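/- Let $(\Omega,\mathcal F,\mathbb P)$ be a probability space carrying two independent standard Brownian motions $B_1,B_3$ on $[0,1]$. Let $\sigma_1,\sigma_2:[0,1]\to(0,\infty)$ and $\rho:[0,1]\to(-1,1)$ be deterministic measurable functions with $\int_0^1\sigma_{\ell,t}^4\,dt<\infty$ for $\ell=1,2$, and let $B_2$ be the Brownian motion given by $dB_{2,t}=\rho_t\,dB_{1,t}+\sqrt{1-\rho_t^2}\,dB_{3,t}$, $B_{2,0}=0$. Let $$dX_{\ell,t}=\sigma_{\ell,t}\,dB_{\ell,t}+b_\ell(t,\omega)\,dt,\qquad \ell=1,2,\quad t\in[0,1].$$ For $n\ge1$ put $\Delta_k^nX_\ell=X_{\ell,k/n}-X_{\ell,(k-1)/n}$ and $$V_1^n(X)=\Big(\sum_{k=1}^n(\Delta_k^nX_1)^2,\ \sum_{k=1}^n(\Delta_k^nX_2)^2,\ \sum_{k=1}^n\Delta_k^nX_1\,\Delta_k^nX_2\Big)^T,$$ $$[V]_1=\Big(\int_0^1\sigma_{1,t}^2dt,\ \int_0^1\sigma_{2,t}^2dt,\ \int_0^1\sigma_{1,t}\sigma_{2,t}\rho_t\,dt\Big)^T.$$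 Assume (B) $b_\ell\in L^\infty(dt\otimes\mathbb P)$ on $[0,1]\times\Omega$ for $\ell=1,2$; (MDP) for $\ell=1,2$ the functions $\sigma_{\ell,t}^2(1-\rho_t^2)$ and $\sigma_{1,t}\sigma_{2,t}(1-\rho_t^2)$ belong to $L^2([0,1],dt)$, and $(b_n)_{n\ge1}$ is a sequence of positive numbers such that, as $n\to\infty$, $b_n\to\infty$, $b_n/\sqrt n\to0$, and $\sqrt n\,b_n\max_{1\le k\le n}\int_{(k-1)/n}^{k/n}\sigma_{\ell,t}^2\,dt\to0$ for $\ell=1,2$. Then the sequence $\frac{\sqrt n}{b_n}\big(V_1^n(X)-[V]_1\big)$ satisfies the large deviation principle on $\mathbb R^3$ with speed $b_n^2$ and rate function $$I_{mdp}(x)=\sup_{\lambda\in\mathbb R^3}\Big(\langle\lambda,x\rangle-\tfrac12\langle\lambda,\Sigma_1\lambda\rangle\Big)=\tfrac12\langle x,\Sigma_1^{-1}x\rangle,$$ where $\Sigma_1$ is the invertible matrix $$\Sigma_1=\begin{pmatrix} \int_0^1 2\sigma_{1,t}^4\,dt & \int_0^1 2\sigma_{1,t}^2\sigma_{2,t}^2\rho_t^2\,dt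 & \int_0^1 2\sigma_{1,t}^3\sigma_{2,t}\rho_t\,dt\\ \int_0^1 2\sigma_{1,t}^2\sigma_{2,t}^2\rho_t^2\,dt & \int_0^1 2\sigma_{2,t}^4\,dt & \int_0^1 2\sigma_{1,t}\sigma_{2,t}^3\rho_t\,dt\\ \int_0^1 2\sigma_{1,t}^3\sigma_{2,t}\rho_t\,dt & \int_0^1 2\sigma_{1,t}\sigma_{2,t}^3\rho_t\,dt & \int_0^1\sigma_{1,t}^2\sigma_{2,t}^2(1+\rho_t^2)\,dt \end{pmatrix}.$$ Here a sequence $M_n$ satisfies the large deviation principle with speed $\lambda_n\to\infty$ and lower semicontinuous rate function $I\ge0$ if for every Borel set $A$, with interior $A^o$ and closure $\bar A$, $$-\inf_{A^o}I\le\liminf_n\tfrac1{\lambda_n}\log\mathbb P(M_n\in A)\le\limsup_n\tfrac1{\lambda_n}\log\mathbb P(M_n\in A)\le-\inf_{\bar A}I.$$ -/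

import Mathlib

open MeasureTheory ProbabilityTheory Filter Set
open scoped Topology ENNReal NNReal Matrix

namespace RealizedVolatility

noncomputable section

/-- Large deviation principle for the random variables `M n` with speed `v n` and rate function
`I : E → [0, +∞]`: the bounds hold for every measurable set `A`, with `log 0 = -∞` and
`inf ∅ = +∞`. -/
structure SatisfiesLDP {Ω E : Type*} [MeasurableSpace Ω] [TopologicalSpace E] [MeasurableSpace E]
    (P : Measure Ω) (M : ℕ → Ω → E) (v : ℕ → ℝ) (I : E → EReal) : Prop where
  aemeasurable : ∀ n, AEMeasurable (M n) P
  speed : Tendsto v atTop atTop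
  nonneg : ∀ x, 0 ≤ I x
  lowerSemicontinuous : LowerSemicontinuous I
  lower : ∀ A : Set E, MeasurableSet A →
    -(⨅ x ∈ interior A, I x) ≤
      liminf (fun n => ((1 / v n : ℝ) : EReal) * ENNReal.log (P {ω | M n ω ∈ A})) atTop
  upper : ∀ A : Set E, MeasurableSet A →
    limsup (fun n => ((1 / v n : ℝ) : EReal) * ENNReal.log (P {ω | M n ω ∈ A})) atTop ≤
      -(⨅ x ∈ closure A, I x)

/-- Standard Brownian motion on the time interval `[0, 1]` (the values of `B` at other times play
no role). -/
structure IsBrownianMotion {Ω : Type*} [MeasurableSpace Ω] (P : Measure Ω) (B : ℝ → Ω → ℝ) :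
    Prop where
  zero : ∀ᵐ ω ∂P, B 0 ω = 0
  indep : HasIndepIncrements (fun (t : Icc (0 : ℝ) 1) ω => B t ω) P
  law : ∀ s ∈ Icc (0 : ℝ) 1, ∀ t ∈ Icc (0 : ℝ) 1, s ≤ t →
    HasLaw (fun ω => B t ω - B s ω) (gaussianReal 0 (t - s).toNNReal) P
  continuous : ∀ᵐ ω ∂P, ContinuousOn (fun t => B t ω) (Icc 0 1)

/-- The step function `∑ i < m, c i • 1_{(s i, s (i+1)]}` on `(0, t]`, with
`0 ≤ s 0 ≤ s 1 ≤ ⋯ ≤ s m ≤ t`. -/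
structure StepFunction (t : ℝ) where
  m : ℕ
  s : ℕ → ℝ
  c : ℕ → ℝ
  mono : Monotone s
  mem : ∀ i, s i ∈ Icc 0 t

namespace StepFunction

variable {t : ℝ}

/-- The value of a step function at `u`. -/
def eval (φ : StepFunction t) (u : ℝ) : ℝ :=
  ∑ i ∈ Finset.range φ.m, (Ioc (φ.s i) (φ.s (i + 1))).indicator (fun _ => φ.c i) u

/-- The elementary stochastic integral `∫₀ᵗ φ dB = ∑ i < m, c i (B_{s (i+1)} - B_{s i})`. -/
def integral {Ω : Type*} (φ : StepFunction t) (B : ℝ → Ω → ℝ) (ω : Ω) : ℝ :=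
  ∑ i ∈ Finset.range φ.m, φ.c i * (B (φ.s (i + 1)) ω - B (φ.s i) ω)

end StepFunction

/-- `Z = ∫₀ᵗ f dB` almost surely, for a deterministic `f ∈ L²([0, t])`: the stochastic integral is
the limit in `L²(P)` of the elementary integrals of step functions that converge to `f` in
`L²([0, t])`. -/
structure IsStochIntegral {Ω : Type*} [MeasurableSpace Ω] (P : Measure Ω) (B : ℝ → Ω → ℝ)
    (f : ℝ → ℝ) (t : ℝ) (Z : Ω → ℝ) : Prop where
  memLp_integrand : MemLp f 2 (volume.restrict (Ioc 0 t))
  memLp : MemLp Z 2 P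
  approx : ∀ ε : ℝ≥0∞, 0 < ε → ∃ φ : StepFunction t,
    eLpNorm (fun u => f u - φ.eval u) 2 (volume.restrict (Ioc 0 t)) < ε ∧
    eLpNorm (fun ω => Z ω - φ.integral B ω) 2 P < ε

/-- `B₁`, `B₂` are standard Brownian motions with instantaneous correlation `ρ`, i.e.
`dB₂ = ρ dB₁ + √(1 - ρ²) dB₃` with a Brownian motion `B₃` independent of `B₁`. -/
structure AreCorrelatedBrownianMotions {Ω : Type*} [MeasurableSpace Ω] (P : Measure Ω)
    (ρ : ℝ → ℝ) (B₁ B₂ B₃ : ℝ → Ω → ℝ) : Prop where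
  brownian₁ : IsBrownianMotion P B₁
  brownian₂ : IsBrownianMotion P B₂
  brownian₃ : IsBrownianMotion P B₃
  indep : IndepFun (fun ω (t : Icc (0 : ℝ) 1) => B₁ t ω) (fun ω (t : Icc (0 : ℝ) 1) => B₃ t ω) P
  decomposition : ∀ t ∈ Icc (0 : ℝ) 1, ∃ Z₁ Z₃ : Ω → ℝ,
    IsStochIntegral P B₁ ρ t Z₁ ∧ IsStochIntegral P B₃ (fun u => √(1 - ρ u ^ 2)) t Z₃ ∧
    ∀ᵐ ω ∂P, B₂ t ω = Z₁ ω + Z₃ ω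

/-- `dX_t = σ_t dB_t + b(t, ω) dt` on `[0, 1]`, i.e. `X_t - X_0 - ∫₀ᵗ b(s, ω) ds = ∫₀ᵗ σ dB`
almost surely, for every `t ∈ [0, 1]`. -/
def IsItoProcess {Ω : Type*} [MeasurableSpace Ω] (P : Measure Ω) (B : ℝ → Ω → ℝ) (σ : ℝ → ℝ)
    (b : ℝ → Ω → ℝ) (X : ℝ → Ω → ℝ) : Prop :=
  ∀ t ∈ Icc (0 : ℝ) 1,
    IsStochIntegral P B σ t (fun ω => X t ω - X 0 ω - ∫ s in (0 : ℝ)..t, b s ω)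

/-- The increment `Δ_k^n X = X_{k/n} - X_{(k-1)/n}`. -/
def increment {Ω : Type*} (X : ℝ → Ω → ℝ) (n k : ℕ) (ω : Ω) : ℝ :=
  X ((k : ℝ) / n) ω - X (((k : ℝ) - 1) / n) ω

/-- Realized covariance `∑_{k=1}^{[nt]} (Δ_k^n X) (Δ_k^n X')`. -/
def realizedCov {Ω : Type*} (X X' : ℝ → Ω → ℝ) (n : ℕ) (t : ℝ) (ω : Ω) : ℝ :=
  ∑ k ∈ Finset.Icc 1 ⌊(n : ℝ) * t⌋₊, increment X n k ω * increment X' n k ω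

/-- The realized (co-)volatility vector `V_t^n(X) = (Q_{1,t}^n(X), Q_{2,t}^n(X), C_t^n(X))`. -/
def realizedVector {Ω : Type*} (X₁ X₂ : ℝ → Ω → ℝ) (n : ℕ) (t : ℝ) (ω : Ω) : Fin 3 → ℝ :=
  ![realizedCov X₁ X₁ n t ω, realizedCov X₂ X₂ n t ω, realizedCov X₁ X₂ n t ω]

/-- The integrated (co-)volatility vector `[V]_t`. -/
def integratedVector (σ₁ σ₂ ρ : ℝ → ℝ) (t : ℝ) : Fin 3 → ℝ :=
  ![∫ s in (0 : ℝ)..t, σ₁ s ^ 2, ∫ s in (0 : ℝ)..t, σ₂ s ^ 2,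
    ∫ s in (0 : ℝ)..t, σ₁ s * σ₂ s * ρ s]

/-- The asymptotic covariance matrix `Σ₁` of the realized (co-)volatility vector at time `1`. -/
def covMatrix (σ₁ σ₂ ρ : ℝ → ℝ) : Matrix (Fin 3) (Fin 3) ℝ :=
  !![∫ t in (0 : ℝ)..1, 2 * σ₁ t ^ 4,
      ∫ t in (0 : ℝ)..1, 2 * σ₁ t ^ 2 * σ₂ t ^ 2 * ρ t ^ 2,
      ∫ t in (0 : ℝ)..1, 2 * σ₁ t ^ 3 * σ₂ t * ρ t;
    ∫ t in (0 : ℝ)..1, 2 * σ₁ t ^ 2 * σ₂ t ^ 2 * ρ t ^ 2,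
      ∫ t in (0 : ℝ)..1, 2 * σ₂ t ^ 4,
      ∫ t in (0 : ℝ)..1, 2 * σ₁ t * σ₂ t ^ 3 * ρ t;
    ∫ t in (0 : ℝ)..1, 2 * σ₁ t ^ 3 * σ₂ t * ρ t,
      ∫ t in (0 : ℝ)..1, 2 * σ₁ t * σ₂ t ^ 3 * ρ t,
      ∫ t in (0 : ℝ)..1, σ₁ t ^ 2 * σ₂ t ^ 2 * (1 + ρ t ^ 2)]

/-- Condition (B) for one drift: `b ∈ L^∞(dt ⊗ P)` on `[0, 1] × Ω`. -/
def BoundedDrift {Ω : Type*} [MeasurableSpace Ω] (P : Measure Ω) (b : ℝ → Ω → ℝ) : Prop :=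
  MemLp (Function.uncurry b) ∞ ((volume.restrict (Icc (0 : ℝ) 1)).prod P)

/-- `√n b_n max_{1 ≤ k ≤ n} ∫_{(k-1)/n}^{k/n} σ_t² dt → 0`. -/
def MaxCondition (σ : ℝ → ℝ) (b : ℕ → ℝ) : Prop :=
  Tendsto (fun n : ℕ => √(n : ℝ) * b n *
    ⨆ k : Fin n, ∫ t in ((k : ℝ) / n)..(((k : ℝ) + 1) / n), σ t ^ 2) atTop (𝓝 0)

/-- Condition (MDP) on the coefficients and on the scale `(b_n)_{n ≥ 1}`. -/
structure MDPCondition (σ₁ σ₂ ρ : ℝ → ℝ) (b : ℕ → ℝ) : Prop where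
  memLp₁ : MemLp (fun t => σ₁ t ^ 2 * (1 - ρ t ^ 2)) 2 (volume.restrict (Icc (0 : ℝ) 1))
  memLp₂ : MemLp (fun t => σ₂ t ^ 2 * (1 - ρ t ^ 2)) 2 (volume.restrict (Icc (0 : ℝ) 1))
  memLp₁₂ : MemLp (fun t => σ₁ t * σ₂ t * (1 - ρ t ^ 2)) 2 (volume.restrict (Icc (0 : ℝ) 1))
  pos : ∀ n, 1 ≤ n → 0 < b n
  tendsto_atTop : Tendsto b atTop atTop
  tendsto_div_sqrt : Tendsto (fun n : ℕ => b n / √(n : ℝ)) atTop (𝓝 0)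
  max₁ : MaxCondition σ₁ b
  max₂ : MaxCondition σ₂ b

end

end RealizedVolatility

open RealizedVolatility

open MeasureTheory ProbabilityTheory Filter Set
open scoped Topology ENNReal NNReal Matrix

namespace RealizedVolatility

/-! ### Large deviations from convergence of the scaled log-Laplace transforms -/

section GartnerEllis

/-! The proof is a Gärtner–Ellis argument in which the Laplace transforms can be computed exactly.
Remove the drifts and let `Z₁`, `Z₂` be the Wiener integrals that remain. All their increments lie
in one closed Gaussian subspace of `L²(P)`, and pairs of increments over different cells are
uncorrelated, hence independent. So the Laplace transform of a quadratic form `A` of the increments,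
with `s = √n b_n`, is a product over the cells of factors `det(I - 2 s A C_k) ^ (-1/2)`, where `C_k`
is the covariance matrix of the increments over cell `k` (`MemL2.lintegral_exp_sum_quadratic`).

Expand the logarithm of each factor (`abs_neg_half_log_sub_le`). The first-order term is `s tr(A
C_k)`, which the centering by `[V]_1` removes. The second-order term is `s² tr(A C_k A C_k)`; after
division by `b_n²` its sum is `n ∑ tr(A C_k A C_k)`. The entries of `C_k` are integrals over cells
of `L²` functions, so this converges to the integral of the spot quantity `tr(A C A C)`, which is
`½⟨l, Σ₁ l⟩` (`tendsto_mul_sum_cellIntegral_mul`, `half_quadratic_covMatrix`). The maximum condition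
makes the cubic remainder vanish. Since the spot quantity is a sum of squares that vanishes only for
`A = 0`, the matrix `Σ₁` is positive definite.

A bounded drift changes each increment by `O(1/n)`, and so moves the normalized error `D` by at most
`ε_n (1 + ‖D‖)` with `ε_n → 0` (`norm_normalizedError_sub_le`). The large deviation bounds
(`upper_bound`, `lower_bound`) are proved directly for such relative perturbations. The upper bound
covers a closed set by finitely many half spaces in a way that tolerates the perturbation; the lower
bound tilts the measure, and a further small tilt shows that the tilted mass concentrates near the
target point. -/

/-- A prefactor `C` is invisible on the logarithmic scale because `log C / v n → 0`. This lets the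
estimates below lose constants, such as the number of half spaces in a cover. -/
lemma limsup_log_le_of_eventually_le {v : ℕ → ℝ} (hv : Tendsto v atTop atTop) {p : ℕ → ℝ≥0∞}
    {J : ℝ} (h : ∀ η > 0, ∃ C : ℝ, 0 < C ∧
      ∀ᶠ n in atTop, p n ≤ ENNReal.ofReal (C * Real.exp (v n * (-J + η)))) :
    limsup (fun n => ((1 / v n : ℝ) : EReal) * ENNReal.log (p n)) atTop ≤ ((-J : ℝ) : EReal) := by
  refine EReal.le_of_forall_lt_iff_le.1 fun z hz => ?_
  have hz' : -J < z := by exact_mod_cast hz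
  obtain ⟨C, hC, hev⟩ := h ((z + J) / 2) (by linarith)
  refine limsup_le_of_le (by isBoundedDefault) ?_
  have hlim : Tendsto (fun n => Real.log C / v n) atTop (𝓝 0) := hv.const_div_atTop _
  filter_upwards [hev, hv.eventually_gt_atTop 0,
    hlim.eventually_lt_const (show 0 < (z + J) / 2 by linarith)] with n hn hvn hsmall
  calc ((1 / v n : ℝ) : EReal) * ENNReal.log (p n)
      ≤ ((1 / v n : ℝ) : EReal)
          * ENNReal.log (ENNReal.ofReal (C * Real.exp (v n * (-J + (z + J) / 2)))) := by
        refine mul_le_mul_of_nonneg_left (ENNReal.log_le_log hn) ?_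
        exact_mod_cast (by positivity : (0 : ℝ) ≤ 1 / v n)
    _ = ((1 / v n * (Real.log C + v n * (-J + (z + J) / 2)) : ℝ) : EReal) := by
        rw [ENNReal.log_ofReal_of_pos (by positivity), Real.log_mul hC.ne' (Real.exp_ne_zero _),
          Real.log_exp, ← EReal.coe_mul]
    _ ≤ z := by
        rw [EReal.coe_le_coe_iff]
        have : 1 / v n * (Real.log C + v n * (-J + (z + J) / 2))
            = Real.log C / v n + (-J + (z + J) / 2) := by field_simp
        rw [this]
        linarith

lemma le_liminf_log_of_eventually_le {v : ℕ → ℝ} (hv : Tendsto v atTop atTop) {p : ℕ → ℝ≥0∞}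
    {J : ℝ} (h : ∀ η > 0, ∃ C : ℝ, 0 < C ∧
      ∀ᶠ n in atTop, ENNReal.ofReal (C * Real.exp (v n * (-J - η))) ≤ p n) :
    ((-J : ℝ) : EReal) ≤ liminf (fun n => ((1 / v n : ℝ) : EReal) * ENNReal.log (p n)) atTop := by
  refine EReal.ge_of_forall_gt_iff_ge.1 fun z hz => ?_
  have hz' : z < -J := by exact_mod_cast hz
  obtain ⟨C, hC, hev⟩ := h ((-J - z) / 2) (by linarith)
  refine le_liminf_of_le (by isBoundedDefault) ?_
  have hlim : Tendsto (fun n => Real.log C / v n) atTop (𝓝 0) := hv.const_div_atTop _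
  filter_upwards [hev, hv.eventually_gt_atTop 0,
    hlim.eventually_const_lt (show -((-J - z) / 2) < 0 by linarith)] with n hn hvn hsmall
  calc (z : EReal)
      ≤ ((1 / v n * (Real.log C + v n * (-J - (-J - z) / 2)) : ℝ) : EReal) := by
        rw [EReal.coe_le_coe_iff]
        have : 1 / v n * (Real.log C + v n * (-J - (-J - z) / 2))
            = Real.log C / v n + (-J - (-J - z) / 2) := by field_simp
        rw [this]
        linarith
    _ = ((1 / v n : ℝ) : EReal)
          * ENNReal.log (ENNReal.ofReal (C * Real.exp (v n * (-J - (-J - z) / 2)))) := by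
        rw [ENNReal.log_ofReal_of_pos (by positivity), Real.log_mul hC.ne' (Real.exp_ne_zero _),
          Real.log_exp, ← EReal.coe_mul]
    _ ≤ ((1 / v n : ℝ) : EReal) * ENNReal.log (p n) := by
        refine mul_le_mul_of_nonneg_left (ENNReal.log_le_log hn) ?_
        exact_mod_cast (by positivity : (0 : ℝ) ≤ 1 / v n)

variable {ι : Type*} [Fintype ι] [DecidableEq ι]

/-- The vectors `± e i` of the standard basis. -/
def signedBasis (p : ι × Bool) : ι → ℝ := Pi.single p.1 (if p.2 then 1 else -1)

lemma signedBasis_dotProduct (p : ι × Bool) (y : ι → ℝ) :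
    signedBasis p ⬝ᵥ y = (if p.2 then 1 else -1) * y p.1 := by
  simp [signedBasis, single_dotProduct]

/-- The norm is the sup norm, so the complement of an open ball is a union of finitely many half
spaces. This is what lets exponential Chebyshev bounds control it. -/
lemma exists_le_signedBasis_dotProduct {y : ι → ℝ} {δ : ℝ} (hδ : 0 < δ) (h : δ ≤ ‖y‖) :
    ∃ p : ι × Bool, δ ≤ signedBasis p ⬝ᵥ y := by
  by_contra! hcon
  refine absurd h (not_le.2 ((pi_norm_lt_iff hδ).2 fun i => ?_))
  have h1 := hcon (i, true)
  have h2 := hcon (i, false)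
  simp only [signedBasis_dotProduct, if_true, one_mul, Bool.false_eq_true, if_false] at h1 h2
  rw [Real.norm_eq_abs, abs_lt]
  constructor <;> linarith

omit [DecidableEq ι] in
lemma abs_dotProduct_le_sum_mul_norm (l y : ι → ℝ) : |l ⬝ᵥ y| ≤ (∑ i, |l i|) * ‖y‖ := by
  rw [dotProduct, Finset.sum_mul]
  refine (Finset.abs_sum_le_sum_abs _ _).trans (Finset.sum_le_sum fun i _ => ?_)
  rw [abs_mul]
  exact mul_le_mul_of_nonneg_left (norm_le_pi_norm y i) (abs_nonneg _)

/-! ### The Legendre transform of a positive definite quadratic form. -/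

section LegendreTransform

variable {S : Matrix ι ι ℝ}

lemma mul_inv_mulVec (hS : S.PosDef) (x : ι → ℝ) : S *ᵥ (S⁻¹ *ᵥ x) = x := by
  rw [Matrix.mulVec_mulVec, Matrix.mul_nonsing_inv _ ((Matrix.isUnit_iff_isUnit_det _).1 hS.isUnit),
    Matrix.one_mulVec]

omit [DecidableEq ι] in
lemma dotProduct_mulVec_symm (hS : S.PosDef) (x y : ι → ℝ) : x ⬝ᵥ (S *ᵥ y) = y ⬝ᵥ (S *ᵥ x) := by
  have h : Sᵀ = S := by simpa using hS.isHermitian.eq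
  rw [Matrix.dotProduct_mulVec, dotProduct_comm, ← Matrix.mulVec_transpose, h]

omit [DecidableEq ι] in
lemma quadratic_add_smul (hS : S.PosDef) (l e : ι → ℝ) (ε : ℝ) :
    1 / 2 * ((l + ε • e) ⬝ᵥ (S *ᵥ (l + ε • e)))
      = 1 / 2 * (l ⬝ᵥ (S *ᵥ l)) + ε * (e ⬝ᵥ (S *ᵥ l)) + ε ^ 2 / 2 * (e ⬝ᵥ (S *ᵥ e)) := by
  simp only [Matrix.mulVec_add, Matrix.mulVec_smul, add_dotProduct, dotProduct_add, smul_dotProduct,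
    dotProduct_smul, smul_eq_mul]
  rw [dotProduct_mulVec_symm hS l e]
  ring

lemma dotProduct_sub_quadratic_inv (hS : S.PosDef) (x : ι → ℝ) :
    (S⁻¹ *ᵥ x) ⬝ᵥ x - 1 / 2 * ((S⁻¹ *ᵥ x) ⬝ᵥ (S *ᵥ (S⁻¹ *ᵥ x)))
      = 1 / 2 * (x ⬝ᵥ (S⁻¹ *ᵥ x)) := by
  rw [mul_inv_mulVec hS, dotProduct_comm]
  ring

/-- Completing the square around the maximizer `m = S⁻¹ x`: the deficit is `½⟨l - m, S (l - m)⟩ ≥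
0`. -/
lemma dotProduct_sub_quadratic_le (hS : S.PosDef) (x l : ι → ℝ) :
    l ⬝ᵥ x - 1 / 2 * (l ⬝ᵥ (S *ᵥ l)) ≤ 1 / 2 * (x ⬝ᵥ (S⁻¹ *ᵥ x)) := by
  set m := S⁻¹ *ᵥ x with hm
  have hx : S *ᵥ m = x := mul_inv_mulVec hS x
  have h := quadratic_add_smul hS m (l - m) 1
  have hnn : 0 ≤ (l - m) ⬝ᵥ (S *ᵥ (l - m)) := by
    simpa using hS.posSemidef.dotProduct_mulVec_nonneg (l - m)
  have e1 : m + (1 : ℝ) • (l - m) = l := by simp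
  rw [e1, hx, sub_dotProduct] at h
  rw [dotProduct_comm x m]
  nlinarith

theorem isLUB_dotProduct_sub_quadratic (hS : S.PosDef) (x : ι → ℝ) :
    IsLUB (range fun l : ι → ℝ => l ⬝ᵥ x - (1 / 2) * (l ⬝ᵥ (S *ᵥ l)))
      ((1 / 2) * (x ⬝ᵥ (S⁻¹ *ᵥ x))) := by
  refine IsGreatest.isLUB ⟨⟨S⁻¹ *ᵥ x, dotProduct_sub_quadratic_inv hS x⟩, ?_⟩
  rintro _ ⟨l, rfl⟩
  exact dotProduct_sub_quadratic_le hS x l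

/-- A closed set on which the Legendre transform exceeds `J` is covered, robustly under a relative
perturbation, by finitely many half spaces `{y | J + ½⟨l, S l⟩ ≤ ⟨l, y⟩}`. -/
lemma exists_finite_halfSpace_cover (hS : S.PosDef) {F : Set (ι → ℝ)} (hF : IsClosed F) {J : ℝ}
    (hJ : ∀ x ∈ F, J < 1 / 2 * (x ⬝ᵥ (S⁻¹ *ᵥ x))) :
    ∃ H : Finset (ι → ℝ), ∃ ε > 0, ∀ y, ∀ z ∈ F, ‖z - y‖ ≤ ε * (1 + ‖y‖) →
      ∃ l ∈ H, J + 1 / 2 * (l ⬝ᵥ (S *ᵥ l)) ≤ l ⬝ᵥ y := by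
  classical
  -- Outside the ball of radius `R` the half spaces of the signed basis vectors suffice, so
  -- compactness is needed only inside.
  obtain ⟨R₀, hR₀⟩ := (Set.finite_range fun p : ι × Bool =>
    J + 1 / 2 * (signedBasis p ⬝ᵥ (S *ᵥ signedBasis p))).bddAbove
  set R := max R₀ 1
  have hR1 : 1 ≤ R := le_max_right _ _
  -- The radius `R + 1` leaves room for `z`, which is within `1/2` of a `y` in the ball of radius
  -- `R`.
  have hK : IsCompact (F ∩ Metric.closedBall 0 (R + 1)) :=
    (isCompact_closedBall _ _).inter_left hF
  let U : (ι → ℝ) → Set (ι → ℝ) := fun l => {y | J + 1 / 2 * (l ⬝ᵥ (S *ᵥ l)) < l ⬝ᵥ y}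
  have hU : ∀ l, IsOpen (U l) := fun l =>
    isOpen_lt continuous_const (continuous_const.dotProduct continuous_id)
  obtain ⟨H, hH⟩ := hK.elim_finite_subcover U hU fun x hx => by
    refine mem_iUnion.2 ⟨S⁻¹ *ᵥ x, ?_⟩
    have h1 := hJ x hx.1
    have h2 := dotProduct_sub_quadratic_inv hS x
    simp only [U, mem_ofPred_eq]
    linarith
  -- The finite cover of the compact part also covers a `δ`-neighbourhood of it, which absorbs the
  -- perturbation from `z` to `y`.
  obtain ⟨δ, hδ, hthick⟩ := hK.exists_thickening_subset_open
    (isOpen_biUnion fun l (_ : l ∈ H) => hU l) hH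
  refine ⟨H ∪ Finset.univ.image signedBasis, min δ 1 / 2 / (1 + R), by positivity,
    fun y z hz hzy => ?_⟩
  rcases le_or_gt ‖y‖ R with hy | hy
  · have hzy' : ‖z - y‖ ≤ min δ 1 / 2 := by
      calc ‖z - y‖ ≤ min δ 1 / 2 / (1 + R) * (1 + ‖y‖) := hzy
        _ ≤ min δ 1 / 2 / (1 + R) * (1 + R) := by gcongr
        _ = min δ 1 / 2 := by field_simp
    have h1 := min_le_left δ 1
    have h2 := min_le_right δ 1
    have hzK : z ∈ F ∩ Metric.closedBall 0 (R + 1) := by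
      refine ⟨hz, ?_⟩
      rw [mem_closedBall_zero_iff]
      have := norm_sub_norm_le z y
      linarith
    have hyt : y ∈ Metric.thickening δ (F ∩ Metric.closedBall 0 (R + 1)) := by
      rw [Metric.mem_thickening_iff]
      refine ⟨z, hzK, ?_⟩
      rw [dist_comm, dist_eq_norm]
      linarith
    obtain ⟨l, hl, hyl⟩ := mem_iUnion₂.1 (hthick hyt)
    exact ⟨l, Finset.mem_union_left _ hl, le_of_lt hyl⟩
  · obtain ⟨p, hp⟩ := exists_le_signedBasis_dotProduct (by linarith) hy.le
    refine ⟨signedBasis p, Finset.mem_union_right _ (by simp), le_trans ?_ hp⟩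
    exact (hR₀ ⟨p, rfl⟩).trans (le_max_left _ _)

end LegendreTransform

end GartnerEllis

/-! ### Large deviation bounds from a quadratic log-Laplace limit. -/

section GartnerEllis

variable {ι : Type*} [Fintype ι]

/-- The scaled log-Laplace transforms `v_n⁻¹ log E exp(v_n ⟨l, D_n⟩)` converge to the quadratic
form `½⟨l, S l⟩`. -/
def HasQuadraticLogLaplaceLimit {Ω : Type*} [MeasurableSpace Ω] (P : Measure Ω)
    (D : ℕ → Ω → ι → ℝ) (v : ℕ → ℝ) (S : Matrix ι ι ℝ) : Prop :=
  ∀ l : ι → ℝ, ∃ Λ : ℕ → ℝ, Tendsto Λ atTop (𝓝 (1 / 2 * (l ⬝ᵥ (S *ᵥ l)))) ∧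
    ∀ᶠ n in atTop, ∫⁻ ω, ENNReal.ofReal (Real.exp (v n * (l ⬝ᵥ D n ω))) ∂P
      = ENNReal.ofReal (Real.exp (v n * Λ n))

variable {Ω : Type*} [MeasurableSpace Ω] {P : Measure Ω} {D : ℕ → Ω → ι → ℝ} {v : ℕ → ℝ}
  {S : Matrix ι ι ℝ}

namespace HasQuadraticLogLaplaceLimit

lemma eventually_lintegral_le (h : HasQuadraticLogLaplaceLimit P D v S)
    (hv : Tendsto v atTop atTop) (l : ι → ℝ) {η : ℝ} (hη : 0 < η) :
    ∀ᶠ n in atTop, ∫⁻ ω, ENNReal.ofReal (Real.exp (v n * (l ⬝ᵥ D n ω))) ∂P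
      ≤ ENNReal.ofReal (Real.exp (v n * (1 / 2 * (l ⬝ᵥ (S *ᵥ l)) + η))) := by
  obtain ⟨Λ, hΛ, hev⟩ := h l
  filter_upwards [hev, hv.eventually_gt_atTop 0, hΛ.eventually_lt_const (lt_add_of_pos_right _ hη)]
    with n hn hvn hlt
  rw [hn]
  gcongr

lemma eventually_le_lintegral (h : HasQuadraticLogLaplaceLimit P D v S)
    (hv : Tendsto v atTop atTop) (l : ι → ℝ) {η : ℝ} (hη : 0 < η) :
    ∀ᶠ n in atTop, ENNReal.ofReal (Real.exp (v n * (1 / 2 * (l ⬝ᵥ (S *ᵥ l)) - η)))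
      ≤ ∫⁻ ω, ENNReal.ofReal (Real.exp (v n * (l ⬝ᵥ D n ω))) ∂P := by
  obtain ⟨Λ, hΛ, hev⟩ := h l
  filter_upwards [hev, hv.eventually_gt_atTop 0, hΛ.eventually_const_lt (sub_lt_self _ hη)]
    with n hn hvn hlt
  rw [hn]
  gcongr

lemma aemeasurable_dotProduct (hD : ∀ n, AEMeasurable (D n) P) (n : ℕ) (l : ι → ℝ) :
    AEMeasurable (fun ω => l ⬝ᵥ D n ω) P := by
  have : Measurable fun x : ι → ℝ => l ⬝ᵥ x := by
    simp only [dotProduct]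
    fun_prop
  exact this.comp_aemeasurable (hD n)

/-- Exponential Chebyshev inequality for a half space. -/
lemma eventually_measure_halfSpace_le (h : HasQuadraticLogLaplaceLimit P D v S)
    (hv : Tendsto v atTop atTop) (hD : ∀ n, AEMeasurable (D n) P) (l : ι → ℝ) (J : ℝ) {η : ℝ}
    (hη : 0 < η) :
    ∀ᶠ n in atTop, P {ω | J + 1 / 2 * (l ⬝ᵥ (S *ᵥ l)) ≤ l ⬝ᵥ D n ω}
      ≤ ENNReal.ofReal (Real.exp (v n * (-J + η))) := by
  filter_upwards [h.eventually_lintegral_le hv l hη, hv.eventually_gt_atTop 0] with n hn hvn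
  set c := J + 1 / 2 * (l ⬝ᵥ (S *ᵥ l)) with hc
  have hmeas : AEMeasurable (fun ω => ENNReal.ofReal (Real.exp (v n * (l ⬝ᵥ D n ω)))) P :=
    (Real.measurable_exp.comp_aemeasurable
      ((aemeasurable_dotProduct hD n l).const_mul _)).ennreal_ofReal
  have hmk := mul_meas_ge_le_lintegral₀ hmeas (ENNReal.ofReal (Real.exp (v n * c)))
  have hset : {ω | ENNReal.ofReal (Real.exp (v n * c))
      ≤ ENNReal.ofReal (Real.exp (v n * (l ⬝ᵥ D n ω)))} = {ω | c ≤ l ⬝ᵥ D n ω} := by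
    ext ω
    simp only [mem_ofPred_eq]
    rw [ENNReal.ofReal_le_ofReal_iff (Real.exp_nonneg _), Real.exp_le_exp,
      mul_le_mul_iff_right₀ hvn]
  rw [hset] at hmk
  have hexp : v n * (1 / 2 * (l ⬝ᵥ (S *ᵥ l)) + η) = v n * c + v n * (-J + η) := by
    rw [hc]
    ring
  rw [hexp, Real.exp_add, ENNReal.ofReal_mul (Real.exp_nonneg _)] at hn
  refine (ENNReal.mul_le_mul_iff_right (a := ENNReal.ofReal (Real.exp (v n * c))) ?_ ?_).1
    (hmk.trans hn)
  · simpa using Real.exp_pos _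
  · exact ENNReal.ofReal_ne_top

variable [DecidableEq ι]

/-- Upper bound on closed sets for a perturbation `M` of `D`. -/
lemma upper_bound (h : HasQuadraticLogLaplaceLimit P D v S)
    (hv : Tendsto v atTop atTop) (hD : ∀ n, AEMeasurable (D n) P) (hS : S.PosDef)
    {M : ℕ → Ω → ι → ℝ} {ε : ℕ → ℝ} (hε : Tendsto ε atTop (𝓝 0))
    (hM : ∀ n, ∀ᵐ ω ∂P, ‖M n ω - D n ω‖ ≤ ε n * (1 + ‖D n ω‖))
    {F : Set (ι → ℝ)} (hF : IsClosed F) {J : ℝ}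
    (hJ : ∀ x ∈ F, J < 1 / 2 * (x ⬝ᵥ (S⁻¹ *ᵥ x))) :
    limsup (fun n => ((1 / v n : ℝ) : EReal) * ENNReal.log (P {ω | M n ω ∈ F})) atTop
      ≤ ((-J : ℝ) : EReal) := by
  obtain ⟨H, ε₀, hε₀, hH⟩ := exists_finite_halfSpace_cover hS hF hJ
  refine limsup_log_le_of_eventually_le hv fun η hη => ⟨H.card + 1, by positivity, ?_⟩
  have hev : ∀ᶠ n in atTop, ∀ l ∈ H, P {ω | J + 1 / 2 * (l ⬝ᵥ (S *ᵥ l)) ≤ l ⬝ᵥ D n ω}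
      ≤ ENNReal.ofReal (Real.exp (v n * (-J + η))) :=
    (Finset.eventually_all _).2 fun l _ => h.eventually_measure_halfSpace_le hv hD l J hη
  filter_upwards [hev, hε.eventually_lt_const hε₀] with n hn hεn
  calc P {ω | M n ω ∈ F}
      ≤ P (⋃ l ∈ H, {ω | J + 1 / 2 * (l ⬝ᵥ (S *ᵥ l)) ≤ l ⬝ᵥ D n ω}) := by
        refine measure_mono_ae ?_
        filter_upwards [hM n] with ω hω hωF
        obtain ⟨l, hl, hle⟩ := hH (D n ω) (M n ω) hωF (hω.trans (by gcongr))
        exact mem_iUnion₂.2 ⟨l, hl, hle⟩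
    _ ≤ ∑ l ∈ H, P {ω | J + 1 / 2 * (l ⬝ᵥ (S *ᵥ l)) ≤ l ⬝ᵥ D n ω} :=
        measure_biUnion_finset_le _ _
    _ ≤ ∑ l ∈ H, ENNReal.ofReal (Real.exp (v n * (-J + η))) := Finset.sum_le_sum hn
    _ = ENNReal.ofReal (H.card * Real.exp (v n * (-J + η))) := by
        rw [Finset.sum_const, nsmul_eq_mul, ENNReal.ofReal_mul (by positivity),
          ENNReal.ofReal_natCast]
    _ ≤ ENNReal.ofReal ((H.card + 1) * Real.exp (v n * (-J + η))) := by
        gcongr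
        linarith

/-- Lower bound on balls, by an exponential change of measure. -/
lemma eventually_le_measure_ball (h : HasQuadraticLogLaplaceLimit P D v S)
    (hv : Tendsto v atTop atTop) (hD : ∀ n, AEMeasurable (D n) P) (hS : S.PosDef)
    (x : ι → ℝ) {δ η : ℝ} (hδ : 0 < δ) (hη : 0 < η) :
    ∀ᶠ n in atTop,
      ENNReal.ofReal (1 / 2 * Real.exp (v n * (-(1 / 2 * (x ⬝ᵥ (S⁻¹ *ᵥ x))) - η)))
        ≤ P {ω | ‖D n ω - x‖ < δ} := by
  classical
  set l := S⁻¹ *ᵥ x with hl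
  have hSl : S *ᵥ l = x := mul_inv_mulVec hS x
  have hI := dotProduct_sub_quadratic_inv hS x
  rw [← hl, hSl] at hI
  set N := ∑ i, |l i| with hN
  have hN0 : 0 ≤ N := Finset.sum_nonneg fun _ _ => abs_nonneg _
  -- shrink the ball so that `⟨l, ·⟩` varies little on it
  obtain ⟨δ', hδ'0, hδ'δ, hδ'N⟩ : ∃ δ' > 0, δ' ≤ δ ∧ N * δ' ≤ η / 2 := by
    refine ⟨min δ (η / (2 * (N + 1))), by positivity, min_le_left _ _, ?_⟩
    calc N * min δ (η / (2 * (N + 1))) ≤ (N + 1) * (η / (2 * (N + 1))) := by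
          gcongr
          · linarith
          · exact min_le_right _ _
      _ = η / 2 := by field_simp
  -- the size of the additional tilt
  obtain ⟨R₀, hR₀⟩ := (Set.finite_range fun p : ι × Bool =>
    signedBasis p ⬝ᵥ (S *ᵥ signedBasis p)).bddAbove
  set R := max R₀ 1
  have hR : ∀ p : ι × Bool, signedBasis p ⬝ᵥ (S *ᵥ signedBasis p) ≤ R := fun p =>
    (hR₀ ⟨p, rfl⟩).trans (le_max_left _ _)
  have hR1 : 1 ≤ R := le_max_right _ _
  -- The extra tilt by `ε e` gains `ε δ'` where `⟨e, D - x⟩ ≥ δ'`. It costs a second-order term of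
  -- at most `ε δ' / 4` by the first condition, and `ε δ' / 4` for the error in the Laplace
  -- transform. The net exponent is at most `q - ε δ' / 2`, against at least `q - ε δ' / 4` for the
  -- total tilted mass. The second condition keeps the final loss below `η`.
  obtain ⟨ε, hε0, hεR, hεη⟩ : ∃ ε > 0, ε * R ≤ δ' / 2 ∧ ε * δ' / 4 ≤ η / 4 := by
    refine ⟨min (δ' / (2 * R)) (η / δ'), by positivity, ?_, ?_⟩
    · calc min (δ' / (2 * R)) (η / δ') * R ≤ δ' / (2 * R) * R := by
            gcongr
            exact min_le_left _ _
        _ = δ' / 2 := by field_simp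
    · calc min (δ' / (2 * R)) (η / δ') * δ' / 4 ≤ η / δ' * δ' / 4 := by
            gcongr
            exact min_le_right _ _
        _ = η / 4 := by field_simp
  set q := 1 / 2 * (l ⬝ᵥ x) with hq
  have hev : ∀ᶠ n in atTop, ∀ p : ι × Bool,
      ∫⁻ ω, ENNReal.ofReal (Real.exp (v n * ((l + ε • signedBasis p) ⬝ᵥ D n ω))) ∂P
        ≤ ENNReal.ofReal (Real.exp (v n * (1 / 2 * ((l + ε • signedBasis p) ⬝ᵥ
          (S *ᵥ (l + ε • signedBasis p))) + ε * δ' / 4))) :=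
    eventually_all.2 fun p => h.eventually_lintegral_le hv _ (by positivity)
  have hsmall : ∀ᶠ n in atTop,
      Fintype.card (ι × Bool) * Real.exp (-(v n * (ε * δ' / 4))) ≤ 1 / 2 := by
    have h1 : Tendsto (fun n => Fintype.card (ι × Bool) * Real.exp (-(v n * (ε * δ' / 4))))
        atTop (𝓝 (Fintype.card (ι × Bool) * 0)) :=
      (Real.tendsto_exp_neg_atTop_nhds_zero.comp
        (hv.atTop_mul_const (by positivity))).const_mul _
    rw [mul_zero] at h1
    exact h1.eventually_le_const (by norm_num)
  filter_upwards [hev, hsmall, h.eventually_le_lintegral hv l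
    (show 0 < ε * δ' / 4 by positivity), hv.eventually_gt_atTop 0] with n hup hsm hlow hvn
  rw [hSl] at hlow
  have hmeas : ∀ p : ι × Bool, AEMeasurable (fun ω => ENNReal.ofReal (Real.exp (v n *
      ((l + ε • signedBasis p) ⬝ᵥ D n ω)))) P := fun p =>
    (Real.measurable_exp.comp_aemeasurable
      ((aemeasurable_dotProduct hD n _).const_mul _)).ennreal_ofReal
  -- the tilted mass of the complement of the ball
  let g : ι × Bool → Ω → ℝ≥0∞ := fun p ω =>
    ENNReal.ofReal (Real.exp (-(v n * (ε * (signedBasis p ⬝ᵥ x + δ'))))) *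
      ENNReal.ofReal (Real.exp (v n * ((l + ε • signedBasis p) ⬝ᵥ D n ω)))
  have hg : ∀ p, ∫⁻ ω, g p ω ∂P ≤ ENNReal.ofReal (Real.exp (v n * (q - ε * δ' / 2))) := by
    intro p
    calc ∫⁻ ω, g p ω ∂P
        = ENNReal.ofReal (Real.exp (-(v n * (ε * (signedBasis p ⬝ᵥ x + δ'))))) *
            ∫⁻ ω, ENNReal.ofReal (Real.exp (v n * ((l + ε • signedBasis p) ⬝ᵥ D n ω))) ∂P :=
          lintegral_const_mul'' _ (hmeas p)
      _ ≤ ENNReal.ofReal (Real.exp (-(v n * (ε * (signedBasis p ⬝ᵥ x + δ'))))) *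
            ENNReal.ofReal (Real.exp (v n * (1 / 2 * ((l + ε • signedBasis p) ⬝ᵥ
              (S *ᵥ (l + ε • signedBasis p))) + ε * δ' / 4))) := by
          gcongr
          exact hup p
      _ ≤ ENNReal.ofReal (Real.exp (v n * (q - ε * δ' / 2))) := by
          rw [← ENNReal.ofReal_mul (Real.exp_nonneg _), ← Real.exp_add,
            quadratic_add_smul hS, hSl, ← hq]
          refine ENNReal.ofReal_le_ofReal (Real.exp_le_exp.2 ?_)
          rw [← mul_neg, ← mul_add]
          refine mul_le_mul_of_nonneg_left ?_ hvn.le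
          have h1 : ε ^ 2 / 2 * (signedBasis p ⬝ᵥ (S *ᵥ signedBasis p)) ≤ ε * δ' / 4 := by
            calc ε ^ 2 / 2 * (signedBasis p ⬝ᵥ (S *ᵥ signedBasis p)) ≤ ε ^ 2 / 2 * R := by
                  gcongr
                  exact hR p
              _ = ε / 2 * (ε * R) := by ring
              _ ≤ ε / 2 * (δ' / 2) := by gcongr
              _ = ε * δ' / 4 := by ring
          linarith
  set c := l ⬝ᵥ x + N * δ' with hc
  let B := {ω | ‖D n ω - x‖ < δ'}
  -- Off the ball some signed basis vector `e` has `⟨e, D - x⟩ ≥ δ'`, so the factor `exp (v ε (⟨e, D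
  -- - x⟩ - δ'))` that distinguishes `g p` from the left side is at least one.
  have hpt : ∀ ω, ENNReal.ofReal (Real.exp (v n * (l ⬝ᵥ D n ω)))
      ≤ B.indicator (fun _ => ENNReal.ofReal (Real.exp (v n * c))) ω + ∑ p, g p ω := by
    intro ω
    have hdec : D n ω = x + (D n ω - x) := by abel
    by_cases hω : ω ∈ B
    · rw [indicator_of_mem hω]
      refine le_add_right (ENNReal.ofReal_le_ofReal (Real.exp_le_exp.2 ?_))
      refine mul_le_mul_of_nonneg_left ?_ hvn.le
      rw [hdec, dotProduct_add, hc]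
      have h1 := (le_abs_self _).trans (abs_dotProduct_le_sum_mul_norm l (D n ω - x))
      have h2 : N * ‖D n ω - x‖ ≤ N * δ' := by
        gcongr
        exact le_of_lt hω
      linarith
    · obtain ⟨p, hp⟩ := exists_le_signedBasis_dotProduct hδ'0 (not_lt.1 hω)
      refine le_add_left (le_trans ?_ (Finset.single_le_sum (f := fun p => g p ω)
        (fun _ _ => zero_le) (Finset.mem_univ p)))
      simp only [g]
      rw [← ENNReal.ofReal_mul (Real.exp_nonneg _), ← Real.exp_add]
      refine ENNReal.ofReal_le_ofReal (Real.exp_le_exp.2 ?_)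
      rw [add_dotProduct, smul_dotProduct, smul_eq_mul]
      rw [dotProduct_sub] at hp
      have h1 : 0 ≤ v n * (ε * (signedBasis p ⬝ᵥ D n ω - signedBasis p ⬝ᵥ x - δ')) := by
        have : 0 ≤ signedBasis p ⬝ᵥ D n ω - signedBasis p ⬝ᵥ x - δ' := by linarith
        positivity
      nlinarith
  have hint : ENNReal.ofReal (Real.exp (v n * (q - ε * δ' / 4)))
      ≤ ENNReal.ofReal (Real.exp (v n * c)) * P B
        + ENNReal.ofReal (1 / 2 * Real.exp (v n * (q - ε * δ' / 4))) := by
    calc ENNReal.ofReal (Real.exp (v n * (q - ε * δ' / 4)))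
        ≤ ∫⁻ ω, B.indicator (fun _ => ENNReal.ofReal (Real.exp (v n * c))) ω
            + ∑ p, g p ω ∂P := hlow.trans (lintegral_mono hpt)
      _ = ∫⁻ ω, B.indicator (fun _ => ENNReal.ofReal (Real.exp (v n * c))) ω ∂P
            + ∑ p, ∫⁻ ω, g p ω ∂P := by
          rw [lintegral_add_right', lintegral_finsetSum']
          · exact fun p _ => (hmeas p).const_mul _
          · exact Finset.aemeasurable_fun_sum _ fun p _ => (hmeas p).const_mul _
      _ ≤ ENNReal.ofReal (Real.exp (v n * c)) * P B
            + ∑ p : ι × Bool, ENNReal.ofReal (Real.exp (v n * (q - ε * δ' / 2))) :=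
          add_le_add (lintegral_indicator_const_le _ _) (Finset.sum_le_sum fun p _ => hg p)
      _ ≤ _ := by
          gcongr
          rw [Finset.sum_const, Finset.card_univ, nsmul_eq_mul, ← ENNReal.ofReal_natCast,
            ← ENNReal.ofReal_mul (by positivity)]
          refine ENNReal.ofReal_le_ofReal ?_
          have : v n * (q - ε * δ' / 2) = -(v n * (ε * δ' / 4)) + v n * (q - ε * δ' / 4) := by ring
          rw [this, Real.exp_add, ← mul_assoc]
          gcongr
  -- At most half of the tilted mass lies off the ball, so the ball carries the other half.
  have hhalf : ENNReal.ofReal (1 / 2 * Real.exp (v n * (q - ε * δ' / 4)))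
      ≤ ENNReal.ofReal (Real.exp (v n * c)) * P B := by
    have h1 : Real.exp (v n * (q - ε * δ' / 4)) = 1 / 2 * Real.exp (v n * (q - ε * δ' / 4))
        + 1 / 2 * Real.exp (v n * (q - ε * δ' / 4)) := by ring
    rw [h1, ENNReal.ofReal_add (by positivity) (by positivity)] at hint
    rw [← h1] at hint
    exact (ENNReal.add_le_add_iff_right ENNReal.ofReal_ne_top).1 hint
  have hPB : P B ≤ P {ω | ‖D n ω - x‖ < δ} := measure_mono fun ω hω => lt_of_lt_of_le hω hδ'δ
  refine le_trans ?_ hPB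
  refine (ENNReal.mul_le_mul_iff_right (a := ENNReal.ofReal (Real.exp (v n * c))) ?_ ?_).1
    (le_trans ?_ hhalf)
  · simpa using Real.exp_pos _
  · exact ENNReal.ofReal_ne_top
  · rw [← ENNReal.ofReal_mul (Real.exp_nonneg _)]
    refine ENNReal.ofReal_le_ofReal ?_
    have h1 : Real.exp (v n * c) * (1 / 2 * Real.exp (v n * (-(1 / 2 * (x ⬝ᵥ l)) - η)))
        = 1 / 2 * Real.exp (v n * (c + (-(1 / 2 * (x ⬝ᵥ l)) - η))) := by
      rw [mul_add (v n) c, Real.exp_add]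
      ring
    rw [h1]
    gcongr
    rw [hc, hq, dotProduct_comm x l]
    linarith

/-- Near `x` the variable `D` is bounded, so the relative perturbation is eventually smaller than `δ
/ 2`. Half of the radius is spent on `D` and half on `M - D`. -/
lemma lower_bound (h : HasQuadraticLogLaplaceLimit P D v S)
    (hv : Tendsto v atTop atTop) (hD : ∀ n, AEMeasurable (D n) P) (hS : S.PosDef)
    {M : ℕ → Ω → ι → ℝ} {ε : ℕ → ℝ} (hε : Tendsto ε atTop (𝓝 0))
    (hM : ∀ n, ∀ᵐ ω ∂P, ‖M n ω - D n ω‖ ≤ ε n * (1 + ‖D n ω‖))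
    {A : Set (ι → ℝ)} {x : ι → ℝ} (hx : x ∈ interior A) :
    ((-(1 / 2 * (x ⬝ᵥ (S⁻¹ *ᵥ x))) : ℝ) : EReal)
      ≤ liminf (fun n => ((1 / v n : ℝ) : EReal) * ENNReal.log (P {ω | M n ω ∈ A})) atTop := by
  obtain ⟨δ, hδ, hball⟩ := Metric.isOpen_iff.1 isOpen_interior x hx
  refine le_liminf_log_of_eventually_le hv fun η hη => ⟨1 / 2, by norm_num, ?_⟩
  have hR : 0 < 1 + (‖x‖ + δ) := by positivity
  filter_upwards [h.eventually_le_measure_ball hv hD hS x (half_pos hδ) hη,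
    hε.eventually_lt_const (show 0 < δ / 2 / (1 + (‖x‖ + δ)) by positivity)] with n hn hεn
  refine hn.trans (measure_mono_ae ?_)
  filter_upwards [hM n] with ω hω hωD
  change ‖D n ω - x‖ < δ / 2 at hωD
  refine interior_subset (hball ?_)
  rw [Metric.mem_ball, dist_eq_norm]
  have hDn : ‖D n ω‖ ≤ ‖x‖ + δ := by
    have := norm_sub_norm_le (D n ω) x
    linarith
  have h1 : ‖M n ω - D n ω‖ ≤ δ / 2 :=
    calc ‖M n ω - D n ω‖ ≤ ε n * (1 + ‖D n ω‖) := hω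
      _ ≤ δ / 2 / (1 + (‖x‖ + δ)) * (1 + (‖x‖ + δ)) := by gcongr
      _ = δ / 2 := by field_simp
  calc ‖M n ω - x‖ = ‖(M n ω - D n ω) + (D n ω - x)‖ := by congr 1; abel
    _ ≤ ‖M n ω - D n ω‖ + ‖D n ω - x‖ := norm_add_le _ _
    _ < δ := by linarith

/-- Gärtner–Ellis theorem with a quadratic limit, for a perturbation `M` of `D`. -/
theorem satisfiesLDP (h : HasQuadraticLogLaplaceLimit P D v S)
    (hv : Tendsto v atTop atTop) (hD : ∀ n, AEMeasurable (D n) P) (hS : S.PosDef)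
    {M : ℕ → Ω → ι → ℝ} (hMm : ∀ n, AEMeasurable (M n) P)
    {ε : ℕ → ℝ} (hε : Tendsto ε atTop (𝓝 0))
    (hM : ∀ n, ∀ᵐ ω ∂P, ‖M n ω - D n ω‖ ≤ ε n * (1 + ‖D n ω‖)) :
    SatisfiesLDP P M v (fun x => (((1 / 2) * (x ⬝ᵥ (S⁻¹ *ᵥ x)) : ℝ) : EReal)) where
  aemeasurable := hMm
  speed := hv
  nonneg x := by
    have := dotProduct_sub_quadratic_le hS x 0
    simp only [zero_dotProduct, mul_zero, sub_zero] at this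
    exact_mod_cast this
  lowerSemicontinuous := by
    refine Continuous.lowerSemicontinuous (continuous_coe_real_ereal.comp ?_)
    exact continuous_const.mul (continuous_id.dotProduct (continuous_const.matrix_mulVec
      continuous_id))
  lower A _ := by
    rw [EReal.neg_le]
    refine le_iInf₂ fun x hx => ?_
    rw [EReal.neg_le, ← EReal.coe_neg]
    exact h.lower_bound hv hD hS hε hM hx
  upper A _ := by
    rw [EReal.le_neg]
    -- Testing with real `J` below the infimum also handles an infinite infimum, as for an empty
    -- closure.
    refine EReal.ge_of_forall_gt_iff_ge.1 fun J hJ => ?_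
    rw [EReal.le_neg, ← EReal.coe_neg]
    have hsub : limsup (fun n => ((1 / v n : ℝ) : EReal) * ENNReal.log (P {ω | M n ω ∈ A})) atTop
        ≤ limsup (fun n => ((1 / v n : ℝ) : EReal)
          * ENNReal.log (P {ω | M n ω ∈ closure A})) atTop := by
      refine limsup_le_limsup ?_ (by isBoundedDefault) (by isBoundedDefault)
      filter_upwards [hv.eventually_gt_atTop 0] with n hvn
      refine mul_le_mul_of_nonneg_left (ENNReal.log_le_log (measure_mono fun ω hω =>
        subset_closure hω)) ?_
      exact_mod_cast (by positivity : (0 : ℝ) ≤ 1 / v n)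
    refine hsub.trans (h.upper_bound hv hD hS hε hM isClosed_closure fun x hx => ?_)
    exact_mod_cast hJ.trans_le (iInf₂_le x hx)

end HasQuadraticLogLaplaceLimit

end GartnerEllis

/-! ### Gaussian subspaces of `L²` -/

section GaussianSpace

variable {Ω : Type*} [MeasurableSpace Ω] {P : Measure Ω} [IsProbabilityMeasure P]

/-- The element `f` of `L²(P)` has law `N(0, ‖f‖²)`, expressed by its characteristic function. -/
def IsCenteredGaussian (f : Lp ℝ 2 P) : Prop :=
  ∀ t : ℝ, ∫ ω, Complex.exp (t * f ω * Complex.I) ∂P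
    = Complex.exp ((-(‖f‖ ^ 2 * t ^ 2 / 2) : ℝ) : ℂ)

omit [IsProbabilityMeasure P] in
lemma L2_norm_sq_eq_integral (f : Lp ℝ 2 P) : ‖f‖ ^ 2 = ∫ ω, f ω ^ 2 ∂P := by
  rw [← real_inner_self_eq_norm_sq, L2.inner_def]
  simp [sq]

lemma integral_abs_L2_le_norm (f : Lp ℝ 2 P) : ∫ ω, |f ω| ∂P ≤ ‖f‖ := by
  have h1 := eLpNorm_le_eLpNorm_of_exponent_le (μ := P) (p := 1) (q := 2) (by norm_num)
    (Lp.memLp f).1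
  have h2 : ∫ ω, |f ω| ∂P = (eLpNorm f 1 P).toReal := by
    rw [eLpNorm_one_eq_lintegral_enorm, ← integral_norm_eq_lintegral_enorm (Lp.memLp f).1]
    rfl
  rw [h2, Lp.norm_def]
  exact ENNReal.toReal_mono (Lp.memLp f).2.ne h1

lemma norm_cexp_sub_cexp_le (a b : ℝ) :
    ‖Complex.exp (a * Complex.I) - Complex.exp (b * Complex.I)‖ ≤ |a - b| := by
  have h1 : Complex.exp (a * Complex.I) - Complex.exp (b * Complex.I)
      = Complex.exp (b * Complex.I) * (Complex.exp (Complex.I * ((a - b : ℝ) : ℂ)) - 1) := by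
    rw [mul_sub, ← Complex.exp_add]
    push_cast
    ring_nf
  rw [h1, norm_mul, Complex.norm_exp_ofReal_mul_I, one_mul]
  exact Real.norm_exp_I_mul_ofReal_sub_one_le

/-- For each `t` both sides of the characteristic function identity are continuous on `L²`: the left
side is `|t|`-Lipschitz because the `L¹` norm is at most the `L²` norm. Hence `L²` limits of
centered Gaussians are again centered Gaussian. -/
lemma isClosed_isCenteredGaussian : IsClosed {f : Lp ℝ 2 P | IsCenteredGaussian f} := by
  have : {f : Lp ℝ 2 P | IsCenteredGaussian f} = ⋂ t : ℝ, {f : Lp ℝ 2 P |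
      ∫ ω, Complex.exp (t * f ω * Complex.I) ∂P
        = Complex.exp ((-(‖f‖ ^ 2 * t ^ 2 / 2) : ℝ) : ℂ)} := by
    ext f
    simp [IsCenteredGaussian]
  rw [this]
  refine isClosed_iInter fun t => isClosed_eq ?_ (by fun_prop)
  have hint : ∀ f : Lp ℝ 2 P, Integrable (fun ω => Complex.exp (t * f ω * Complex.I)) P := by
    intro f
    refine Integrable.of_bound (C := 1) ?_ (ae_of_all _ fun ω => ?_)
    · have := (Lp.memLp f).1
      have h2 : Continuous fun x : ℝ => Complex.exp (t * x * Complex.I) := by fun_prop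
      exact h2.comp_aestronglyMeasurable this
    · rw [← Complex.ofReal_mul, Complex.norm_exp_ofReal_mul_I]
  refine (LipschitzWith.of_dist_le_mul (K := ‖t‖₊) fun f g => ?_).continuous
  rw [dist_eq_norm, dist_eq_norm, ← integral_sub (hint f) (hint g)]
  calc ‖∫ ω, (Complex.exp (t * f ω * Complex.I) - Complex.exp (t * g ω * Complex.I)) ∂P‖
      ≤ ∫ ω, |t| * |(f - g) ω| ∂P := by
        refine norm_integral_le_of_norm_le ?_ ?_
        · exact (((Lp.memLp (f - g)).integrable (by norm_num)).abs).const_mul _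
        · filter_upwards [Lp.coeFn_sub f g] with ω hω
          have := norm_cexp_sub_cexp_le (t * f ω) (t * g ω)
          push_cast at this
          refine this.trans ?_
          rw [hω, ← mul_sub, abs_mul]
          rfl
    _ = |t| * ∫ ω, |(f - g) ω| ∂P := integral_const_mul _ _
    _ ≤ ‖t‖₊ * ‖f - g‖ := by
        gcongr
        · simp
        · exact integral_abs_L2_le_norm _

lemma IsCenteredGaussian.hasLaw {f : Lp ℝ 2 P} (hf : IsCenteredGaussian f) :
    HasLaw f (gaussianReal 0 (‖f‖ ^ 2).toNNReal) P where
  aemeasurable := (Lp.memLp f).1.aemeasurable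
  map_eq := by
    have : IsProbabilityMeasure (P.map f) :=
      Measure.isProbabilityMeasure_map (Lp.memLp f).1.aemeasurable
    refine Measure.ext_of_charFun ?_
    ext t
    rw [charFun_apply_real, integral_map (Lp.memLp f).1.aemeasurable (by fun_prop), hf t,
      charFun_gaussianReal]
    congr 1
    rw [Real.coe_toNNReal _ (by positivity)]
    push_cast
    ring

omit [IsProbabilityMeasure P] in
lemma isCenteredGaussian_of_hasGaussianLaw {f : Lp ℝ 2 P} (hf : HasGaussianLaw f P)
    (h0 : ∫ ω, f ω ∂P = 0) : IsCenteredGaussian f := by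
  intro t
  have h := charFun_apply_real (μ := P.map f) t
  rw [integral_map (Lp.memLp f).1.aemeasurable (by fun_prop), hf.map_eq_gaussianReal,
    charFun_gaussianReal] at h
  rw [← h, h0, Real.coe_toNNReal _ (variance_nonneg _ _), L2_norm_sq_eq_integral,
    variance_of_integral_eq_zero (Lp.memLp f).1.aemeasurable h0]
  congr 1
  push_cast
  simp

/-- The random variable `Z` belongs to the subspace `S` of `L²(P)`. -/
def MemL2 (S : Submodule ℝ (Lp ℝ 2 P)) (Z : Ω → ℝ) : Prop := ∃ f ∈ S, Z =ᵐ[P] f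

namespace MemL2

variable {S : Submodule ℝ (Lp ℝ 2 P)} {Z Z' : Ω → ℝ}

omit [IsProbabilityMeasure P] in
lemma memLp (h : MemL2 S Z) : MemLp Z 2 P := by
  obtain ⟨f, -, hf⟩ := h
  exact (memLp_congr_ae hf).2 (Lp.memLp f)

omit [IsProbabilityMeasure P] in
lemma of_toLp_mem (hZ : MemLp Z 2 P) (h : hZ.toLp Z ∈ S) : MemL2 S Z :=
  ⟨_, h, hZ.coeFn_toLp.symm⟩

omit [IsProbabilityMeasure P] in
lemma toLp_mem (h : MemL2 S Z) : h.memLp.toLp Z ∈ S := by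
  obtain ⟨f, hfS, hf⟩ := h
  have : MemLp.toLp Z (MemL2.memLp ⟨f, hfS, hf⟩) = f := by
    rw [Lp.ext_iff]
    exact (MemLp.coeFn_toLp _).trans hf
  rwa [this]

omit [IsProbabilityMeasure P] in
lemma congr (h : MemL2 S Z) (hZ : Z' =ᵐ[P] Z) : MemL2 S Z' := by
  obtain ⟨f, hfS, hf⟩ := h
  exact ⟨f, hfS, hZ.trans hf⟩

omit [IsProbabilityMeasure P] in
lemma add (h : MemL2 S Z) (h' : MemL2 S Z') : MemL2 S (fun ω => Z ω + Z' ω) := by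
  obtain ⟨f, hfS, hf⟩ := h
  obtain ⟨g, hgS, hg⟩ := h'
  exact ⟨f + g, S.add_mem hfS hgS, (hf.add hg).trans (Lp.coeFn_add f g).symm⟩

omit [IsProbabilityMeasure P] in
lemma const_mul (h : MemL2 S Z) (c : ℝ) : MemL2 S (fun ω => c * Z ω) := by
  obtain ⟨f, hfS, hf⟩ := h
  refine ⟨c • f, S.smul_mem c hfS, ?_⟩
  filter_upwards [hf, Lp.coeFn_smul c f] with ω h1 h2
  rw [h2, h1]
  rfl

omit [IsProbabilityMeasure P] in
lemma sub (h : MemL2 S Z) (h' : MemL2 S Z') : MemL2 S (fun ω => Z ω - Z' ω) := by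
  refine (h.add (h'.const_mul (-1))).congr (ae_of_all _ fun ω => ?_)
  simp only
  ring

omit [IsProbabilityMeasure P] in
lemma sum {ι : Type*} (s : Finset ι) {Y : ι → Ω → ℝ} (h : ∀ i ∈ s, MemL2 S (Y i)) :
    MemL2 S (fun ω => ∑ i ∈ s, Y i ω) := by
  classical
  induction s using Finset.induction_on with
  | empty =>
    refine ⟨0, S.zero_mem, ?_⟩
    filter_upwards [Lp.coeFn_zero ℝ 2 P] with ω hω
    simpa using hω.symm
  | insert i s hi ih =>
    refine ((h i (by simp)).add (ih fun j hj => h j (by simp [hj]))).congr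
      (ae_of_all _ fun ω => ?_)
    simp [Finset.sum_insert hi]

omit [IsProbabilityMeasure P] in
lemma of_approx (hS : IsClosed (S : Set (Lp ℝ 2 P))) (hZ : MemLp Z 2 P)
    (h : ∀ ε : ℝ≥0∞, 0 < ε → ∃ Y, MemL2 S Y ∧ eLpNorm (fun ω => Z ω - Y ω) 2 P < ε) :
    MemL2 S Z := by
  refine of_toLp_mem hZ (hS.closure_subset (EMetric.mem_closure_iff.2 fun ε hε => ?_))
  obtain ⟨Y, hY, hlt⟩ := h ε hε
  refine ⟨_, hY.toLp_mem, ?_⟩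
  rw [Lp.edist_toLp_toLp]
  exact hlt

lemma hasLaw (hS : ∀ f ∈ S, IsCenteredGaussian f) (h : MemL2 S Z) :
    ∃ w : ℝ≥0, HasLaw Z (gaussianReal 0 w) P := by
  obtain ⟨f, hfS, hf⟩ := h
  exact ⟨_, (hS f hfS).hasLaw.congr hf⟩

lemma integral_eq_zero (hS : ∀ f ∈ S, IsCenteredGaussian f) (h : MemL2 S Z) :
    ∫ ω, Z ω ∂P = 0 := by
  obtain ⟨w, hw⟩ := h.hasLaw hS
  rw [hw.integral_eq, integral_id_gaussianReal]

/-- Finite families in a Gaussian subspace are jointly Gaussian. -/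
lemma hasGaussianLaw_pi (hS : ∀ f ∈ S, IsCenteredGaussian f) {ι : Type*} [Finite ι]
    {Y : ι → Ω → ℝ} (hY : ∀ i, MemL2 S (Y i)) : HasGaussianLaw (fun ω i => Y i ω) P where
  isGaussian_map := by
    classical
    have := Fintype.ofFinite ι
    have hm : AEMeasurable (fun ω i => Y i ω) P :=
      aemeasurable_pi_lambda _ fun i => (hY i).memLp.1.aemeasurable
    -- Cramér–Wold: a linear functional of the family is a linear combination, which stays in the
    -- subspace.
    refine isGaussian_of_map_eq_gaussianReal fun L => ?_
    obtain ⟨w, hw⟩ := (MemL2.sum Finset.univ fun i _ =>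
      (hY i).const_mul (L (Pi.single i 1))).hasLaw hS
    refine ⟨0, w, ?_⟩
    rw [← hw.map_eq, AEMeasurable.map_map_of_aemeasurable (by fun_prop) hm]
    congr 1
    ext ω
    simp only [Function.comp_apply]
    conv_lhs => rw [pi_eq_sum_univ' (fun i => Y i ω)]
    simp [mul_comm]

end MemL2

/-- The closed subspace spanned by two independent centered Gaussian processes is Gaussian. -/
lemma exists_gaussianSpace {T : Type*} {W W' : T → Ω → ℝ} (hW : IsGaussianProcess W P)
    (hW' : IsGaussianProcess W' P) (hW0 : ∀ t, ∫ ω, W t ω ∂P = 0)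
    (hW'0 : ∀ t, ∫ ω, W' t ω ∂P = 0)
    (hind : IndepFun (fun ω t => W t ω) (fun ω t => W' t ω) P) :
    ∃ S : Submodule ℝ (Lp ℝ 2 P), IsClosed (S : Set (Lp ℝ 2 P)) ∧
      (∀ f ∈ S, IsCenteredGaussian f) ∧ (∀ t, MemL2 S (W t)) ∧ ∀ t, MemL2 S (W' t) := by
  have hm : ∀ t, MemLp (W t) 2 P := fun t => (hW.hasGaussianLaw_eval t).memLp_two
  have hm' : ∀ t, MemLp (W' t) 2 P := fun t => (hW'.hasGaussianLaw_eval t).memLp_two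
  have hcomb : ∀ {V : T → Ω → ℝ} (hV : ∀ t, MemLp (V t) 2 P) (f : Lp ℝ 2 P),
      f ∈ Submodule.span ℝ (range fun t => (hV t).toLp) →
      ∃ c : T →₀ ℝ, f =ᵐ[P] fun ω => ∑ t ∈ c.support, c t * V t ω := by
    intro V hV f hf
    obtain ⟨c, rfl⟩ := Finsupp.mem_span_range_iff_exists_finsupp.1 hf
    refine ⟨c, (Lp.coeFn_finsetSum _ _).trans ?_⟩
    have h1 : ∀ᵐ ω ∂P, ∀ t ∈ c.support, (c t • (hV t).toLp : Lp ℝ 2 P) ω = c t * V t ω := by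
      rw [Finset.eventually_all]
      intro t _
      filter_upwards [Lp.coeFn_smul (c t) (hV t).toLp, (hV t).coeFn_toLp] with ω h1 h2
      rw [h1, Pi.smul_apply, h2, smul_eq_mul]
    filter_upwards [h1] with ω hω
    rw [Finset.sum_apply]
    exact Finset.sum_congr rfl hω
  have hlaw : ∀ {V : T → Ω → ℝ} (hV : IsGaussianProcess V P) (c : T →₀ ℝ),
      HasGaussianLaw (fun ω => ∑ t ∈ c.support, c t * V t ω) P := fun hV c =>
    (hV.smul c).hasGaussianLaw_fun_sum
  set S₀ := Submodule.span ℝ (range fun t => (hm t).toLp)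
    ⊔ Submodule.span ℝ (range fun t => (hm' t).toLp) with hS₀
  -- An element of the algebraic span is a combination of values of `W` plus an independent
  -- combination of values of `W'`. The two are Gaussian, hence so is their sum.
  have hS₀g : ∀ f ∈ S₀, IsCenteredGaussian f := by
    intro f hf
    obtain ⟨g, hg, g', hg', rfl⟩ := Submodule.mem_sup.1 hf
    obtain ⟨c, hc⟩ := hcomb hm g hg
    obtain ⟨c', hc'⟩ := hcomb hm' g' hg'
    have hae : (g + g' : Lp ℝ 2 P) =ᵐ[P] fun ω =>
        ∑ t ∈ c.support, c t * W t ω + ∑ t ∈ c'.support, c' t * W' t ω :=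
      (Lp.coeFn_add g g').trans (hc.add hc')
    have hindep : IndepFun (fun ω => ∑ t ∈ c.support, c t * W t ω)
        (fun ω => ∑ t ∈ c'.support, c' t * W' t ω) P := by
      have h1 : ∀ d : T →₀ ℝ, Measurable fun x : T → ℝ => ∑ t ∈ d.support, d t * x t :=
        fun d => Finset.measurable_fun_sum _ fun t _ => (measurable_pi_apply t).const_mul _
      exact hind.comp (h1 c) (h1 c')
    refine isCenteredGaussian_of_hasGaussianLaw ?_ ?_
    · exact ((hindep.hasGaussianLaw (hlaw hW c) (hlaw hW' c')).fun_add).congr hae.symm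
    · have i1 : ∀ t, Integrable (fun ω => c t * W t ω) P := fun t =>
        ((hm t).integrable (by norm_num)).const_mul _
      have i2 : ∀ t, Integrable (fun ω => c' t * W' t ω) P := fun t =>
        ((hm' t).integrable (by norm_num)).const_mul _
      rw [integral_congr_ae hae, integral_add (integrable_finsetSum _ fun t _ => i1 t)
        (integrable_finsetSum _ fun t _ => i2 t), integral_finsetSum _ fun t _ => i1 t,
        integral_finsetSum _ fun t _ => i2 t]
      simp [integral_const_mul, hW0, hW'0]
  refine ⟨S₀.topologicalClosure, S₀.isClosed_topologicalClosure, fun f hf => ?_, fun t => ?_,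
    fun t => ?_⟩
  · exact closure_minimal (t := {f : Lp ℝ 2 P | IsCenteredGaussian f}) hS₀g
      isClosed_isCenteredGaussian hf
  · exact MemL2.of_toLp_mem (hm t) (S₀.le_topologicalClosure
      ((le_sup_left : _ ≤ S₀) (Submodule.subset_span ⟨t, rfl⟩)))
  · exact MemL2.of_toLp_mem (hm' t) (S₀.le_topologicalClosure
      ((le_sup_right : _ ≤ S₀) (Submodule.subset_span ⟨t, rfl⟩)))

end GaussianSpace

/-! ### Covariances of Wiener integrals -/

section WienerIntegral

/-- Continuity of the `L²` inner product, stated for functions so that it applies both on `Ω` and on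
the time interval. -/
lemma tendsto_integral_mul_of_tendsto_eLpNorm {α : Type*} [MeasurableSpace α] {μ : Measure α}
    {f g : α → ℝ} {F G : ℕ → α → ℝ} (hf : MemLp f 2 μ) (hg : MemLp g 2 μ)
    (hF : ∀ n, MemLp (F n) 2 μ) (hG : ∀ n, MemLp (G n) 2 μ)
    (tF : Tendsto (fun n => eLpNorm (fun a => f a - F n a) 2 μ) atTop (𝓝 0))
    (tG : Tendsto (fun n => eLpNorm (fun a => g a - G n a) 2 μ) atTop (𝓝 0)) :
    Tendsto (fun n => ∫ a, F n a * G n a ∂μ) atTop (𝓝 (∫ a, f a * g a ∂μ)) := by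
  have hinner : ∀ {u w : α → ℝ} (hu : MemLp u 2 μ) (hw : MemLp w 2 μ),
      inner ℝ (hu.toLp u) (hw.toLp w) = ∫ a, u a * w a ∂μ := by
    intro u w hu hw
    rw [L2.inner_def]
    refine integral_congr_ae ?_
    filter_upwards [hu.coeFn_toLp, hw.coeFn_toLp] with a h1 h2
    rw [h1, h2]
    simp [mul_comm]
  have hlim : ∀ {u : α → ℝ} {U : ℕ → α → ℝ} (hu : MemLp u 2 μ) (hU : ∀ n, MemLp (U n) 2 μ),
      Tendsto (fun n => eLpNorm (fun a => u a - U n a) 2 μ) atTop (𝓝 0) →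
      Tendsto (fun n => (hU n).toLp (U n)) atTop (𝓝 (hu.toLp u)) := by
    intro u U hu hU h
    rw [tendsto_iff_edist_tendsto_0]
    refine h.congr fun n => ?_
    rw [edist_comm, Lp.edist_toLp_toLp]
    rfl
  have := (hlim hf hF tF).inner (𝕜 := ℝ) (hlim hg hG tG)
  simpa only [hinner] using this

/-- Used twice in the isometry: with Brownian values under `P`, and with indicators of `(0, s]`
under Lebesgue measure. The two expansions then agree term by term. -/
lemma integral_sum_increments_mul_sum_increments {α : Type*} [MeasurableSpace α] {μ : Measure α}
    {X Y : ℕ → α → ℝ} (hX : ∀ i, MemLp (X i) 2 μ) (hY : ∀ i, MemLp (Y i) 2 μ) (c d : ℕ → ℝ)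
    (m p : ℕ) :
    ∫ a, (∑ i ∈ Finset.range m, c i * (X (i + 1) a - X i a))
        * (∑ j ∈ Finset.range p, d j * (Y (j + 1) a - Y j a)) ∂μ
      = ∑ i ∈ Finset.range m, ∑ j ∈ Finset.range p, c i * d j *
        ((∫ a, X (i + 1) a * Y (j + 1) a ∂μ) - (∫ a, X i a * Y (j + 1) a ∂μ)
          - (∫ a, X (i + 1) a * Y j a ∂μ) + ∫ a, X i a * Y j a ∂μ) := by
  have hXY : ∀ i j, Integrable (fun a => X i a * Y j a) μ := fun i j =>
    (hX i).integrable_mul (hY j)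
  simp_rw [Finset.sum_mul_sum]
  have hterm : ∀ i j a, c i * (X (i + 1) a - X i a) * (d j * (Y (j + 1) a - Y j a))
      = c i * d j * (X (i + 1) a * Y (j + 1) a - X i a * Y (j + 1) a
          - X (i + 1) a * Y j a + X i a * Y j a) := fun i j a => by ring
  simp_rw [hterm]
  have hint : ∀ i j, Integrable (fun a => c i * d j * (X (i + 1) a * Y (j + 1) a
      - X i a * Y (j + 1) a - X (i + 1) a * Y j a + X i a * Y j a)) μ := fun i j =>
    ((((hXY _ _).sub (hXY _ _)).sub (hXY _ _)).add (hXY _ _)).const_mul _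
  rw [integral_finsetSum _ fun i _ => integrable_finsetSum _ fun j _ => hint i j]
  refine Finset.sum_congr rfl fun i _ => ?_
  rw [integral_finsetSum _ fun j _ => hint i j]
  refine Finset.sum_congr rfl fun j _ => ?_
  have i1 : Integrable (fun a => X (i + 1) a * Y (j + 1) a - X i a * Y (j + 1) a) μ :=
    (hXY _ _).sub (hXY _ _)
  have i2 : Integrable (fun a => X (i + 1) a * Y (j + 1) a - X i a * Y (j + 1) a
      - X (i + 1) a * Y j a) μ := i1.sub (hXY _ _)
  rw [integral_const_mul, integral_add i2 (hXY _ _), integral_sub i1 (hXY _ _),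
    integral_sub (hXY _ _) (hXY _ _)]

namespace StepFunction

variable {t : ℝ}

/-- The indicator function of `(0, s]`. -/
noncomputable def initialIndicator (s u : ℝ) : ℝ := (Ioc 0 s).indicator (fun _ => 1) u

lemma eval_eq_sum_initialIndicator (φ : StepFunction t) (u : ℝ) :
    φ.eval u = ∑ i ∈ Finset.range φ.m,
      φ.c i * (initialIndicator (φ.s (i + 1)) u - initialIndicator (φ.s i) u) := by
  refine Finset.sum_congr rfl fun i _ => ?_
  have h1 := (φ.mem i).1
  have h2 := φ.mono (Nat.le_succ i)
  simp only [Nat.succ_eq_add_one] at h2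
  simp only [initialIndicator, indicator_apply, mem_Ioc]
  by_cases a : 0 < u
  · by_cases b : u ≤ φ.s i
    · have : u ≤ φ.s (i + 1) := b.trans h2
      have : ¬ φ.s i < u := not_lt.2 b
      simp [*]
    · have : φ.s i < u := not_le.1 b
      simp [*]
  · have : ¬ φ.s i < u := fun h => a (h1.trans_lt h)
    simp [*]

lemma memLp_initialIndicator (s a b : ℝ) :
    MemLp (initialIndicator s) 2 (volume.restrict (Ioc a b)) :=
  memLp_indicator_const 2 measurableSet_Ioc 1 (Or.inr (by finiteness))

lemma memLp_eval (φ : StepFunction t) (a b : ℝ) :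
    MemLp φ.eval 2 (volume.restrict (Ioc a b)) := by
  have : φ.eval = fun u => ∑ i ∈ Finset.range φ.m,
      φ.c i * (initialIndicator (φ.s (i + 1)) u - initialIndicator (φ.s i) u) :=
    funext φ.eval_eq_sum_initialIndicator
  rw [this]
  exact memLp_finsetSum _ fun i _ =>
    ((memLp_initialIndicator _ a b).sub (memLp_initialIndicator _ a b)).const_mul _

lemma setIntegral_initialIndicator_mul {κ : ℝ → ℝ} {s r m : ℝ} (h : min s r ≤ m) :
    ∫ u in Ioc 0 m, initialIndicator s u * (κ u * initialIndicator r u)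
      = ∫ u in Ioc 0 (min s r), κ u := by
  have h1 : ∀ u, initialIndicator s u * (κ u * initialIndicator r u)
      = (Ioc 0 (min s r)).indicator κ u := by
    intro u
    simp only [initialIndicator, indicator_apply, mem_Ioc, le_min_iff]
    by_cases h0 : 0 < u <;> by_cases hs : u ≤ s <;> by_cases hr : u ≤ r <;> simp [*]
  simp_rw [h1]
  rw [setIntegral_indicator measurableSet_Ioc,
    inter_eq_self_of_subset_right (Ioc_subset_Ioc_right h)]

end StepFunction

variable {Ω : Type*} [MeasurableSpace Ω] {P : Measure Ω}

/-- `E[B_s B'_r] = ∫₀^{s ∧ r} κ` for `s, r ∈ [0, 1]`. -/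
def HasCovarianceDensity (P : Measure Ω) (B B' : ℝ → Ω → ℝ) (κ : ℝ → ℝ) : Prop :=
  ∀ s ∈ Icc (0 : ℝ) 1, ∀ r ∈ Icc (0 : ℝ) 1, ∫ ω, B s ω * B' r ω ∂P = ∫ u in Ioc 0 (min s r), κ u

namespace IsStochIntegral

variable {B B' : ℝ → Ω → ℝ} {f g κ : ℝ → ℝ} {t t' : ℝ} {Z Z' : Ω → ℝ}

lemma exists_seq (h : IsStochIntegral P B f t Z) : ∃ φ : ℕ → StepFunction t,
    Tendsto (fun n => eLpNorm (fun u => f u - (φ n).eval u) 2 (volume.restrict (Ioc 0 t)))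
      atTop (𝓝 0) ∧
    Tendsto (fun n => eLpNorm (fun ω => Z ω - (φ n).integral B ω) 2 P) atTop (𝓝 0) := by
  choose φ hφ1 hφ2 using fun n : ℕ =>
    -- At `n = 0` the tolerance is `∞`, which is harmless.
    h.approx (n : ℝ≥0∞)⁻¹ (ENNReal.inv_pos.2 (ENNReal.natCast_ne_top n))
  exact ⟨φ, tendsto_of_tendsto_of_tendsto_of_le_of_le tendsto_const_nhds
      ENNReal.tendsto_inv_nat_nhds_zero (fun _ => zero_le) fun n => (hφ1 n).le,
    tendsto_of_tendsto_of_tendsto_of_le_of_le tendsto_const_nhds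
      ENNReal.tendsto_inv_nat_nhds_zero (fun _ => zero_le) fun n => (hφ2 n).le⟩

lemma memLp_integral (hB : ∀ s ∈ Icc (0 : ℝ) 1, MemLp (B s) 2 P) (ht : t ≤ 1)
    (φ : StepFunction t) : MemLp (φ.integral B) 2 P := by
  have h : ∀ i, MemLp (B (φ.s i)) 2 P := fun i =>
    hB _ ⟨(φ.mem i).1, (φ.mem i).2.trans ht⟩
  exact memLp_finsetSum _ fun i _ => ((h (i + 1)).sub (h i)).const_mul _

/-- Elementary integrals are linear combinations of values of `B`, and `S` is closed under `L²`
limits. -/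
lemma memL2 {S : Submodule ℝ (Lp ℝ 2 P)} (hS : IsClosed (S : Set (Lp ℝ 2 P)))
    (hB : ∀ s ∈ Icc (0 : ℝ) 1, MemL2 S (B s)) (ht : t ≤ 1) (h : IsStochIntegral P B f t Z) :
    MemL2 S Z := by
  refine MemL2.of_approx hS h.memLp fun ε hε => ?_
  obtain ⟨φ, -, hφ⟩ := h.approx ε hε
  have hm : ∀ i, MemL2 S (B (φ.s i)) := fun i =>
    hB _ ⟨(φ.mem i).1, (φ.mem i).2.trans ht⟩
  exact ⟨φ.integral B, MemL2.sum _ fun i _ => ((hm (i + 1)).sub (hm i)).const_mul _, hφ⟩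

/-- The covariance of two Wiener integrals. -/
theorem integral_mul_eq (hB : ∀ s ∈ Icc (0 : ℝ) 1, MemLp (B s) 2 P)
    (hB' : ∀ s ∈ Icc (0 : ℝ) 1, MemLp (B' s) 2 P)
    (hκm : AEStronglyMeasurable κ (volume.restrict (Ioc 0 1)))
    (hκ : ∀ u ∈ Ioc (0 : ℝ) 1, |κ u| ≤ 1) (hcov : HasCovarianceDensity P B B' κ)
    (ht : t ≤ 1) (ht' : t' ≤ 1)
    (hZ : IsStochIntegral P B f t Z) (hZ' : IsStochIntegral P B' g t' Z') :
    ∫ ω, Z ω * Z' ω ∂P = ∫ u in Ioc 0 (min t t'), f u * (κ u * g u) := by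
  obtain ⟨φ, hφ1, hφ2⟩ := hZ.exists_seq
  obtain ⟨ψ, hψ1, hψ2⟩ := hZ'.exists_seq
  set m := min t t' with hm
  have hsub : Ioc (0 : ℝ) m ⊆ Ioc 0 1 := Ioc_subset_Ioc_right ((min_le_left _ _).trans ht)
  have hle : volume.restrict (Ioc 0 m) ≤ volume.restrict (Ioc 0 t) :=
    Measure.restrict_mono (Ioc_subset_Ioc_right (min_le_left _ _)) le_rfl
  have hle' : volume.restrict (Ioc 0 m) ≤ volume.restrict (Ioc 0 t') :=
    Measure.restrict_mono (Ioc_subset_Ioc_right (min_le_right _ _)) le_rfl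
  have hκm' : AEStronglyMeasurable κ (volume.restrict (Ioc 0 m)) :=
    hκm.mono_measure (Measure.restrict_mono hsub le_rfl)
  have hκae : ∀ᵐ u ∂volume.restrict (Ioc 0 m), |κ u| ≤ 1 :=
    (ae_restrict_iff' measurableSet_Ioc).2 (ae_of_all _ fun u hu => hκ u (hsub hu))
  -- Since `|κ| ≤ 1`, multiplication by `κ` is a contraction of `L²`, so the weighted step functions
  -- still converge.
  have hmul : ∀ {w : ℝ → ℝ}, MemLp w 2 (volume.restrict (Ioc 0 m)) →
      MemLp (fun u => κ u * w u) 2 (volume.restrict (Ioc 0 m)) := by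
    intro w hw
    refine hw.of_le (hκm'.mul hw.1) ?_
    filter_upwards [hκae] with u hu
    rw [norm_mul]
    exact mul_le_of_le_one_left (norm_nonneg _) hu
  have lim1 : Tendsto (fun n => ∫ ω, (φ n).integral B ω * (ψ n).integral B' ω ∂P) atTop
      (𝓝 (∫ ω, Z ω * Z' ω ∂P)) :=
    tendsto_integral_mul_of_tendsto_eLpNorm hZ.memLp hZ'.memLp
      (fun n => memLp_integral hB ht _) (fun n => memLp_integral hB' ht' _) hφ2 hψ2
  have lim2 : Tendsto (fun n => ∫ u in Ioc 0 m, (φ n).eval u * (κ u * (ψ n).eval u)) atTop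
      (𝓝 (∫ u in Ioc 0 m, f u * (κ u * g u))) := by
    refine tendsto_integral_mul_of_tendsto_eLpNorm (hZ.memLp_integrand.mono_measure hle)
      (hmul (hZ'.memLp_integrand.mono_measure hle')) (fun n => (φ n).memLp_eval _ _)
      (fun n => hmul ((ψ n).memLp_eval _ _)) ?_ ?_
    · exact tendsto_of_tendsto_of_tendsto_of_le_of_le tendsto_const_nhds hφ1
        (fun _ => zero_le) fun n => eLpNorm_mono_measure _ hle
    · refine tendsto_of_tendsto_of_tendsto_of_le_of_le tendsto_const_nhds hψ1
        (fun _ => zero_le) fun n => ?_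
      refine (eLpNorm_mono_ae ?_).trans (eLpNorm_mono_measure _ hle')
      filter_upwards [hκae] with u hu
      rw [← mul_sub, norm_mul]
      exact mul_le_of_le_one_left (norm_nonneg _) hu
  -- It remains to prove the identity for step functions, where `hcov` matches each product of
  -- Brownian values with a product of indicators.
  refine tendsto_nhds_unique lim1 (lim2.congr fun n => ?_)
  have hs : ∀ i, (φ n).s i ∈ Icc (0 : ℝ) 1 := fun i =>
    ⟨((φ n).mem i).1, ((φ n).mem i).2.trans ht⟩
  have hr : ∀ i, (ψ n).s i ∈ Icc (0 : ℝ) 1 := fun i =>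
    ⟨((ψ n).mem i).1, ((ψ n).mem i).2.trans ht'⟩
  have hmin : ∀ i j, min ((φ n).s i) ((ψ n).s j) ≤ m := fun i j =>
    min_le_min ((φ n).mem i).2 ((ψ n).mem j).2
  have h1 := integral_sum_increments_mul_sum_increments (fun i => hB _ (hs i))
    (fun i => hB' _ (hr i)) (φ n).c (ψ n).c (φ n).m (ψ n).m
  have h2 := integral_sum_increments_mul_sum_increments
    (fun i => StepFunction.memLp_initialIndicator ((φ n).s i) 0 m)
    (fun i => hmul (StepFunction.memLp_initialIndicator ((ψ n).s i) 0 m))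
    (φ n).c (ψ n).c (φ n).m (ψ n).m
  simp only [StepFunction.setIntegral_initialIndicator_mul (hmin _ _)] at h2
  simp only [hcov _ (hs _) _ (hr _)] at h1
  simp only [StepFunction.integral]
  rw [h1, ← h2]
  simp only [StepFunction.eval_eq_sum_initialIndicator]
  refine integral_congr_ae (ae_of_all _ fun u => ?_)
  simp only
  congr 1
  rw [Finset.mul_sum]
  refine Finset.sum_congr rfl fun j _ => ?_
  ring

end IsStochIntegral

/-! ### Gaussian structure and covariance of a Brownian motion. -/

namespace IsBrownianMotion

variable {B : ℝ → Ω → ℝ}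

lemma hasLaw (h : IsBrownianMotion P B) {t : ℝ} (ht : t ∈ Icc (0 : ℝ) 1) :
    HasLaw (B t) (gaussianReal 0 t.toNNReal) P := by
  have h1 := h.law 0 (by simp) t ht ht.1
  rw [sub_zero] at h1
  refine h1.congr ?_
  filter_upwards [h.zero] with ω hω
  rw [hω, sub_zero]

lemma memLp (h : IsBrownianMotion P B) {t : ℝ} (ht : t ∈ Icc (0 : ℝ) 1) : MemLp (B t) 2 P :=
  (h.hasLaw ht).hasGaussianLaw.memLp_two

lemma integral_eq_zero (h : IsBrownianMotion P B) {t : ℝ} (ht : t ∈ Icc (0 : ℝ) 1) :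
    ∫ ω, B t ω ∂P = 0 := by
  rw [(h.hasLaw ht).integral_eq, integral_id_gaussianReal]

lemma _root_.RealizedVolatility.integral_sq_of_hasLaw_gaussianReal {Y : Ω → ℝ} {w : ℝ≥0}
    (h : HasLaw Y (gaussianReal 0 w) P) : ∫ ω, Y ω ^ 2 ∂P = w := by
  have h1 : ∫ ω, Y ω ∂P = 0 := by rw [h.integral_eq, integral_id_gaussianReal]
  rw [← variance_of_integral_eq_zero h.aemeasurable h1, h.variance_eq, variance_id_gaussianReal]

/-- Polarization, `2 B_s B_r = B_s² + B_r² - (B_r - B_s)²`, reduces the covariance to the variances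
of `B_s`, `B_r` and the increment. -/
lemma hasCovarianceDensity_self (h : IsBrownianMotion P B) :
    HasCovarianceDensity P B B (fun _ => 1) := by
  have key : ∀ s ∈ Icc (0 : ℝ) 1, ∀ r ∈ Icc (0 : ℝ) 1, s ≤ r → ∫ ω, B s ω * B r ω ∂P = s := by
    intro s hs r hr hsr
    have e1 := integral_sq_of_hasLaw_gaussianReal (h.hasLaw hs)
    have e2 := integral_sq_of_hasLaw_gaussianReal (h.hasLaw hr)
    have e3 := integral_sq_of_hasLaw_gaussianReal (h.law s hs r hr hsr)
    rw [Real.coe_toNNReal _ hs.1] at e1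
    rw [Real.coe_toNNReal _ hr.1] at e2
    rw [Real.coe_toNNReal _ (sub_nonneg.2 hsr)] at e3
    have i1 : Integrable (fun ω => B s ω ^ 2) P := (h.memLp hs).integrable_sq
    have i2 : Integrable (fun ω => B r ω ^ 2) P := (h.memLp hr).integrable_sq
    have i3 : Integrable (fun ω => (B r ω - B s ω) ^ 2) P :=
      ((h.memLp hr).sub (h.memLp hs)).integrable_sq
    have e : ∀ ω, B s ω * B r ω = 1 / 2 * (B s ω ^ 2 + B r ω ^ 2 - (B r ω - B s ω) ^ 2) :=
      fun ω => by ring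
    simp_rw [e]
    have i12 : Integrable (fun ω => B s ω ^ 2 + B r ω ^ 2) P := i1.add i2
    rw [integral_const_mul, integral_sub i12 i3, integral_add i1 i2, e1, e2, e3]
    ring
  intro s hs r hr
  rw [setIntegral_const, smul_eq_mul, mul_one, Measure.real, Real.volume_Ioc, sub_zero,
    ENNReal.toReal_ofReal (le_min hs.1 hr.1)]
  rcases le_total s r with hsr | hsr
  · rw [key s hs r hr hsr, min_eq_left hsr]
  · simp_rw [mul_comm (B s _)]
    rw [key r hr s hs hsr, min_eq_right hsr]

lemma isGaussianProcess (h : IsBrownianMotion P B) :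
    IsGaussianProcess (fun (t : Icc (0 : ℝ) 1) ω => B t ω) P := by
  exact HasIndepIncrements.isGaussianProcess (fun t => (h.hasLaw t.2).hasGaussianLaw)
    (by simpa using h.zero) h.indep

/-- `B_t` is the Wiener integral of the constant function `1`. -/
lemma isStochIntegral_one (h : IsBrownianMotion P B) {t : ℝ} (ht : t ∈ Icc (0 : ℝ) 1) :
    IsStochIntegral P B (fun _ => 1) t (B t) where
  memLp_integrand := memLp_const 1
  memLp := h.memLp ht
  approx ε hε := by
    refine ⟨⟨1, fun i => if i = 0 then 0 else t, fun _ => 1, ?_, fun i => ?_⟩, ?_, ?_⟩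
    · refine monotone_nat_of_le_succ fun i => ?_
      by_cases hi : i = 0 <;> simp [hi, ht.1]
    · by_cases hi : i = 0 <;> simp [hi, ht.1]
    · rw [eLpNorm_congr_ae (g := fun _ => (0 : ℝ))]
      · simpa using hε
      · refine (ae_restrict_iff' measurableSet_Ioc).2 (ae_of_all _ fun u hu => ?_)
        simp only [StepFunction.eval, Finset.range_one, Finset.sum_singleton, if_true, zero_add,
          one_ne_zero, if_false]
        rw [indicator_of_mem hu, sub_self]
    · rw [eLpNorm_congr_ae (g := fun _ => (0 : ℝ))]
      · simpa using hε
      · filter_upwards [h.zero] with ω hω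
        simp [StepFunction.integral, hω]

end IsBrownianMotion

/-! ### Covariance and joint Gaussianity of the correlated pair. -/

namespace AreCorrelatedBrownianMotions

variable {ρ : ℝ → ℝ} {B₁ B₂ B₃ : ℝ → Ω → ℝ}

lemma hasCovarianceDensity₁₃ (h : AreCorrelatedBrownianMotions P ρ B₁ B₂ B₃) :
    HasCovarianceDensity P B₁ B₃ (fun _ => 0) := by
  intro s hs r hr
  have hind : IndepFun (B₁ s) (B₃ r) P :=
    h.indep.comp (measurable_pi_apply (⟨s, hs⟩ : Icc (0 : ℝ) 1))
      (measurable_pi_apply (⟨r, hr⟩ : Icc (0 : ℝ) 1))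
  rw [hind.integral_fun_mul_eq_mul_integral (h.brownian₁.memLp hs).1 (h.brownian₃.memLp hr).1,
    h.brownian₁.integral_eq_zero hs]
  simp

/-- Write `B₁ s` as the Wiener integral of `1` and decompose `B₂ r`. The isometry pairs `1` with `ρ`
in the `B₁` part, and the `B₃` part is orthogonal to `B₁`. -/
lemma hasCovarianceDensity₁₂ (h : AreCorrelatedBrownianMotions P ρ B₁ B₂ B₃) :
    HasCovarianceDensity P B₁ B₂ ρ := by
  intro s hs r hr
  obtain ⟨Z₁, Z₃, hZ₁, hZ₃, hB₂⟩ := h.decomposition r hr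
  have m1 := fun s (hs : s ∈ Icc (0 : ℝ) 1) => h.brownian₁.memLp hs
  have m3 := fun s (hs : s ∈ Icc (0 : ℝ) 1) => h.brownian₃.memLp hs
  have e1 := IsStochIntegral.integral_mul_eq m1 m1 aestronglyMeasurable_const (by simp)
    h.brownian₁.hasCovarianceDensity_self hs.2 hr.2 (h.brownian₁.isStochIntegral_one hs) hZ₁
  have e3 := IsStochIntegral.integral_mul_eq m1 m3 aestronglyMeasurable_const (by simp)
    h.hasCovarianceDensity₁₃ hs.2 hr.2 (h.brownian₁.isStochIntegral_one hs) hZ₃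
  have e : (fun ω => B₁ s ω * B₂ r ω) =ᵐ[P] fun ω => B₁ s ω * Z₁ ω + B₁ s ω * Z₃ ω := by
    filter_upwards [hB₂] with ω hω
    rw [hω, mul_add]
  have i1 : Integrable (fun ω => B₁ s ω * Z₁ ω) P := (m1 s hs).integrable_mul hZ₁.memLp
  have i3 : Integrable (fun ω => B₁ s ω * Z₃ ω) P := (m1 s hs).integrable_mul hZ₃.memLp
  rw [integral_congr_ae e, integral_add i1 i3, e1, e3]
  simp

/-- There is a Gaussian subspace of `L²(P)` containing both Brownian motions `B₁` and `B₂`. -/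
lemma exists_gaussianSpace [IsProbabilityMeasure P]
    (h : AreCorrelatedBrownianMotions P ρ B₁ B₂ B₃) :
    ∃ S : Submodule ℝ (Lp ℝ 2 P), IsClosed (S : Set (Lp ℝ 2 P)) ∧
      (∀ f ∈ S, IsCenteredGaussian f) ∧ (∀ t ∈ Icc (0 : ℝ) 1, MemL2 S (B₁ t)) ∧
      ∀ t ∈ Icc (0 : ℝ) 1, MemL2 S (B₂ t) := by
  obtain ⟨S, hS, hSg, h1, h3⟩ := RealizedVolatility.exists_gaussianSpace
    (IsBrownianMotion.isGaussianProcess h.brownian₁)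
    (IsBrownianMotion.isGaussianProcess h.brownian₃)
    (fun t => h.brownian₁.integral_eq_zero t.2) (fun t => h.brownian₃.integral_eq_zero t.2) h.indep
  refine ⟨S, hS, hSg, fun t ht => h1 ⟨t, ht⟩, fun t ht => ?_⟩
  obtain ⟨Z₁, Z₃, hZ₁, hZ₃, hB₂⟩ := h.decomposition t ht
  exact ((hZ₁.memL2 hS (fun s hs => h1 ⟨s, hs⟩) ht.2).add
    (hZ₃.memL2 hS (fun s hs => h3 ⟨s, hs⟩) ht.2)).congr hB₂

end AreCorrelatedBrownianMotions

end WienerIntegral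

/-! ### Exponential moments of Gaussian quadratic forms -/

section QuadraticForm

/-- Completing the square: with `d = 1 - 2γ`, the weight turns the standard normal density into a
constant times the density of `N(c/d, 1/d)`. -/
lemma lintegral_exp_quadratic_gaussianReal_one {γ : ℝ} (hγ : 0 < 1 - 2 * γ) (c : ℝ) :
    ∫⁻ x, ENNReal.ofReal (Real.exp (c * x + γ * x ^ 2)) ∂gaussianReal 0 1
      = ENNReal.ofReal
        (Real.exp (-(1 / 2) * Real.log (1 - 2 * γ) + c ^ 2 / (2 * (1 - 2 * γ)))) := by
  set d := 1 - 2 * γ with hd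
  have hw : (d⁻¹).toNNReal ≠ 0 := (Real.toNNReal_pos.2 (inv_pos.2 hγ)).ne'
  have hwd : (((d⁻¹).toNNReal : ℝ≥0) : ℝ) = d⁻¹ := Real.coe_toNNReal _ (inv_pos.2 hγ).le
  rw [gaussianReal_of_var_ne_zero _ one_ne_zero,
    lintegral_withDensity_eq_lintegral_mul _ (measurable_gaussianPDF _ _) (by fun_prop)]
  have key : ∀ x : ℝ, (gaussianPDF 0 1 * fun x => ENNReal.ofReal (Real.exp (c * x + γ * x ^ 2))) x
      = ENNReal.ofReal (Real.exp (-(1 / 2) * Real.log d + c ^ 2 / (2 * d)))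
        * gaussianPDF (c / d) (d⁻¹).toNNReal x := by
    intro x
    simp only [Pi.mul_apply, gaussianPDF, gaussianPDFReal]
    rw [← ENNReal.ofReal_mul (by positivity), ← ENNReal.ofReal_mul (by positivity)]
    congr 1
    have h1 : Real.exp (-(1 / 2) * Real.log d) = √d⁻¹ := by
      rw [Real.sqrt_eq_rpow, Real.rpow_def_of_pos (by positivity), Real.log_inv]
      ring_nf
    have h2 : √(2 * Real.pi * d⁻¹) = √(2 * Real.pi) * √d⁻¹ := Real.sqrt_mul (by positivity) _
    have h3 : √d⁻¹ ≠ 0 := by positivity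
    have h4 : √(2 * Real.pi) ≠ 0 := by positivity
    simp only [NNReal.coe_one, mul_one, hwd]
    rw [Real.exp_add (-(1 / 2) * Real.log d), h1, h2, mul_inv]
    have h5 : √d⁻¹ * Real.exp (c ^ 2 / (2 * d)) * ((√(2 * Real.pi))⁻¹ * (√d⁻¹)⁻¹
        * Real.exp (-(x - c / d) ^ 2 / (2 * d⁻¹)))
        = (√(2 * Real.pi))⁻¹ * (Real.exp (c ^ 2 / (2 * d))
          * Real.exp (-(x - c / d) ^ 2 / (2 * d⁻¹))) := by
      field_simp
    rw [h5, mul_assoc, ← Real.exp_add, ← Real.exp_add]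
    congr 2
    have : γ = (1 - d) / 2 := by rw [hd]; ring
    rw [this]
    field_simp
    ring
  rw [lintegral_congr key, lintegral_const_mul _ (measurable_gaussianPDF _ _),
    lintegral_gaussianPDF_eq_one _ hw, mul_one]

/-- Scaling the standard normal by `√w` also covers `w = 0`, where there is no density. That case
matters because the variance of a regression residual is not known to be positive when this is
applied. -/
lemma lintegral_exp_quadratic_gaussianReal (w : ℝ≥0) {γ : ℝ} (hγ : 0 < 1 - 2 * (γ * w)) (c : ℝ) :
    ∫⁻ x, ENNReal.ofReal (Real.exp (c * x + γ * x ^ 2)) ∂gaussianReal 0 w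
      = ENNReal.ofReal (Real.exp (-(1 / 2) * Real.log (1 - 2 * (γ * w))
          + c ^ 2 * w / (2 * (1 - 2 * (γ * w))))) := by
  have hmap : gaussianReal 0 w = (gaussianReal 0 1).map (fun x => √w * x) := by
    rw [gaussianReal_map_const_mul]
    congr 1
    · simp
    · ext
      simp
  have hsq : √(w : ℝ) ^ 2 = w := Real.sq_sqrt w.2
  rw [hmap, lintegral_map (by fun_prop) (by fun_prop)]
  have h := lintegral_exp_quadratic_gaussianReal_one hγ (c * √w)
  rw [mul_pow, hsq] at h
  rw [← h]
  refine lintegral_congr fun x => ?_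
  rw [mul_pow, hsq]
  ring_nf

variable {Ω : Type*} [MeasurableSpace Ω] {P : Measure Ω} [IsProbabilityMeasure P]

omit [IsProbabilityMeasure P] in
-- Integrating out `W`, with linear coefficient `b U`, leaves a Gaussian integral in `U` with
-- coefficient `a + b² q / (2d)`, where `d = 1 - 2cq`. The product of `d` with the second
-- normalizing factor is the determinant.
lemma lintegral_exp_quadratic_of_indepFun {U W : Ω → ℝ} {p q : ℝ≥0}
    (hU : HasLaw U (gaussianReal 0 p) P) (hW : HasLaw W (gaussianReal 0 q) P)
    (hind : IndepFun U W P) {a b c : ℝ} (h1 : 0 < 1 - 2 * (c * q))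
    (h2 : 0 < (1 - 2 * (a * p)) * (1 - 2 * (c * q)) - b ^ 2 * p * q) :
    ∫⁻ ω, ENNReal.ofReal (Real.exp (a * U ω ^ 2 + b * (U ω * W ω) + c * W ω ^ 2)) ∂P
      = ENNReal.ofReal (Real.exp (-(1 / 2) *
          Real.log ((1 - 2 * (a * p)) * (1 - 2 * (c * q)) - b ^ 2 * p * q))) := by
  have := hU.isProbabilityMeasure
  have hlaw : P.map (fun ω => (U ω, W ω)) = (gaussianReal 0 p).prod (gaussianReal 0 q) := by
    rw [(indepFun_iff_map_prod_eq_prod_map_map hU.aemeasurable hW.aemeasurable).1 hind,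
      hU.map_eq, hW.map_eq]
  set d := 1 - 2 * (c * q) with hd
  have hm : Measurable fun z : ℝ × ℝ =>
      ENNReal.ofReal (Real.exp (a * z.1 ^ 2 + b * (z.1 * z.2) + c * z.2 ^ 2)) := by fun_prop
  calc ∫⁻ ω, ENNReal.ofReal (Real.exp (a * U ω ^ 2 + b * (U ω * W ω) + c * W ω ^ 2)) ∂P
      = ∫⁻ z, ENNReal.ofReal (Real.exp (a * z.1 ^ 2 + b * (z.1 * z.2) + c * z.2 ^ 2))
          ∂(gaussianReal 0 p).prod (gaussianReal 0 q) := by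
        rw [← hlaw, lintegral_map' hm.aemeasurable (hU.aemeasurable.prodMk hW.aemeasurable)]
    _ = ∫⁻ x, ∫⁻ y, ENNReal.ofReal (Real.exp (a * x ^ 2 + b * (x * y) + c * y ^ 2))
          ∂gaussianReal 0 q ∂gaussianReal 0 p := lintegral_prod _ hm.aemeasurable
    _ = ∫⁻ x, ENNReal.ofReal (Real.exp (-(1 / 2) * Real.log d))
          * ENNReal.ofReal (Real.exp (0 * x + (a + b ^ 2 * q / (2 * d)) * x ^ 2))
            ∂gaussianReal 0 p := by
        refine lintegral_congr fun x => ?_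
        have e : ∀ y : ℝ, ENNReal.ofReal (Real.exp (a * x ^ 2 + b * (x * y) + c * y ^ 2))
            = ENNReal.ofReal (Real.exp (a * x ^ 2))
              * ENNReal.ofReal (Real.exp ((b * x) * y + c * y ^ 2)) := by
          intro y
          rw [← ENNReal.ofReal_mul (Real.exp_nonneg _), ← Real.exp_add]
          ring_nf
        rw [lintegral_congr e, lintegral_const_mul _ (by fun_prop),
          lintegral_exp_quadratic_gaussianReal q h1, ← hd,
          ← ENNReal.ofReal_mul (Real.exp_nonneg _), ← ENNReal.ofReal_mul (Real.exp_nonneg _),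
          ← Real.exp_add, ← Real.exp_add]
        congr 2
        ring
    _ = _ := by
        have h3 : (1 - 2 * (a * p)) * d - b ^ 2 * p * q
            = d * (1 - 2 * ((a + b ^ 2 * q / (2 * d)) * p)) := by
          field_simp
          ring
        have h4 : 0 < 1 - 2 * ((a + b ^ 2 * q / (2 * d)) * p) := by
          rw [h3] at h2
          exact pos_of_mul_pos_right h2 h1.le
        rw [lintegral_const_mul _ (by fun_prop), lintegral_exp_quadratic_gaussianReal p h4,
          ← ENNReal.ofReal_mul (Real.exp_nonneg _), ← Real.exp_add, h3,
          Real.log_mul h1.ne' h4.ne']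
        congr 2
        ring

/-- The exponential moment of a quadratic form in two jointly Gaussian centered variables. -/
theorem MemL2.lintegral_exp_quadratic {S : Submodule ℝ (Lp ℝ 2 P)}
    (hS : ∀ f ∈ S, IsCenteredGaussian f) {U V : Ω → ℝ} (hU : MemL2 S U) (hV : MemL2 S V)
    {p r q : ℝ} (hp : ∫ ω, U ω * U ω ∂P = p) (hr : ∫ ω, U ω * V ω ∂P = r)
    (hq : ∫ ω, V ω * V ω ∂P = q) (hp0 : 0 < p) {a b c : ℝ}
    (h1 : 0 < 1 - 2 * (c * (q - r ^ 2 / p)))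
    (h2 : 0 < 1 - 2 * (a * p + b * r + c * q) + 4 * ((a * c - b ^ 2 / 4) * (p * q - r ^ 2))) :
    ∫⁻ ω, ENNReal.ofReal (Real.exp (a * (U ω * U ω) + c * (V ω * V ω) + b * (U ω * V ω))) ∂P
      = ENNReal.ofReal (Real.exp (-(1 / 2) * Real.log (1 - 2 * (a * p + b * r + c * q)
          + 4 * ((a * c - b ^ 2 / 4) * (p * q - r ^ 2))))) := by
  -- The regression coefficient of `V` on `U`: the residual `V - k U` is uncorrelated with `U`,
  -- hence independent of it by joint Gaussianity.
  set k := r / p with hk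
  have hW : MemL2 S (fun ω => V ω - k * U ω) := hV.sub (hU.const_mul k)
  have iUU : Integrable (fun ω => U ω * U ω) P := hU.memLp.integrable_mul hU.memLp
  have iUV : Integrable (fun ω => U ω * V ω) P := hU.memLp.integrable_mul hV.memLp
  have iVV : Integrable (fun ω => V ω * V ω) P := hV.memLp.integrable_mul hV.memLp
  have hkp : k * p = r := by rw [hk]; field_simp
  have hUW : ∫ ω, U ω * (V ω - k * U ω) ∂P = 0 := by
    have e : ∀ ω, U ω * (V ω - k * U ω) = U ω * V ω - k * (U ω * U ω) := fun ω => by ring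
    simp_rw [e]
    rw [integral_sub iUV (iUU.const_mul k), integral_const_mul, hp, hr, hkp, sub_self]
  have hWW : ∫ ω, (V ω - k * U ω) ^ 2 ∂P = q - r ^ 2 / p := by
    have e : ∀ ω, (V ω - k * U ω) ^ 2
        = V ω * V ω - 2 * k * (U ω * V ω) + k ^ 2 * (U ω * U ω) := fun ω => by ring
    have i1 : Integrable (fun ω => V ω * V ω - 2 * k * (U ω * V ω)) P :=
      iVV.sub (iUV.const_mul _)
    simp_rw [e]
    rw [integral_add i1 (iUU.const_mul _), integral_sub iVV (iUV.const_mul _),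
      integral_const_mul, integral_const_mul, hp, hr, hq, ← hkp]
    field_simp
    ring
  obtain ⟨p', hp'⟩ := hU.hasLaw hS
  obtain ⟨q', hq'⟩ := hW.hasLaw hS
  have ep : (p' : ℝ) = p := by
    rw [← integral_sq_of_hasLaw_gaussianReal hp', ← hp]
    simp_rw [sq]
  have eq : (q' : ℝ) = q - r ^ 2 / p := by rw [← integral_sq_of_hasLaw_gaussianReal hq', hWW]
  have hind : IndepFun U (fun ω => V ω - k * U ω) P := by
    have hpi := MemL2.hasGaussianLaw_pi hS (ι := Fin 2) (Y := ![U, fun ω => V ω - k * U ω])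
      (fun i => by fin_cases i <;> simpa)
    refine HasGaussianLaw.indepFun_of_covariance_eq_zero (hpi.prodMk 0 1) ?_
    rw [covariance_eq_sub hU.memLp hW.memLp, hU.integral_eq_zero hS, zero_mul, sub_zero]
    exact hUW
  -- The determinant is unchanged by the shear `(U, V) ↦ (U, V - k U)`.
  have hdet : (1 - 2 * ((a + b * k + c * k ^ 2) * p')) * (1 - 2 * (c * q'))
      - (b + 2 * c * k) ^ 2 * p' * q' = 1 - 2 * (a * p + b * r + c * q)
        + 4 * ((a * c - b ^ 2 / 4) * (p * q - r ^ 2)) := by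
    rw [ep, eq, ← hkp]
    field_simp
    ring
  rw [← hdet, ← lintegral_exp_quadratic_of_indepFun hp' hq' hind (by rw [eq]; exact h1)
    (by rw [hdet]; exact h2)]
  refine lintegral_congr fun ω => ?_
  ring_nf

omit [IsProbabilityMeasure P] in
lemma lintegral_prod_comp_of_iIndepFun {ι : Type*} [Fintype ι] {β : ι → Type*}
    [∀ i, MeasurableSpace (β i)] {X : ∀ i, Ω → β i} (hX : iIndepFun X P)
    (hm : ∀ i, AEMeasurable (X i) P) {f : ∀ i, β i → ℝ≥0∞} (hf : ∀ i, Measurable (f i)) :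
    ∫⁻ ω, ∏ i, f i (X i ω) ∂P = ∏ i, ∫⁻ ω, f i (X i ω) ∂P := by
  have hind : iIndepFun (fun i => f i ∘ (hm i).mk (X i)) P :=
    (hX.congr fun i => (hm i).ae_eq_mk).comp _ hf
  have h := lintegral_prod_eq_prod_lintegral_of_indepFun Finset.univ _ hind
    fun i => (hf i).comp (hm i).measurable_mk
  have hae : ∀ᵐ ω ∂P, ∀ i, X i ω = (hm i).mk (X i) ω := eventually_all.2 fun i => (hm i).ae_eq_mk
  calc ∫⁻ ω, ∏ i, f i (X i ω) ∂P
      = ∫⁻ ω, ∏ i, (f i ∘ (hm i).mk (X i)) ω ∂P := by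
        refine lintegral_congr_ae ?_
        filter_upwards [hae] with ω hω
        exact Finset.prod_congr rfl fun i _ => by rw [hω i]; rfl
    _ = ∏ i, ∫⁻ ω, (f i ∘ (hm i).mk (X i)) ω ∂P := h
    _ = ∏ i, ∫⁻ ω, f i (X i ω) ∂P := by
        refine Finset.prod_congr rfl fun i _ => lintegral_congr_ae ?_
        filter_upwards [hae] with ω hω
        rw [hω i]
        rfl

/-- The exponential moment of a sum of quadratic forms in uncorrelated pairs of jointly Gaussian
variables. -/
theorem MemL2.lintegral_exp_sum_quadratic {S : Submodule ℝ (Lp ℝ 2 P)}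
    (hS : ∀ f ∈ S, IsCenteredGaussian f) {n : ℕ} {U V : Fin n → Ω → ℝ}
    (hU : ∀ k, MemL2 S (U k)) (hV : ∀ k, MemL2 S (V k)) {p r q : Fin n → ℝ}
    (hp : ∀ k, ∫ ω, U k ω * U k ω ∂P = p k) (hr : ∀ k, ∫ ω, U k ω * V k ω ∂P = r k)
    (hq : ∀ k, ∫ ω, V k ω * V k ω ∂P = q k)
    (hUU : ∀ j k, j ≠ k → ∫ ω, U j ω * U k ω ∂P = 0)
    (hUV : ∀ j k, j ≠ k → ∫ ω, U j ω * V k ω ∂P = 0)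
    (hVV : ∀ j k, j ≠ k → ∫ ω, V j ω * V k ω ∂P = 0) (hp0 : ∀ k, 0 < p k) {a b c : ℝ}
    (h1 : ∀ k, 0 < 1 - 2 * (c * (q k - r k ^ 2 / p k)))
    (h2 : ∀ k, 0 < 1 - 2 * (a * p k + b * r k + c * q k)
      + 4 * ((a * c - b ^ 2 / 4) * (p k * q k - r k ^ 2))) :
    ∫⁻ ω, ENNReal.ofReal (Real.exp (∑ k, (a * (U k ω * U k ω) + c * (V k ω * V k ω)
        + b * (U k ω * V k ω)))) ∂P
      = ENNReal.ofReal (Real.exp (∑ k, -(1 / 2) * Real.log (1 - 2 * (a * p k + b * r k + c * q k)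
          + 4 * ((a * c - b ^ 2 / 4) * (p k * q k - r k ^ 2))))) := by
  -- Each pair becomes one vector, so that vanishing covariances between different vectors give
  -- independence of the pairs, although `U k` and `V k` stay correlated.
  let Y : Fin n → Fin 2 → Ω → ℝ := fun k => ![U k, V k]
  have hY : ∀ k i, MemL2 S (Y k i) := fun k i => by
    fin_cases i
    · exact hU k
    · exact hV k
  have hgauss : HasGaussianLaw (fun ω k i => Y k i ω) P :=
    (MemL2.hasGaussianLaw_pi hS (Y := fun x : Fin n × Fin 2 => Y x.1 x.2)
      fun x => hY x.1 x.2).map_equiv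
        (LinearEquiv.curry ℝ ℝ (Fin n) (Fin 2)).toContinuousLinearEquiv
  have hind : iIndepFun (fun k ω i => Y k i ω) P := by
    refine hgauss.iIndepFun_of_covariance_eval fun j k hjk i i' => ?_
    rw [covariance_eq_sub (hY j i).memLp (hY k i').memLp, (hY j i).integral_eq_zero hS, zero_mul,
      sub_zero]
    change ∫ ω, Y j i ω * Y k i' ω ∂P = 0
    fin_cases i <;> fin_cases i'
    · exact hUU j k hjk
    · exact hUV j k hjk
    · simpa [Y, mul_comm] using hUV k j hjk.symm
    · exact hVV j k hjk
  have hm : ∀ k, AEMeasurable (fun ω i => Y k i ω) P := fun k =>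
    aemeasurable_pi_lambda _ fun i => (hY k i).memLp.1.aemeasurable
  have h := lintegral_prod_comp_of_iIndepFun hind hm (f := fun _ (y : Fin 2 → ℝ) =>
    ENNReal.ofReal (Real.exp (a * (y 0 * y 0) + c * (y 1 * y 1) + b * (y 0 * y 1))))
    (fun _ => by fun_prop)
  have hprod : ∀ x : Fin n → ℝ, ENNReal.ofReal (Real.exp (∑ k, x k))
      = ∏ k, ENNReal.ofReal (Real.exp (x k)) := fun x => by
    rw [Real.exp_sum, ENNReal.ofReal_prod_of_nonneg fun _ _ => Real.exp_nonneg _]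
  simp_rw [hprod]
  refine h.trans (Finset.prod_congr rfl fun k _ => ?_)
  exact (hU k).lintegral_exp_quadratic hS (hV k) (hp k) (hr k) (hq k) (hp0 k) (h1 k) (h2 k)

end QuadraticForm

/-! ### Averages of square-integrable functions over uniform partitions -/

section Averaging

/-- The integral of `f` over the `k`-th interval `[k/n, (k+1)/n]` of the uniform partition. -/
noncomputable def cellIntegral (f : ℝ → ℝ) (n k : ℕ) : ℝ :=
  ∫ t in (k : ℝ) / n..((k : ℝ) + 1) / n, f t

lemma sum_cellIntegral {f : ℝ → ℝ} {n : ℕ} (hn : n ≠ 0)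
    (hf : ∀ k < n, IntervalIntegrable f volume ((k : ℝ) / n) (((k : ℝ) + 1) / n)) :
    ∑ k ∈ Finset.range n, cellIntegral f n k = ∫ t in (0 : ℝ)..1, f t := by
  have hn' : (n : ℝ) ≠ 0 := by exact_mod_cast hn
  have h := intervalIntegral.sum_integral_adjacent_intervals (μ := volume) (f := f)
    (a := fun k : ℕ => (k : ℝ) / n) (n := n) (fun k hk => by
      have := hf k hk
      push_cast
      exact this)
  simp only [Nat.cast_zero, zero_div, div_self hn'] at h
  rw [← h]
  refine Finset.sum_congr rfl fun k _ => ?_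
  rw [cellIntegral]
  push_cast
  rfl

lemma cell_length {n : ℕ} (hn : n ≠ 0) (k : ℕ) : ((k : ℝ) + 1) / n - (k : ℝ) / n = (n : ℝ)⁻¹ := by
  have hn' : (n : ℝ) ≠ 0 := by exact_mod_cast hn
  field_simp
  ring

lemma cell_le (n k : ℕ) : (k : ℝ) / n ≤ ((k : ℝ) + 1) / n := by
  gcongr
  linarith

/-- Cauchy–Schwarz on a cell of length `1/n`, obtained by integrating the squared deviation of `f`
from its mean `n A`. -/
lemma sq_cellIntegral_le {f : ℝ → ℝ} {n : ℕ} (hn : n ≠ 0) (k : ℕ)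
    (hf : IntervalIntegrable f volume ((k : ℝ) / n) (((k : ℝ) + 1) / n))
    (hf2 : IntervalIntegrable (fun t => f t ^ 2) volume ((k : ℝ) / n) (((k : ℝ) + 1) / n)) :
    n * cellIntegral f n k ^ 2 ≤ cellIntegral (fun t => f t ^ 2) n k := by
  have hn' : (n : ℝ) ≠ 0 := by exact_mod_cast hn
  set A := cellIntegral f n k with hA
  have h0 : 0 ≤ ∫ t in (k : ℝ) / n..((k : ℝ) + 1) / n, (f t - n * A) ^ 2 :=
    intervalIntegral.integral_nonneg (cell_le n k) fun t _ => sq_nonneg _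
  have e : ∀ t, (f t - n * A) ^ 2 = f t ^ 2 - 2 * (n * A) * f t + (n * A) ^ 2 := fun t => by ring
  simp_rw [e] at h0
  have i1 : IntervalIntegrable (fun t => f t ^ 2 - 2 * (n * A) * f t) volume
      ((k : ℝ) / n) (((k : ℝ) + 1) / n) := hf2.sub (hf.const_mul _)
  rw [intervalIntegral.integral_add i1 intervalIntegrable_const,
    intervalIntegral.integral_sub hf2 (hf.const_mul _), intervalIntegral.integral_const_mul,
    intervalIntegral.integral_const, cell_length hn] at h0
  have e2 : (n : ℝ)⁻¹ • ((n : ℝ) * A) ^ 2 = n * A ^ 2 := by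
    rw [smul_eq_mul]
    field_simp
  rw [e2] at h0
  change 0 ≤ cellIntegral (fun t => f t ^ 2) n k - 2 * (n * A) * A + n * A ^ 2 at h0
  linarith

/-- The average of `F` over the cell of the partition of mesh `1/n` that contains `x`. -/
noncomputable def cellAverage (F : ℝ → ℝ) (n : ℕ) (x : ℝ) : ℝ :=
  n * ∫ t in ((⌈(n : ℝ) * x⌉ : ℝ) - 1) / n..(⌈(n : ℝ) * x⌉ : ℝ) / n, F t

lemma ae_tendsto_cellAverage {F : ℝ → ℝ} (hF : LocallyIntegrable F) :
    ∀ᵐ x, Tendsto (fun n => cellAverage F n x) atTop (𝓝 (F x)) := by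
  -- Lebesgue differentiation along balls that contain `x` without being centered at it: the cell of
  -- `x` is the closed ball with center `(⌈n x⌉ - 1/2) / n` and radius `1 / (2n)`.
  filter_upwards [IsUnifLocDoublingMeasure.ae_tendsto_average (μ := volume) hF 1] with x hx
  have hlim : Tendsto (fun n : ℕ => (n : ℝ)⁻¹ / 2) atTop (𝓝[>] 0) := by
    refine tendsto_nhdsWithin_iff.2 ⟨?_, ?_⟩
    · have := (tendsto_inv_atTop_nhds_zero_nat (𝕜 := ℝ)).div_const 2
      rwa [zero_div] at this
    · filter_upwards [eventually_gt_atTop 0] with n hn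
      have : (0 : ℝ) < n := by exact_mod_cast hn
      simp only [mem_Ioi]
      positivity
  refine (hx (fun n : ℕ => ((⌈(n : ℝ) * x⌉ : ℝ) - 1 / 2) / n) (fun n : ℕ => (n : ℝ)⁻¹ / 2)
    hlim ?_).congr' ?_
  · filter_upwards [eventually_gt_atTop 0] with n hn
    have hn' : (0 : ℝ) < n := by exact_mod_cast hn
    have h1 := Int.le_ceil ((n : ℝ) * x)
    have h2 := Int.ceil_lt_add_one ((n : ℝ) * x)
    rw [Metric.mem_closedBall, Real.dist_eq]
    have e : x - ((⌈(n : ℝ) * x⌉ : ℝ) - 1 / 2) / n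
        = (n * x - (⌈(n : ℝ) * x⌉ - 1 / 2)) * (n : ℝ)⁻¹ := by
      field_simp
    rw [e, abs_mul, abs_of_pos (inv_pos.2 hn')]
    have h3 : |n * x - (⌈(n : ℝ) * x⌉ - 1 / 2)| ≤ 1 / 2 := by
      rw [abs_le]
      constructor <;> linarith
    have := mul_le_mul_of_nonneg_right h3 (inv_pos.2 hn').le
    linarith
  · filter_upwards [eventually_gt_atTop 0] with n hn
    have hn' : (0 : ℝ) < n := by exact_mod_cast hn
    have hball : Metric.closedBall (((⌈(n : ℝ) * x⌉ : ℝ) - 1 / 2) / n) ((n : ℝ)⁻¹ / 2)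
        = Icc (((⌈(n : ℝ) * x⌉ : ℝ) - 1) / n) ((⌈(n : ℝ) * x⌉ : ℝ) / n) := by
      rw [Real.closedBall_eq_Icc]
      congr 1 <;> field_simp <;> ring
    have hle : ((⌈(n : ℝ) * x⌉ : ℝ) - 1) / n ≤ (⌈(n : ℝ) * x⌉ : ℝ) / n := by
      gcongr
      linarith
    rw [hball, setAverage_eq, integral_Icc_eq_integral_Ioc, cellAverage,
      intervalIntegral.integral_of_le hle, Measure.real, Real.volume_Icc, smul_eq_mul,
      ENNReal.toReal_ofReal (sub_nonneg.2 hle)]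
    congr 1
    field_simp
    ring

lemma cellAverage_of_mem {F : ℝ → ℝ} {n k : ℕ} {x : ℝ} (hn : n ≠ 0)
    (hx : x ∈ Ioc ((k : ℝ) / n) (((k : ℝ) + 1) / n)) :
    cellAverage F n x = n * cellIntegral F n k := by
  have hn' : (0 : ℝ) < n := by exact_mod_cast Nat.pos_of_ne_zero hn
  have hc : ⌈(n : ℝ) * x⌉ = (k : ℤ) + 1 := by
    rw [Int.ceil_eq_iff]
    have h1 := (div_lt_iff₀ hn').1 hx.1
    have h2 := (le_div_iff₀ hn').1 hx.2
    push_cast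
    constructor <;> linarith
  rw [cellAverage, hc, cellIntegral]
  push_cast
  rw [add_sub_cancel_right]

lemma integral_sq_cellAverage (F : ℝ → ℝ) {n : ℕ} (hn : n ≠ 0) :
    IntervalIntegrable (fun x => cellAverage F n x ^ 2) volume 0 1 ∧
    ∫ x in (0 : ℝ)..1, cellAverage F n x ^ 2
      = n * ∑ k ∈ Finset.range n, cellIntegral F n k ^ 2 := by
  have hn' : (n : ℝ) ≠ 0 := by exact_mod_cast hn
  have hconst : ∀ k : ℕ, ∀ x ∈ uIoc ((k : ℝ) / n) (((k : ℝ) + 1) / n),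
      (n * cellIntegral F n k) ^ 2 = cellAverage F n x ^ 2 := by
    intro k x hx
    rw [uIoc_of_le (cell_le n k)] at hx
    rw [cellAverage_of_mem hn hx]
  have hint : ∀ k : ℕ, IntervalIntegrable (fun x => cellAverage F n x ^ 2) volume
      ((k : ℝ) / n) (((k : ℝ) + 1) / n) := fun k =>
    (intervalIntegrable_const (c := (n * cellIntegral F n k) ^ 2)).congr (hconst k)
  constructor
  · have h := IntervalIntegrable.trans_iterate (μ := volume) (f := fun x => cellAverage F n x ^ 2)
      (a := fun k : ℕ => (k : ℝ) / n) (n := n) (fun k _ => by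
        have := hint k
        push_cast
        exact this)
    simpa [div_self hn'] using h
  · rw [← sum_cellIntegral hn fun k _ => hint k, Finset.mul_sum]
    refine Finset.sum_congr rfl fun k _ => ?_
    rw [cellIntegral, ← intervalIntegral.integral_congr_ae (ae_of_all _ (hconst k)),
      intervalIntegral.integral_const, cell_length hn, smul_eq_mul]
    field_simp

/-- The sum is the squared `L²` norm of the cell average of `F` on `[0, 1]`. Cauchy–Schwarz bounds
it by `∫ F²`; almost everywhere convergence of the averages and Fatou's lemma give the matching
lower bound. -/
lemma tendsto_mul_sum_sq_cellIntegral_of_integrable {F : ℝ → ℝ} (hF : Integrable F)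
    (hF2 : Integrable fun t => F t ^ 2) :
    Tendsto (fun n : ℕ => n * ∑ k ∈ Finset.range n, cellIntegral F n k ^ 2) atTop
      (𝓝 (∫ t in (0 : ℝ)..1, F t ^ 2)) := by
  have hI0 : 0 ≤ ∫ t in (0 : ℝ)..1, F t ^ 2 :=
    intervalIntegral.integral_nonneg zero_le_one fun t _ => sq_nonneg _
  have hq0 : ∀ n : ℕ, 0 ≤ (n : ℝ) * ∑ k ∈ Finset.range n, cellIntegral F n k ^ 2 := fun n =>
    mul_nonneg n.cast_nonneg (Finset.sum_nonneg fun _ _ => sq_nonneg _)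
  have hupper : ∀ n : ℕ, n ≠ 0 → n * ∑ k ∈ Finset.range n, cellIntegral F n k ^ 2
      ≤ ∫ t in (0 : ℝ)..1, F t ^ 2 := by
    intro n hn
    rw [← sum_cellIntegral hn fun k _ => hF2.intervalIntegrable, Finset.mul_sum]
    exact Finset.sum_le_sum fun k _ =>
      sq_cellIntegral_le hn k hF.intervalIntegrable hF2.intervalIntegrable
  have hlower : ENNReal.ofReal (∫ t in (0 : ℝ)..1, F t ^ 2)
      ≤ liminf (fun n : ℕ => ENNReal.ofReal (n * ∑ k ∈ Finset.range n, cellIntegral F n k ^ 2))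
        atTop := by
    have hE : ∀ n : ℕ, n ≠ 0 →
        ENNReal.ofReal (n * ∑ k ∈ Finset.range n, cellIntegral F n k ^ 2)
        = ∫⁻ x in Ioc 0 1, ENNReal.ofReal (cellAverage F n x ^ 2) := by
      intro n hn
      obtain ⟨h1, h2⟩ := integral_sq_cellAverage F hn
      rw [← h2, intervalIntegral.integral_of_le zero_le_one,
        ofReal_integral_eq_lintegral_ofReal h1.1 (ae_of_all _ fun x => sq_nonneg _)]
    -- The shift to `n + 1` avoids `n = 0`, where there is no partition.
    have hae : ∀ᵐ x ∂volume.restrict (Ioc (0 : ℝ) 1), ENNReal.ofReal (F x ^ 2)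
        = liminf (fun n : ℕ => ENNReal.ofReal (cellAverage F (n + 1) x ^ 2)) atTop := by
      filter_upwards [ae_restrict_of_ae (ae_tendsto_cellAverage hF.locallyIntegrable)] with x hx
      exact ((ENNReal.tendsto_ofReal ((hx.comp (tendsto_add_atTop_nat 1)).pow 2)).liminf_eq).symm
    rw [intervalIntegral.integral_of_le zero_le_one,
      ofReal_integral_eq_lintegral_ofReal hF2.restrict (ae_of_all _ fun x => sq_nonneg _),
      lintegral_congr_ae hae, ← liminf_nat_add _ 1]
    refine (lintegral_liminf_le' fun n => ?_).trans (le_of_eq ?_)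
    · exact (integral_sq_cellAverage F n.succ_ne_zero).1.1.1.aemeasurable.ennreal_ofReal
    · congr 1
      ext n
      exact (hE (n + 1) n.succ_ne_zero).symm
  have hlim : Tendsto (fun n : ℕ =>
      ENNReal.ofReal (n * ∑ k ∈ Finset.range n, cellIntegral F n k ^ 2)) atTop
      (𝓝 (ENNReal.ofReal (∫ t in (0 : ℝ)..1, F t ^ 2))) := by
    refine tendsto_of_le_liminf_of_limsup_le hlower ?_
    refine limsup_le_of_le (by isBoundedDefault) ?_
    filter_upwards [eventually_ne_atTop 0] with n hn
    exact ENNReal.ofReal_le_ofReal (hupper n hn)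
  have := (ENNReal.tendsto_toReal ENNReal.ofReal_ne_top).comp hlim
  rw [ENNReal.toReal_ofReal hI0] at this
  refine this.congr fun n => ?_
  rw [Function.comp_apply, ENNReal.toReal_ofReal (hq0 n)]

lemma cell_subset {n k : ℕ} (hk : k < n) :
    uIcc ((k : ℝ) / n) (((k : ℝ) + 1) / n) ⊆ Icc 0 1 := by
  have hn : (0 : ℝ) < n := by exact_mod_cast (Nat.zero_le k).trans_lt hk
  rw [uIcc_of_le (cell_le n k)]
  refine Icc_subset_Icc (by positivity) ?_
  rw [div_le_one hn]
  exact_mod_cast hk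

/-- `n ∑ₖ (∫_{Iₖ} f)² → ∫₀¹ f²` for `f ∈ L²([0, 1])`. -/
theorem tendsto_mul_sum_sq_cellIntegral {f : ℝ → ℝ}
    (hf : MemLp f 2 (volume.restrict (Icc (0 : ℝ) 1))) :
    Tendsto (fun n : ℕ => n * ∑ k ∈ Finset.range n, cellIntegral f n k ^ 2) atTop
      (𝓝 (∫ t in (0 : ℝ)..1, f t ^ 2)) := by
  -- Differentiation needs a locally integrable function on the whole line; extension by zero
  -- changes no cell integral.
  set F := (Icc (0 : ℝ) 1).indicator f with hFdef
  have hF : Integrable F := (integrable_indicator_iff measurableSet_Icc).2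
    (hf.integrable (by norm_num))
  have hsq : (fun t => F t ^ 2) = (Icc (0 : ℝ) 1).indicator fun t => f t ^ 2 := by
    ext t
    by_cases ht : t ∈ Icc (0 : ℝ) 1 <;> simp [hFdef, ht]
  have hF2 : Integrable fun t => F t ^ 2 := by
    rw [hsq]
    exact (integrable_indicator_iff measurableSet_Icc).2 hf.integrable_sq
  have hFf : ∀ t ∈ Icc (0 : ℝ) 1, F t = f t := fun t ht => indicator_of_mem ht _
  have h := tendsto_mul_sum_sq_cellIntegral_of_integrable hF hF2
  have e : ∫ t in (0 : ℝ)..1, F t ^ 2 = ∫ t in (0 : ℝ)..1, f t ^ 2 :=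
    intervalIntegral.integral_congr fun t ht => by
      rw [uIcc_of_le zero_le_one] at ht
      simp only [hFf t ht]
  rw [e] at h
  refine h.congr fun n => ?_
  congr 1
  refine Finset.sum_congr rfl fun k hk => ?_
  congr 1
  exact intervalIntegral.integral_congr fun t ht => hFf t (cell_subset (Finset.mem_range.1 hk) ht)

lemma intervalIntegrable_cell {f : ℝ → ℝ} (hf : IntegrableOn f (Icc (0 : ℝ) 1)) {n k : ℕ}
    (hk : k < n) : IntervalIntegrable f volume ((k : ℝ) / n) (((k : ℝ) + 1) / n) :=
  (hf.mono_set (cell_subset hk)).intervalIntegrable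

/-- Polarization of the quadratic case, applied to `f + g` and `f - g`. -/
theorem tendsto_mul_sum_cellIntegral_mul {f g : ℝ → ℝ}
    (hf : MemLp f 2 (volume.restrict (Icc (0 : ℝ) 1)))
    (hg : MemLp g 2 (volume.restrict (Icc (0 : ℝ) 1))) :
    Tendsto (fun n : ℕ => n * ∑ k ∈ Finset.range n, cellIntegral f n k * cellIntegral g n k) atTop
      (𝓝 (∫ t in (0 : ℝ)..1, f t * g t)) := by
  have hadd := tendsto_mul_sum_sq_cellIntegral (hf.add hg)
  have hsub := tendsto_mul_sum_sq_cellIntegral (hf.sub hg)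
  have h := (hadd.sub hsub).const_mul (1 / 4)
  have hi : ∀ {u : ℝ → ℝ}, MemLp u 2 (volume.restrict (Icc (0 : ℝ) 1)) →
      IntegrableOn u (Icc 0 1) := fun hu => hu.integrable (by norm_num)
  have hi2 : ∀ {u : ℝ → ℝ}, MemLp u 2 (volume.restrict (Icc (0 : ℝ) 1)) →
      IntervalIntegrable (fun t => u t ^ 2) volume 0 1 := fun {u} hu => by
    have h1 : IntegrableOn (fun t => u t ^ 2) (uIcc 0 1) := by
      rw [uIcc_of_le zero_le_one]
      exact hu.integrable_sq
    exact h1.intervalIntegrable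
  have e : 1 / 4 * ((∫ t in (0 : ℝ)..1, (f + g) t ^ 2) - ∫ t in (0 : ℝ)..1, (f - g) t ^ 2)
      = ∫ t in (0 : ℝ)..1, f t * g t := by
    rw [← intervalIntegral.integral_sub (hi2 (hf.add hg)) (hi2 (hf.sub hg)),
      ← intervalIntegral.integral_const_mul]
    refine intervalIntegral.integral_congr fun t _ => ?_
    simp only [Pi.add_apply, Pi.sub_apply]
    ring
  rw [e] at h
  refine h.congr fun n => ?_
  rw [← mul_sub, ← Finset.sum_sub_distrib, mul_left_comm, Finset.mul_sum]
  congr 1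
  refine Finset.sum_congr rfl fun k hk => ?_
  have hk' := Finset.mem_range.1 hk
  have e1 : cellIntegral (f + g) n k = cellIntegral f n k + cellIntegral g n k :=
    intervalIntegral.integral_add (intervalIntegrable_cell (hi hf) hk')
      (intervalIntegrable_cell (hi hg) hk')
  have e2 : cellIntegral (f - g) n k = cellIntegral f n k - cellIntegral g n k :=
    intervalIntegral.integral_sub (intervalIntegrable_cell (hi hf) hk')
      (intervalIntegrable_cell (hi hg) hk')
  rw [e1, e2]
  ring

end Averaging

/-! ### Expansion of the logarithm of a 2 × 2 determinant. -/

section LogDeterminant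

/-- Second order expansion of `-½ log det` with a cubic error. -/
lemma abs_neg_half_log_sub_le {T Δ m : ℝ} (hm : m ≤ 1 / 16) (hT : |T| ≤ m) (hΔ : |Δ| ≤ m ^ 2) :
    0 < 1 - 2 * T + 4 * Δ ∧
    |(-(1 / 2) * Real.log (1 - 2 * T + 4 * Δ) - T) - (T ^ 2 - 2 * Δ)| ≤ 35 * m ^ 3 := by
  have hm0 : 0 ≤ m := (abs_nonneg T).trans hT
  set w := 2 * T - 4 * Δ with hw
  have hm2 : m ^ 2 ≤ m / 16 := by nlinarith
  have hw3 : |w| ≤ 3 * m := by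
    calc |w| ≤ |2 * T| + |4 * Δ| := abs_sub _ _
      _ = 2 * |T| + 4 * |Δ| := by rw [abs_mul, abs_mul]; norm_num
      _ ≤ 3 * m := by linarith
  have hw1 : |w| ≤ 1 / 2 := by linarith
  have e1 : 1 - 2 * T + 4 * Δ = 1 - w := by rw [hw]; ring
  rw [e1]
  refine ⟨by linarith [le_abs_self w], ?_⟩
  have hlog := Real.abs_log_sub_add_sum_range_le (show |w| < 1 by linarith) 2
  simp only [Finset.sum_range_succ, Finset.sum_range_zero, zero_add, pow_one, Nat.cast_zero,
    Nat.cast_one, div_one] at hlog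
  norm_num at hlog
  -- The Taylor remainder is at most `|w|³ / (1 - |w|)`; the constant is `3³ / (1/2) = 54`.
  have hlog' : |w + w ^ 2 / 2 + Real.log (1 - w)| ≤ 54 * m ^ 3 := by
    refine hlog.trans ?_
    rw [div_le_iff₀ (by linarith)]
    have h3 : |w| ^ 3 ≤ (3 * m) ^ 3 := by gcongr
    have h4 : 54 * m ^ 3 * (1 / 2) ≤ 54 * m ^ 3 * (1 - |w|) := by
      gcongr
      linarith
    calc |w| ^ 3 ≤ (3 * m) ^ 3 := h3
      _ = 54 * m ^ 3 * (1 / 2) := by ring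
      _ ≤ _ := h4
  have hrem : (-(1 / 2) * Real.log (1 - w) - T) - (T ^ 2 - 2 * Δ)
      = -(1 / 2) * (w + w ^ 2 / 2 + Real.log (1 - w)) + (-4 * (T * Δ) + 4 * (Δ * Δ)) := by
    rw [hw]
    ring
  have hTΔ : |T * Δ| ≤ m ^ 3 := by
    rw [abs_mul]
    calc |T| * |Δ| ≤ m * m ^ 2 := by gcongr
      _ = m ^ 3 := by ring
  have hΔΔ : |Δ * Δ| ≤ m ^ 3 / 16 := by
    rw [abs_mul]
    calc |Δ| * |Δ| ≤ m ^ 2 * m ^ 2 := by gcongr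
      _ = m ^ 3 * m := by ring
      _ ≤ m ^ 3 * (1 / 16) := by gcongr
      _ = m ^ 3 / 16 := by ring
  have hm3 : 0 ≤ m ^ 3 := by positivity
  -- The three errors add up to `27 + 4 + 1/4` times `m³`, which is below `35 m³`.
  rw [hrem]
  have a1 := abs_le.1 hlog'
  have a2 := abs_le.1 hTΔ
  have a3 := abs_le.1 hΔΔ
  rw [abs_le]
  constructor <;> linarith

end LogDeterminant

/-! ### The volatility coefficients and the limiting quadratic form -/

/-- The standing assumptions on the deterministic coefficients. -/
structure VolatilityCoefficients (σ₁ σ₂ ρ : ℝ → ℝ) : Prop where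
  aemeasurable₁ : AEMeasurable σ₁ (volume.restrict (Icc (0 : ℝ) 1))
  aemeasurable₂ : AEMeasurable σ₂ (volume.restrict (Icc (0 : ℝ) 1))
  aemeasurable_corr : AEMeasurable ρ (volume.restrict (Icc (0 : ℝ) 1))
  pos₁ : ∀ t ∈ Icc (0 : ℝ) 1, 0 < σ₁ t
  pos₂ : ∀ t ∈ Icc (0 : ℝ) 1, 0 < σ₂ t
  corr_mem : ∀ t ∈ Icc (0 : ℝ) 1, ρ t ∈ Ioo (-1 : ℝ) 1
  fourth₁ : IntegrableOn (fun t => σ₁ t ^ 4) (Icc (0 : ℝ) 1)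
  fourth₂ : IntegrableOn (fun t => σ₂ t ^ 4) (Icc (0 : ℝ) 1)

/-- For `A = ((x, z/2), (z/2, y))` and `C = L Lᵀ` with `L` the Cholesky factor of the spot
covariance matrix, this is `tr (A C A C) = ‖Lᵀ A L‖²`. -/
lemma spot_quadratic_pos {x y z s t r : ℝ} (hs : 0 < s) (ht : 0 < t) (hr : r ∈ Ioo (-1 : ℝ) 1)
    (h : ¬(x = 0 ∧ y = 0 ∧ z = 0)) :
    0 < x ^ 2 * (s ^ 2 * s ^ 2) + y ^ 2 * (t ^ 2 * t ^ 2) + z ^ 2 / 2 * (s ^ 2 * t ^ 2)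
      + (z ^ 2 / 2 + 2 * x * y) * ((s * t * r) * (s * t * r)) + 2 * x * z * (s ^ 2 * (s * t * r))
      + 2 * y * z * (t ^ 2 * (s * t * r)) := by
  have hr2 : 0 < 1 - r ^ 2 := by nlinarith [hr.1, hr.2]
  -- The three terms come from the entries of `Lᵀ A L`: the (1,1) entry squared, twice the square of
  -- the off-diagonal entry, and the (2,2) entry squared. Read backwards, their vanishing forces
  -- `y`, then `z`, then `x` to be zero.
  have e : x ^ 2 * (s ^ 2 * s ^ 2) + y ^ 2 * (t ^ 2 * t ^ 2) + z ^ 2 / 2 * (s ^ 2 * t ^ 2)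
      + (z ^ 2 / 2 + 2 * x * y) * ((s * t * r) * (s * t * r)) + 2 * x * z * (s ^ 2 * (s * t * r))
      + 2 * y * z * (t ^ 2 * (s * t * r))
      = (x * s ^ 2 + z * (s * t * r) + y * (t ^ 2 * r ^ 2)) ^ 2
        + t ^ 2 * (1 - r ^ 2) / 2 * (z * s + 2 * y * t * r) ^ 2
        + (t ^ 2 * (1 - r ^ 2)) ^ 2 * y ^ 2 := by ring
  rw [e]
  have c0 : 0 < t ^ 2 * (1 - r ^ 2) := by positivity
  by_contra! hle
  have h1 : 0 ≤ (x * s ^ 2 + z * (s * t * r) + y * (t ^ 2 * r ^ 2)) ^ 2 := sq_nonneg _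
  have h2 : 0 ≤ t ^ 2 * (1 - r ^ 2) / 2 * (z * s + 2 * y * t * r) ^ 2 := by positivity
  have h3 : 0 ≤ (t ^ 2 * (1 - r ^ 2)) ^ 2 * y ^ 2 := by positivity
  have e3 : (t ^ 2 * (1 - r ^ 2)) ^ 2 * y ^ 2 = 0 := by linarith
  have e2 : t ^ 2 * (1 - r ^ 2) / 2 * (z * s + 2 * y * t * r) ^ 2 = 0 := by linarith
  have e1 : (x * s ^ 2 + z * (s * t * r) + y * (t ^ 2 * r ^ 2)) ^ 2 = 0 := by linarith
  have hy : y = 0 := by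
    rcases mul_eq_zero.1 e3 with h' | h'
    · exact absurd h' (by positivity)
    · simpa using h'
  have hz : z = 0 := by
    rcases mul_eq_zero.1 e2 with h' | h'
    · exact absurd h' (by positivity)
    · have h'' : z * s = 0 := by simpa [hy] using h'
      exact (mul_eq_zero.1 h'').resolve_right hs.ne'
  have hx : x = 0 := by
    have h'' : x * s ^ 2 = 0 := by simpa [hy, hz] using e1
    exact (mul_eq_zero.1 h'').resolve_right (by positivity)
  exact h ⟨hx, hy, hz⟩

lemma covMatrix_eq (σ₁ σ₂ ρ : ℝ → ℝ)
    (h : IntervalIntegrable (fun t => σ₁ t ^ 2 * σ₂ t ^ 2) volume 0 1)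
    (h' : IntervalIntegrable (fun t => (σ₁ t * σ₂ t * ρ t) * (σ₁ t * σ₂ t * ρ t)) volume 0 1) :
    covMatrix σ₁ σ₂ ρ =
      !![2 * ∫ t in (0 : ℝ)..1, σ₁ t ^ 2 * σ₁ t ^ 2,
          2 * ∫ t in (0 : ℝ)..1, (σ₁ t * σ₂ t * ρ t) * (σ₁ t * σ₂ t * ρ t),
          2 * ∫ t in (0 : ℝ)..1, σ₁ t ^ 2 * (σ₁ t * σ₂ t * ρ t);
        2 * ∫ t in (0 : ℝ)..1, (σ₁ t * σ₂ t * ρ t) * (σ₁ t * σ₂ t * ρ t),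
          2 * ∫ t in (0 : ℝ)..1, σ₂ t ^ 2 * σ₂ t ^ 2,
          2 * ∫ t in (0 : ℝ)..1, σ₂ t ^ 2 * (σ₁ t * σ₂ t * ρ t);
        2 * ∫ t in (0 : ℝ)..1, σ₁ t ^ 2 * (σ₁ t * σ₂ t * ρ t),
          2 * ∫ t in (0 : ℝ)..1, σ₂ t ^ 2 * (σ₁ t * σ₂ t * ρ t),
          (∫ t in (0 : ℝ)..1, σ₁ t ^ 2 * σ₂ t ^ 2)
            + ∫ t in (0 : ℝ)..1, (σ₁ t * σ₂ t * ρ t) * (σ₁ t * σ₂ t * ρ t)] := by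
  rw [← intervalIntegral.integral_add h h']
  simp_rw [← intervalIntegral.integral_const_mul]
  ext i j
  fin_cases i <;> fin_cases j <;>
    exact intervalIntegral.integral_congr fun t _ => by ring

/-- Expressed through products of `σ₁²`, `σ₂²` and `σ₁ σ₂ ρ`, half the quadratic form has exactly
the shape of the limit found for the log-Laplace transforms. -/
lemma half_quadratic_covMatrix {σ₁ σ₂ ρ : ℝ → ℝ}
    (h : IntervalIntegrable (fun t => σ₁ t ^ 2 * σ₂ t ^ 2) volume 0 1)
    (h' : IntervalIntegrable (fun t => (σ₁ t * σ₂ t * ρ t) * (σ₁ t * σ₂ t * ρ t)) volume 0 1)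
    (l : Fin 3 → ℝ) :
    1 / 2 * (l ⬝ᵥ (covMatrix σ₁ σ₂ ρ *ᵥ l))
      = l 0 ^ 2 * (∫ t in (0 : ℝ)..1, σ₁ t ^ 2 * σ₁ t ^ 2)
        + l 1 ^ 2 * (∫ t in (0 : ℝ)..1, σ₂ t ^ 2 * σ₂ t ^ 2)
        + l 2 ^ 2 / 2 * (∫ t in (0 : ℝ)..1, σ₁ t ^ 2 * σ₂ t ^ 2)
        + (l 2 ^ 2 / 2 + 2 * l 0 * l 1)
          * (∫ t in (0 : ℝ)..1, (σ₁ t * σ₂ t * ρ t) * (σ₁ t * σ₂ t * ρ t))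
        + 2 * l 0 * l 2 * (∫ t in (0 : ℝ)..1, σ₁ t ^ 2 * (σ₁ t * σ₂ t * ρ t))
        + 2 * l 1 * l 2 * (∫ t in (0 : ℝ)..1, σ₂ t ^ 2 * (σ₁ t * σ₂ t * ρ t)) := by
  rw [covMatrix_eq σ₁ σ₂ ρ h h']
  simp only [Matrix.mulVec, dotProduct, Fin.sum_univ_three, Matrix.of_apply, Matrix.cons_val]
  ring

namespace VolatilityCoefficients

variable {σ₁ σ₂ ρ : ℝ → ℝ}

lemma memLp_sq₁ (h : VolatilityCoefficients σ₁ σ₂ ρ) :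
    MemLp (fun t => σ₁ t ^ 2) 2 (volume.restrict (Icc (0 : ℝ) 1)) := by
  rw [memLp_two_iff_integrable_sq (h.aemeasurable₁.pow_const 2).aestronglyMeasurable]
  refine h.fourth₁.congr (ae_of_all _ fun t => ?_)
  simp only
  ring

lemma memLp_sq₂ (h : VolatilityCoefficients σ₁ σ₂ ρ) :
    MemLp (fun t => σ₂ t ^ 2) 2 (volume.restrict (Icc (0 : ℝ) 1)) := by
  rw [memLp_two_iff_integrable_sq (h.aemeasurable₂.pow_const 2).aestronglyMeasurable]
  refine h.fourth₂.congr (ae_of_all _ fun t => ?_)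
  simp only
  ring

lemma abs_mul_mul_corr_le (h : VolatilityCoefficients σ₁ σ₂ ρ) {t : ℝ} (ht : t ∈ Icc (0 : ℝ) 1) :
    |σ₁ t * σ₂ t * ρ t| ≤ σ₁ t ^ 2 + σ₂ t ^ 2 := by
  have h1 := h.pos₁ t ht
  have h2 := h.pos₂ t ht
  have hρ : |ρ t| ≤ 1 := abs_le.2 ⟨(h.corr_mem t ht).1.le, (h.corr_mem t ht).2.le⟩
  rw [abs_mul, abs_of_pos (mul_pos h1 h2)]
  nlinarith [mul_pos h1 h2, sq_nonneg (σ₁ t - σ₂ t)]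

lemma memLp_mul_corr (h : VolatilityCoefficients σ₁ σ₂ ρ) :
    MemLp (fun t => σ₁ t * σ₂ t * ρ t) 2 (volume.restrict (Icc (0 : ℝ) 1)) := by
  refine (h.memLp_sq₁.add h.memLp_sq₂).of_le
    ((h.aemeasurable₁.mul h.aemeasurable₂).mul h.aemeasurable_corr).aestronglyMeasurable ?_
  refine (ae_restrict_iff' measurableSet_Icc).2 (ae_of_all _ fun t ht => ?_)
  exact (h.abs_mul_mul_corr_le ht).trans (le_abs_self _)

lemma intervalIntegrable_mul {f g : ℝ → ℝ} (hf : MemLp f 2 (volume.restrict (Icc (0 : ℝ) 1)))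
    (hg : MemLp g 2 (volume.restrict (Icc (0 : ℝ) 1))) :
    IntervalIntegrable (fun t => f t * g t) volume 0 1 := by
  have h1 : IntegrableOn (fun t => f t * g t) (uIcc 0 1) := by
    rw [uIcc_of_le zero_le_one]
    exact hf.integrable_mul hg
  exact h1.intervalIntegrable

/-- Half the quadratic form is the integral of the spot form, which is positive at every time by
`spot_quadratic_pos`. -/
theorem posDef_covMatrix (h : VolatilityCoefficients σ₁ σ₂ ρ) :
    (covMatrix σ₁ σ₂ ρ).PosDef := by
  have m1 := h.memLp_sq₁
  have m2 := h.memLp_sq₂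
  have m12 := h.memLp_mul_corr
  have i1 := intervalIntegrable_mul m1 m2
  have i2 := intervalIntegrable_mul m12 m12
  refine Matrix.PosDef.of_dotProduct_mulVec_pos ?_ fun l hl => ?_
  · rw [covMatrix_eq σ₁ σ₂ ρ i1 i2]
    ext i j
    fin_cases i <;> fin_cases j <;> simp
  have hq := half_quadratic_covMatrix i1 i2 l
  simp_rw [← intervalIntegral.integral_const_mul] at hq
  have j1 := (intervalIntegrable_mul m1 m1).const_mul (l 0 ^ 2)
  have j2 := (intervalIntegrable_mul m2 m2).const_mul (l 1 ^ 2)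
  have j3 := i1.const_mul (l 2 ^ 2 / 2)
  have j4 := i2.const_mul (l 2 ^ 2 / 2 + 2 * l 0 * l 1)
  have j5 := (intervalIntegrable_mul m1 m12).const_mul (2 * l 0 * l 2)
  have j6 := (intervalIntegrable_mul m2 m12).const_mul (2 * l 1 * l 2)
  rw [← intervalIntegral.integral_add j1 j2, ← intervalIntegral.integral_add (j1.add j2) j3,
    ← intervalIntegral.integral_add ((j1.add j2).add j3) j4,
    ← intervalIntegral.integral_add (((j1.add j2).add j3).add j4) j5,
    ← intervalIntegral.integral_add ((((j1.add j2).add j3).add j4).add j5) j6] at hq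
  have hpos := intervalIntegral.intervalIntegral_pos_of_pos_on
    (((((j1.add j2).add j3).add j4).add j5).add j6) (fun t ht => by
      have ht' : t ∈ Icc (0 : ℝ) 1 := Ioo_subset_Icc_self ht
      refine spot_quadratic_pos (x := l 0) (y := l 1) (z := l 2) (h.pos₁ t ht') (h.pos₂ t ht')
        (h.corr_mem t ht') fun h0 => hl ?_
      ext i
      fin_cases i
      exacts [h0.1, h0.2.1, h0.2.2]) zero_lt_one
  simp only [star_trivial]
  change 0 < ∫ t in (0 : ℝ)..1, _ at hpos
  linarith

/-! ### Bounds on the covariance matrix of a single cell. -/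

section Cells

variable {n k : ℕ}

lemma integrableOn_of_memLp {f : ℝ → ℝ} (hf : MemLp f 2 (volume.restrict (Icc (0 : ℝ) 1))) :
    IntegrableOn f (Icc 0 1) := hf.integrable (by norm_num)

lemma cellIntegral_sq₁_pos (h : VolatilityCoefficients σ₁ σ₂ ρ) (hk : k < n) :
    0 < cellIntegral (fun t => σ₁ t ^ 2) n k := by
  have hn : (0 : ℝ) < n := by exact_mod_cast (Nat.zero_le k).trans_lt hk
  have hlt : (k : ℝ) / n < ((k : ℝ) + 1) / n := by gcongr; linarith
  refine intervalIntegral.intervalIntegral_pos_of_pos_on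
    (intervalIntegrable_cell (integrableOn_of_memLp h.memLp_sq₁) hk) (fun t ht => ?_) hlt
  have ht' : t ∈ Icc (0 : ℝ) 1 := cell_subset hk (by
    rw [uIcc_of_le hlt.le]
    exact Ioo_subset_Icc_self ht)
  have := h.pos₁ t ht'
  positivity

lemma cellIntegral_sq_nonneg (σ : ℝ → ℝ) (n k : ℕ) : 0 ≤ cellIntegral (fun t => σ t ^ 2) n k :=
  intervalIntegral.integral_nonneg (cell_le n k) fun _ _ => sq_nonneg _

lemma abs_cellIntegral_mul_corr_le (h : VolatilityCoefficients σ₁ σ₂ ρ) (hk : k < n) :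
    |cellIntegral (fun t => σ₁ t * σ₂ t * ρ t) n k|
      ≤ cellIntegral (fun t => σ₁ t ^ 2) n k + cellIntegral (fun t => σ₂ t ^ 2) n k := by
  have i1 := intervalIntegrable_cell (integrableOn_of_memLp h.memLp_sq₁) hk
  have i2 := intervalIntegrable_cell (integrableOn_of_memLp h.memLp_sq₂) hk
  have i12 := intervalIntegrable_cell (integrableOn_of_memLp h.memLp_mul_corr) hk
  refine (intervalIntegral.abs_integral_le_integral_abs (cell_le n k)).trans ?_
  rw [cellIntegral, cellIntegral, ← intervalIntegral.integral_add i1 i2]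
  refine intervalIntegral.integral_mono_on (cell_le n k) i12.abs (i1.add i2) fun t ht => ?_
  refine h.abs_mul_mul_corr_le (cell_subset hk ?_)
  rwa [uIcc_of_le (cell_le n k)]

/-- Discriminant argument: `x² p - 2 x r + q` is the integral of a nonnegative function for every
`x`, in particular for its minimizer `x = r / p`. -/
lemma sq_cellIntegral_mul_corr_le (h : VolatilityCoefficients σ₁ σ₂ ρ) (hk : k < n) :
    cellIntegral (fun t => σ₁ t * σ₂ t * ρ t) n k ^ 2
      ≤ cellIntegral (fun t => σ₁ t ^ 2) n k * cellIntegral (fun t => σ₂ t ^ 2) n k := by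
  have i1 := intervalIntegrable_cell (integrableOn_of_memLp h.memLp_sq₁) hk
  have i2 := intervalIntegrable_cell (integrableOn_of_memLp h.memLp_sq₂) hk
  have i12 := intervalIntegrable_cell (integrableOn_of_memLp h.memLp_mul_corr) hk
  have hp := h.cellIntegral_sq₁_pos hk
  set p := cellIntegral (fun t => σ₁ t ^ 2) n k with hpdef
  set q := cellIntegral (fun t => σ₂ t ^ 2) n k with hqdef
  set r := cellIntegral (fun t => σ₁ t * σ₂ t * ρ t) n k with hrdef
  have key : ∀ x : ℝ, 0 ≤ x ^ 2 * p - 2 * x * r + q := by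
    intro x
    have j1 := i1.const_mul (x ^ 2)
    have j12 := i12.const_mul (2 * x)
    have e : ∫ t in (k : ℝ) / n..((k : ℝ) + 1) / n,
        (x ^ 2 * σ₁ t ^ 2 - 2 * x * (σ₁ t * σ₂ t * ρ t) + σ₂ t ^ 2)
        = x ^ 2 * p - 2 * x * r + q := by
      rw [intervalIntegral.integral_add (j1.sub j12) i2, intervalIntegral.integral_sub j1 j12,
        intervalIntegral.integral_const_mul, intervalIntegral.integral_const_mul]
      rfl
    rw [← e]
    refine intervalIntegral.integral_nonneg (cell_le n k) fun t ht => ?_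
    have ht' : t ∈ Icc (0 : ℝ) 1 := cell_subset hk (by rwa [uIcc_of_le (cell_le n k)])
    have hρ2 : 0 ≤ 1 - ρ t ^ 2 := by nlinarith [(h.corr_mem t ht').1, (h.corr_mem t ht').2]
    have : x ^ 2 * σ₁ t ^ 2 - 2 * x * (σ₁ t * σ₂ t * ρ t) + σ₂ t ^ 2
        = (x * σ₁ t - σ₂ t * ρ t) ^ 2 + σ₂ t ^ 2 * (1 - ρ t ^ 2) := by ring
    rw [this]
    positivity
  have hx := key (r / p)
  have e : (r / p) ^ 2 * p - 2 * (r / p) * r + q = q - r ^ 2 / p := by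
    field_simp
    ring
  rw [e, sub_nonneg, div_le_iff₀ hp] at hx
  linarith

end Cells

end VolatilityCoefficients

/-! ### Convergence of the log-Laplace transforms -/

section LogLaplace

/-- For a pair of Gaussian variables with covariance matrix `((p, r), (r, q))`, half the trace term
`⟨A, C⟩` of the log-Laplace transform of the quadratic form `a u² + b u v + c v²`. -/
def traceTerm (a b c p r q : ℝ) : ℝ := a * p + b * r + c * q

/-- The determinant `det A · det C` of the quadratic form and the covariance matrix. -/
noncomputable def detTerm (a b c p r q : ℝ) : ℝ := (a * c - b ^ 2 / 4) * (p * q - r ^ 2)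

/-- The log-Laplace transform of the centered quadratic form `a u² + b u v + c v²`. -/
noncomputable def cellLogLaplace (a b c p r q : ℝ) : ℝ :=
  -(1 / 2) * Real.log (1 - 2 * traceTerm a b c p r q + 4 * detTerm a b c p r q)
    - traceTerm a b c p r q

/-- The trace is linear and the determinant quadratic in `s`, so with `m = L s (p + q)` they are at
most `m` and `m²`, as `abs_neg_half_log_sub_le` requires. The first conclusion makes the exponential
moment of the regression residual finite. -/
lemma cellLogLaplace_estimates {s x y z p r q : ℝ} (hs : 0 ≤ s) (hp : 0 ≤ p) (hq : 0 ≤ q)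
    (hr : |r| ≤ p + q) (hrr : r ^ 2 ≤ p * q)
    (hm : (|x| + |y| + |z|) * (s * (p + q)) ≤ 1 / 16) :
    0 < 1 - 2 * ((s * y) * (q - r ^ 2 / p)) ∧
    0 < 1 - 2 * traceTerm (s * x) (s * z) (s * y) p r q
      + 4 * detTerm (s * x) (s * z) (s * y) p r q ∧
    |cellLogLaplace (s * x) (s * z) (s * y) p r q
      - s ^ 2 * (traceTerm x z y p r q ^ 2 - 2 * detTerm x z y p r q)|
        ≤ 35 * ((|x| + |y| + |z|) * (s * (p + q))) ^ 3 := by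
  set L := |x| + |y| + |z| with hL
  have hx : |x| ≤ L := by rw [hL]; linarith [abs_nonneg y, abs_nonneg z]
  have hy : |y| ≤ L := by rw [hL]; linarith [abs_nonneg x, abs_nonneg z]
  have hz : |z| ≤ L := by rw [hL]; linarith [abs_nonneg x, abs_nonneg y]
  have hL0 : 0 ≤ L := (abs_nonneg x).trans hx
  have hT : traceTerm (s * x) (s * z) (s * y) p r q = s * traceTerm x z y p r q := by
    simp only [traceTerm]
    ring
  have hΔ : detTerm (s * x) (s * z) (s * y) p r q = s ^ 2 * detTerm x z y p r q := by
    simp only [detTerm]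
    ring
  have hTle : |traceTerm x z y p r q| ≤ L * (p + q) := by
    calc |traceTerm x z y p r q| ≤ |x * p| + |z * r| + |y * q| := abs_add_three _ _ _
      _ = |x| * p + |z| * |r| + |y| * q := by
          rw [abs_mul, abs_mul, abs_mul, abs_of_nonneg hp, abs_of_nonneg hq]
      _ ≤ |x| * (p + q) + |z| * (p + q) + |y| * (p + q) := by
          gcongr
          · linarith
          · linarith
      _ = L * (p + q) := by rw [hL]; ring
  have hdet0 : 0 ≤ p * q - r ^ 2 := sub_nonneg.2 hrr
  have hκ : |x * y - z ^ 2 / 4| ≤ L ^ 2 := by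
    have h1 : |x * y| = |x| * |y| := abs_mul x y
    have h2 : |z ^ 2 / 4| = |z| ^ 2 / 4 := by rw [abs_div, abs_pow]; norm_num
    calc |x * y - z ^ 2 / 4| ≤ |x * y| + |z ^ 2 / 4| := abs_sub _ _
      _ = |x| * |y| + |z| ^ 2 / 4 := by rw [h1, h2]
      _ ≤ L ^ 2 := by
          rw [hL]
          nlinarith [abs_nonneg x, abs_nonneg y, abs_nonneg z, mul_nonneg (abs_nonneg x)
            (abs_nonneg y), mul_nonneg (abs_nonneg x) (abs_nonneg z),
            mul_nonneg (abs_nonneg y) (abs_nonneg z)]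
  have hΔle : |detTerm x z y p r q| ≤ (L * (p + q)) ^ 2 := by
    rw [detTerm, abs_mul, abs_of_nonneg hdet0, mul_pow]
    gcongr
    nlinarith [mul_nonneg hp hq, sq_nonneg r]
  have hm' : L * (s * (p + q)) = s * (L * (p + q)) := by ring
  have hT' : |traceTerm (s * x) (s * z) (s * y) p r q| ≤ L * (s * (p + q)) := by
    rw [hT, abs_mul, abs_of_nonneg hs, hm']
    gcongr
  have hΔ' : |detTerm (s * x) (s * z) (s * y) p r q| ≤ (L * (s * (p + q))) ^ 2 := by
    rw [hΔ, abs_mul, abs_of_nonneg (sq_nonneg s), hm', mul_pow s]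
    gcongr
  obtain ⟨h1, h2⟩ := abs_neg_half_log_sub_le hm hT' hΔ'
  refine ⟨?_, h1, ?_⟩
  · have hw0 : 0 ≤ r ^ 2 / p := by positivity
    have hw1 : r ^ 2 / p ≤ q := by
      rcases hp.eq_or_lt with hp0 | hp0
      · rw [← hp0, div_zero]
        exact hq
      · rw [div_le_iff₀ hp0]
        linarith
    have h3 : |(s * y) * (q - r ^ 2 / p)| ≤ 1 / 16 := by
      rw [abs_mul, abs_mul, abs_of_nonneg hs, abs_of_nonneg (sub_nonneg.2 hw1)]
      calc s * |y| * (q - r ^ 2 / p) ≤ s * L * (p + q) := by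
            gcongr
            linarith
        _ = L * (s * (p + q)) := by ring
        _ ≤ 1 / 16 := hm
    linarith [le_abs_self ((s * y) * (q - r ^ 2 / p))]
  · rw [cellLogLaplace]
    convert! h2 using 3
    rw [hT, hΔ]
    ring

/-- Convergence of the scaled sums of the log-Laplace transforms of the cells. -/
lemma tendsto_sum_cellLogLaplace {p r q : ℕ → ℕ → ℝ} {b M : ℕ → ℝ} (x y z : ℝ)
    (hb : ∀ n, 1 ≤ n → 0 < b n) (hp : ∀ (n k : ℕ), k < n → 0 ≤ p n k)
    (hq : ∀ (n k : ℕ), k < n → 0 ≤ q n k)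
    (hr : ∀ (n k : ℕ), k < n → |r n k| ≤ p n k + q n k)
    (hrr : ∀ (n k : ℕ), k < n → r n k ^ 2 ≤ p n k * q n k) (hM : Tendsto M atTop (𝓝 0))
    (hMle : ∀ (n k : ℕ), k < n → √(n : ℝ) * b n * (p n k + q n k) ≤ M n)
    {App Aqq Apq Arr Apr Aqr : ℝ}
    (hpp : Tendsto (fun n : ℕ => n * ∑ k ∈ Finset.range n, p n k * p n k) atTop (𝓝 App))
    (hqq : Tendsto (fun n : ℕ => n * ∑ k ∈ Finset.range n, q n k * q n k) atTop (𝓝 Aqq))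
    (hpq : Tendsto (fun n : ℕ => n * ∑ k ∈ Finset.range n, p n k * q n k) atTop (𝓝 Apq))
    (hrr' : Tendsto (fun n : ℕ => n * ∑ k ∈ Finset.range n, r n k * r n k) atTop (𝓝 Arr))
    (hpr : Tendsto (fun n : ℕ => n * ∑ k ∈ Finset.range n, p n k * r n k) atTop (𝓝 Apr))
    (hqr : Tendsto (fun n : ℕ => n * ∑ k ∈ Finset.range n, q n k * r n k) atTop (𝓝 Aqr)) :
    (∀ᶠ n : ℕ in atTop, ∀ k < n,
      0 < 1 - 2 * ((√(n : ℝ) * b n * y) * (q n k - r n k ^ 2 / p n k)) ∧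
      0 < 1 - 2 * traceTerm (√(n : ℝ) * b n * x) (√(n : ℝ) * b n * z) (√(n : ℝ) * b n * y)
          (p n k) (r n k) (q n k)
        + 4 * detTerm (√(n : ℝ) * b n * x) (√(n : ℝ) * b n * z) (√(n : ℝ) * b n * y)
          (p n k) (r n k) (q n k)) ∧
    Tendsto (fun n : ℕ => (b n ^ 2)⁻¹ * ∑ k ∈ Finset.range n,
        cellLogLaplace (√(n : ℝ) * b n * x) (√(n : ℝ) * b n * z) (√(n : ℝ) * b n * y)
          (p n k) (r n k) (q n k)) atTop
      (𝓝 (x ^ 2 * App + y ^ 2 * Aqq + z ^ 2 / 2 * Apq + (z ^ 2 / 2 + 2 * x * y) * Arr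
        + 2 * x * z * Apr + 2 * y * z * Aqr)) := by
  set L := |x| + |y| + |z| with hL
  have hL0 : 0 ≤ L := by positivity
  have hLM : Tendsto (fun n => L * M n) atTop (𝓝 0) := by simpa using hM.const_mul L
  have hest : ∀ᶠ n : ℕ in atTop, 1 ≤ n ∧ L * M n ≤ 1 / 16 :=
    (eventually_ge_atTop 1).and (hLM.eventually_le_const (by norm_num))
  have hcell : ∀ n : ℕ, 1 ≤ n → L * M n ≤ 1 / 16 → ∀ k < n,
      L * (√(n : ℝ) * b n * (p n k + q n k)) ≤ 1 / 16 := fun n _ h k hk =>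
    (mul_le_mul_of_nonneg_left (hMle n k hk) hL0).trans h
  have hs : ∀ n : ℕ, 1 ≤ n → 0 ≤ √(n : ℝ) * b n := fun n hn =>
    mul_nonneg (Real.sqrt_nonneg _) (hb n hn).le
  refine ⟨?_, ?_⟩
  · filter_upwards [hest] with n hn k hk
    obtain ⟨h1, h2, -⟩ := cellLogLaplace_estimates (x := x) (y := y) (z := z) (hs n hn.1)
      (hp n k hk) (hq n k hk) (hr n k hk) (hrr n k hk) (hcell n hn.1 hn.2 k hk)
    exact ⟨h1, h2⟩
  -- the leading term
  have hmain : Tendsto (fun n : ℕ => (n : ℝ) * ∑ k ∈ Finset.range n,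
      (traceTerm x z y (p n k) (r n k) (q n k) ^ 2 - 2 * detTerm x z y (p n k) (r n k) (q n k)))
      atTop (𝓝 (x ^ 2 * App + y ^ 2 * Aqq + z ^ 2 / 2 * Apq + (z ^ 2 / 2 + 2 * x * y) * Arr
        + 2 * x * z * Apr + 2 * y * z * Aqr)) := by
    refine ((((((hpp.const_mul (x ^ 2)).add (hqq.const_mul (y ^ 2))).add
      (hpq.const_mul (z ^ 2 / 2))).add (hrr'.const_mul (z ^ 2 / 2 + 2 * x * y))).add
      (hpr.const_mul (2 * x * z))).add (hqr.const_mul (2 * y * z))).congr fun n => ?_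
    simp only [Finset.mul_sum, ← Finset.sum_add_distrib]
    refine Finset.sum_congr rfl fun k _ => ?_
    simp only [traceTerm, detTerm]
    ring
  -- the cubic error
  have hsq : Tendsto (fun n : ℕ => n * ∑ k ∈ Finset.range n, (p n k + q n k) ^ 2) atTop
      (𝓝 (App + 2 * Apq + Aqq)) := by
    refine ((hpp.add (hpq.const_mul 2)).add hqq).congr fun n => ?_
    simp only [Finset.mul_sum, ← Finset.sum_add_distrib]
    refine Finset.sum_congr rfl fun k _ => ?_
    ring
  -- One of the three factors in the cubic error is bounded by `M n → 0`; the other two, summed and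
  -- normalized, converge.
  have herr : Tendsto (fun n : ℕ => 35 * L ^ 2 * ((L * M n) *
      (n * ∑ k ∈ Finset.range n, (p n k + q n k) ^ 2))) atTop (𝓝 0) := by
    simpa using (hLM.mul hsq).const_mul (35 * L ^ 2)
  have hdiff : Tendsto (fun n : ℕ => ((b n ^ 2)⁻¹ * ∑ k ∈ Finset.range n,
        cellLogLaplace (√(n : ℝ) * b n * x) (√(n : ℝ) * b n * z) (√(n : ℝ) * b n * y)
          (p n k) (r n k) (q n k))
      - (n : ℝ) * ∑ k ∈ Finset.range n, (traceTerm x z y (p n k) (r n k) (q n k) ^ 2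
          - 2 * detTerm x z y (p n k) (r n k) (q n k))) atTop (𝓝 0) := by
    refine squeeze_zero_norm' ?_ herr
    filter_upwards [hest] with n hn
    have hbn := hb n hn.1
    -- This is where the scaling fits: the speed `b n ^ 2` cancels and leaves the factor `n` of the
    -- averaging theorem.
    have hsn : (√(n : ℝ) * b n) ^ 2 = n * b n ^ 2 := by
      rw [mul_pow, Real.sq_sqrt n.cast_nonneg]
    have e : ((b n ^ 2)⁻¹ * ∑ k ∈ Finset.range n,
        cellLogLaplace (√(n : ℝ) * b n * x) (√(n : ℝ) * b n * z) (√(n : ℝ) * b n * y)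
          (p n k) (r n k) (q n k))
        - (n : ℝ) * ∑ k ∈ Finset.range n, (traceTerm x z y (p n k) (r n k) (q n k) ^ 2
          - 2 * detTerm x z y (p n k) (r n k) (q n k))
        = (b n ^ 2)⁻¹ * ∑ k ∈ Finset.range n,
          (cellLogLaplace (√(n : ℝ) * b n * x) (√(n : ℝ) * b n * z) (√(n : ℝ) * b n * y)
            (p n k) (r n k) (q n k) - (√(n : ℝ) * b n) ^ 2
              * (traceTerm x z y (p n k) (r n k) (q n k) ^ 2
                - 2 * detTerm x z y (p n k) (r n k) (q n k))) := by
      have hg : ∀ A B : ℕ → ℝ, (b n ^ 2)⁻¹ * ∑ k ∈ Finset.range n, A k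
          - (n : ℝ) * ∑ k ∈ Finset.range n, B k
          = (b n ^ 2)⁻¹ * ∑ k ∈ Finset.range n, (A k - (√(n : ℝ) * b n) ^ 2 * B k) := by
        intro A B
        rw [Finset.sum_sub_distrib, ← Finset.mul_sum, hsn]
        field_simp
      exact hg _ _
    rw [e, norm_mul, norm_inv, Real.norm_of_nonneg (sq_nonneg (b n))]
    calc (b n ^ 2)⁻¹ * ‖∑ k ∈ Finset.range n,
          (cellLogLaplace (√(n : ℝ) * b n * x) (√(n : ℝ) * b n * z) (√(n : ℝ) * b n * y)
            (p n k) (r n k) (q n k) - (√(n : ℝ) * b n) ^ 2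
              * (traceTerm x z y (p n k) (r n k) (q n k) ^ 2
                - 2 * detTerm x z y (p n k) (r n k) (q n k)))‖
        ≤ (b n ^ 2)⁻¹ * ∑ k ∈ Finset.range n,
            35 * L ^ 2 * ((L * M n) * ((√(n : ℝ) * b n) ^ 2 * (p n k + q n k) ^ 2)) := by
          gcongr
          refine norm_sum_le_of_le _ fun k hk => ?_
          have hk' := Finset.mem_range.1 hk
          obtain ⟨-, -, h3⟩ := cellLogLaplace_estimates (x := x) (y := y) (z := z) (hs n hn.1)
            (hp n k hk') (hq n k hk') (hr n k hk') (hrr n k hk') (hcell n hn.1 hn.2 k hk')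
          refine h3.trans ?_
          have h4 : 0 ≤ 35 * L ^ 2 * (L * ((√(n : ℝ) * b n) ^ 2 * (p n k + q n k) ^ 2)) := by
            positivity
          have h5 := mul_le_mul_of_nonneg_left (hMle n k hk') h4
          calc 35 * (L * (√(n : ℝ) * b n * (p n k + q n k))) ^ 3
              = 35 * L ^ 2 * (L * ((√(n : ℝ) * b n) ^ 2 * (p n k + q n k) ^ 2))
                * (√(n : ℝ) * b n * (p n k + q n k)) := by ring
            _ ≤ 35 * L ^ 2 * (L * ((√(n : ℝ) * b n) ^ 2 * (p n k + q n k) ^ 2)) * M n := h5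
            _ = 35 * L ^ 2 * ((L * M n) * ((√(n : ℝ) * b n) ^ 2 * (p n k + q n k) ^ 2)) := by
                ring
      _ = 35 * L ^ 2 * ((L * M n) * (n * ∑ k ∈ Finset.range n, (p n k + q n k) ^ 2)) := by
          simp only [← Finset.mul_sum]
          rw [hsn]
          field_simp
  simpa using hdiff.add hmain

end LogLaplace

/-! ### Increments of Wiener integrals -/

section Increments

variable {Ω : Type*} [MeasurableSpace Ω] {P : Measure Ω}

/-- The increment of a process over the `k`-th cell `(k / n, (k + 1) / n]`. -/
noncomputable def cellIncrement (Z : ℝ → Ω → ℝ) (n k : ℕ) (ω : Ω) : ℝ :=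
  Z (((k : ℝ) + 1) / n) ω - Z ((k : ℝ) / n) ω

omit [MeasurableSpace Ω] in
lemma realizedCov_one (Z Z' : ℝ → Ω → ℝ) (n : ℕ) (ω : Ω) :
    realizedCov Z Z' n 1 ω
      = ∑ k ∈ Finset.range n, cellIncrement Z n k ω * cellIncrement Z' n k ω := by
  have h1 : Finset.Icc 1 n = Finset.Ico (0 + 1) (n + 1) := by
    ext k
    simp
  rw [realizedCov, mul_one, Nat.floor_natCast, h1, ← Finset.sum_Ico_add', Finset.range_eq_Ico]
  refine Finset.sum_congr rfl fun k _ => ?_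
  simp [increment, cellIncrement]

lemma div_mem_Icc {n k : ℕ} (hk : k ≤ n) : (k : ℝ) / n ∈ Icc (0 : ℝ) 1 :=
  ⟨by positivity, div_le_one_of_le₀ (by exact_mod_cast hk) n.cast_nonneg⟩

lemma succ_div_mem_Icc {n k : ℕ} (hk : k < n) : ((k : ℝ) + 1) / n ∈ Icc (0 : ℝ) 1 := by
  exact_mod_cast div_mem_Icc (Nat.succ_le_of_lt hk)

/-- The covariance of the increments over two cells of two Wiener integrals. -/
theorem integral_cellIncrement_mul {B B' Z Z' : ℝ → Ω → ℝ} {f g κ w : ℝ → ℝ}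
    (hB : ∀ s ∈ Icc (0 : ℝ) 1, MemLp (B s) 2 P) (hB' : ∀ s ∈ Icc (0 : ℝ) 1, MemLp (B' s) 2 P)
    (hκm : AEStronglyMeasurable κ (volume.restrict (Ioc 0 1)))
    (hκ : ∀ u ∈ Ioc (0 : ℝ) 1, |κ u| ≤ 1) (hcov : HasCovarianceDensity P B B' κ)
    (hZ : ∀ t ∈ Icc (0 : ℝ) 1, IsStochIntegral P B f t (Z t))
    (hZ' : ∀ t ∈ Icc (0 : ℝ) 1, IsStochIntegral P B' g t (Z' t))
    (hw : ∀ u, f u * (κ u * g u) = w u) (hwi : IntegrableOn w (Icc 0 1)) {n j k : ℕ}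
    (hj : j < n) (hk : k < n) :
    ∫ ω, cellIncrement Z n j ω * cellIncrement Z' n k ω ∂P
      = if j = k then cellIntegral w n k else 0 := by
  have key : ∀ t ∈ Icc (0 : ℝ) 1, ∀ t' ∈ Icc (0 : ℝ) 1,
      ∫ ω, Z t ω * Z' t' ω ∂P = ∫ u in (0 : ℝ)..(min t t'), w u := by
    intro t ht t' ht'
    rw [IsStochIntegral.integral_mul_eq hB hB' hκm hκ hcov ht.2 ht'.2 (hZ t ht) (hZ' t' ht'),
      intervalIntegral.integral_of_le (le_min ht.1 ht'.1)]
    simp_rw [hw]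
  have hint : ∀ t ∈ Icc (0 : ℝ) 1, ∀ t' ∈ Icc (0 : ℝ) 1,
      Integrable (fun ω => Z t ω * Z' t' ω) P := fun t ht t' ht' =>
    (hZ t ht).memLp.integrable_mul (hZ' t' ht').memLp
  have hexp : ∀ s ∈ Icc (0 : ℝ) 1, ∀ t ∈ Icc (0 : ℝ) 1, ∀ s' ∈ Icc (0 : ℝ) 1,
      ∀ t' ∈ Icc (0 : ℝ) 1, ∫ ω, (Z t ω - Z s ω) * (Z' t' ω - Z' s' ω) ∂P
        = (∫ ω, Z t ω * Z' t' ω ∂P) - (∫ ω, Z t ω * Z' s' ω ∂P)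
          - ((∫ ω, Z s ω * Z' t' ω ∂P) - ∫ ω, Z s ω * Z' s' ω ∂P) := by
    intro s hs t ht s' hs' t' ht'
    have e : ∀ ω, (Z t ω - Z s ω) * (Z' t' ω - Z' s' ω)
        = (Z t ω * Z' t' ω - Z t ω * Z' s' ω) - (Z s ω * Z' t' ω - Z s ω * Z' s' ω) := fun ω => by
      ring
    simp_rw [e]
    have i1 : Integrable (fun ω => Z t ω * Z' t' ω - Z t ω * Z' s' ω) P :=
      (hint t ht t' ht').sub (hint t ht s' hs')
    have i2 : Integrable (fun ω => Z s ω * Z' t' ω - Z s ω * Z' s' ω) P :=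
      (hint s hs t' ht').sub (hint s hs s' hs')
    rw [integral_sub i1 i2, integral_sub (hint t ht t' ht')
        (hint t ht s' hs'), integral_sub (hint s hs t' ht') (hint s hs s' hs')]
  have hj0 := div_mem_Icc hj.le
  have hj1 := succ_div_mem_Icc hj
  have hk0 := div_mem_Icc hk.le
  have hk1 := succ_div_mem_Icc hk
  simp only [cellIncrement]
  rw [hexp _ hj0 _ hj1 _ hk0 _ hk1, key _ hj1 _ hk1, key _ hj1 _ hk0, key _ hj0 _ hk1,
    key _ hj0 _ hk0]
  have hlt : ∀ {i l : ℕ}, i < l → ((i : ℝ) + 1) / n ≤ (l : ℝ) / n := fun {i l} h => by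
    gcongr
    exact_mod_cast h
  have hcj := cell_le n j
  have hck := cell_le n k
  -- On the diagonal the minima leave the difference of two integrals from `0`; for distinct cells
  -- the four terms cancel in pairs.
  split_ifs with hjk
  · subst hjk
    rw [min_self, min_self, min_eq_right hcj, min_eq_left hcj, sub_self, sub_zero, cellIntegral]
    refine intervalIntegral.integral_interval_sub_left ?_ ?_
    · exact (hwi.mono_set (uIcc_subset_Icc (by simp) hj1)).intervalIntegrable
    · exact (hwi.mono_set (uIcc_subset_Icc (by simp) hj0)).intervalIntegrable
  · rcases lt_or_gt_of_ne hjk with h | h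
    · have h1 := hlt h
      rw [min_eq_left (h1.trans hck), min_eq_left h1, min_eq_left ((hcj.trans h1).trans hck),
        min_eq_left (hcj.trans h1)]
      ring
    · have h1 := hlt h
      rw [min_eq_right (h1.trans hcj), min_eq_right ((hck.trans h1).trans hcj), min_eq_right h1,
        min_eq_right (hck.trans h1)]
      ring

end Increments

/-! ### The drift -/

section Drift

variable {Ω : Type*} [MeasurableSpace Ω] {P : Measure Ω} [IsProbabilityMeasure P]

/-- The bound is the essential supremum; Fubini turns a null set of the product into a statement
about almost every path. -/
lemma BoundedDrift.exists_bound {b : ℝ → Ω → ℝ} (h : BoundedDrift P b) :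
    ∃ K : ℝ, 0 ≤ K ∧ ∀ᵐ ω ∂P, IntegrableOn (fun s => b s ω) (Icc 0 1) ∧
      ∀ᵐ s ∂(volume.restrict (Icc (0 : ℝ) 1)), |b s ω| ≤ K := by
  obtain ⟨K, hK0, hK⟩ : ∃ K : ℝ, 0 ≤ K ∧ ∀ᵐ z ∂((volume.restrict (Icc (0 : ℝ) 1)).prod P),
      |b z.1 z.2| ≤ K := by
    refine ⟨(eLpNormEssSup (Function.uncurry b)
      ((volume.restrict (Icc (0 : ℝ) 1)).prod P)).toReal, ENNReal.toReal_nonneg, ?_⟩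
    have hfin := h.2
    rw [eLpNorm_exponent_top] at hfin
    filter_upwards [enorm_ae_le_eLpNormEssSup (Function.uncurry b)
      ((volume.restrict (Icc (0 : ℝ) 1)).prod P)] with z hz
    have := ENNReal.toReal_mono hfin.ne hz
    rwa [toReal_enorm] at this
  refine ⟨K, hK0, ?_⟩
  have hswap := (Measure.measurePreserving_swap
    (μ := P) (ν := volume.restrict (Icc (0 : ℝ) 1))).quasiMeasurePreserving.ae hK
  filter_upwards [Measure.ae_ae_of_ae_prod hswap, h.1.prod_swap.prodMk_left] with ω h1 h2
  exact ⟨Integrable.of_bound h2 K h1, h1⟩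

lemma BoundedDrift.aemeasurable_integral {b : ℝ → Ω → ℝ} (h : BoundedDrift P b) {t : ℝ}
    (ht : t ∈ Icc (0 : ℝ) 1) : AEMeasurable (fun ω => ∫ s in (0 : ℝ)..t, b s ω) P := by
  have h1 : AEStronglyMeasurable (Function.uncurry b) ((volume.restrict (Ioc (0 : ℝ) t)).prod P) :=
    h.1.mono_measure (Measure.prod_mono (Measure.restrict_mono
      (Ioc_subset_Icc_self.trans (Icc_subset_Icc_right ht.2)) le_rfl) le_rfl)
  simp_rw [intervalIntegral.integral_of_le ht.1]
  exact h1.prod_swap.integral_prod_right'.aemeasurable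

/-- The increments of a bounded drift over the cells are of order `1 / n`. -/
lemma BoundedDrift.exists_cellIncrement_le {b : ℝ → Ω → ℝ} (h : BoundedDrift P b) :
    ∃ K : ℝ, 0 ≤ K ∧ ∀ᵐ ω ∂P, ∀ n k : ℕ, k < n →
      |cellIncrement (fun t ω => ∫ s in (0 : ℝ)..t, b s ω) n k ω| ≤ K / n := by
  obtain ⟨K, hK0, hK⟩ := h.exists_bound
  refine ⟨K, hK0, ?_⟩
  filter_upwards [hK] with ω hω n k hk
  have hn : n ≠ 0 := by omega
  rw [cellIncrement, intervalIntegral.integral_interval_sub_left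
    (hω.1.mono_set (uIcc_subset_Icc (by simp) (succ_div_mem_Icc hk))).intervalIntegrable
    (hω.1.mono_set (uIcc_subset_Icc (by simp) (div_mem_Icc hk.le))).intervalIntegrable]
  have h1 := intervalIntegral.norm_integral_le_of_norm_le_const_ae (a := (k : ℝ) / n)
    (b := ((k : ℝ) + 1) / n) (f := fun s => b s ω) (C := K) ?_
  · rwa [cell_length hn, abs_of_nonneg (by positivity), ← div_eq_mul_inv] at h1
  · filter_upwards [(ae_restrict_iff' measurableSet_Icc).1 hω.2] with s hs hs'
    exact hs (cell_subset hk (uIoc_subset_uIcc hs'))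

/-- A perturbation of order `1 / n` of the increments changes the sum of their products by
`O(n^{-1/2})`. -/
lemma sqrt_mul_abs_sum_mul_sub_le {n : ℕ} {u v a c : ℕ → ℝ} {K : ℝ} (hK : 0 ≤ K)
    (ha : ∀ k < n, |a k| ≤ K / n) (hc : ∀ k < n, |c k| ≤ K / n) :
    √(n : ℝ) * |∑ k ∈ Finset.range n, (u k + a k) * (v k + c k)
        - ∑ k ∈ Finset.range n, u k * v k|
      ≤ K * (2 + ∑ k ∈ Finset.range n, u k * u k + ∑ k ∈ Finset.range n, v k * v k) + K ^ 2 := by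
  rcases Nat.eq_zero_or_pos n with rfl | hn
  · simp
    positivity
  have hn1 : (1 : ℝ) ≤ n := by exact_mod_cast hn
  have hr : 1 ≤ √(n : ℝ) := Real.one_le_sqrt.2 hn1
  have hrr : √(n : ℝ) * √(n : ℝ) = n := Real.mul_self_sqrt n.cast_nonneg
  set r := √(n : ℝ) with hrdef
  have hr0 : 0 < r := by linarith
  -- Weighted AM-GM trades the terms linear in the increments for their sums of squares; summing
  -- `1/n` over `n` cells costs only a constant.
  have habs : ∀ x : ℝ, |x| ≤ r * (1 / n + x * x) := by
    intro x
    rw [← hrr]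
    have : r * (1 / (r * r) + x * x) = r⁻¹ + r * (|x| * |x|) := by
      rw [abs_mul_abs_self]
      field_simp
    rw [this]
    have h2 : 0 ≤ r⁻¹ * (r * |x| - 1 / 2) ^ 2 := by positivity
    have h3 : r⁻¹ * (r * |x| - 1 / 2) ^ 2 = r * (|x| * |x|) - |x| + r⁻¹ / 4 := by
      field_simp
      ring
    have h4 : 0 < r⁻¹ := by positivity
    linarith
  have hterm : ∀ k ∈ Finset.range n, |(u k + a k) * (v k + c k) - u k * v k|
      ≤ K / n * (r * (1 / n + u k * u k)) + K / n * (r * (1 / n + v k * v k))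
        + K / n * (K / n) := by
    intro k hk
    have hk := Finset.mem_range.1 hk
    have e : (u k + a k) * (v k + c k) - u k * v k = c k * u k + a k * v k + a k * c k := by ring
    rw [e]
    refine (abs_add_three _ _ _).trans ?_
    rw [abs_mul, abs_mul, abs_mul]
    have hKn : 0 ≤ K / n := by positivity
    gcongr
    · exact hc k hk
    · exact habs _
    · exact ha k hk
    · exact habs _
    · exact ha k hk
    · exact hc k hk
  rw [← Finset.sum_sub_distrib]
  calc r * |∑ k ∈ Finset.range n, ((u k + a k) * (v k + c k) - u k * v k)|
      ≤ r * ∑ k ∈ Finset.range n, (K / n * (r * (1 / n + u k * u k))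
        + K / n * (r * (1 / n + v k * v k)) + K / n * (K / n)) := by
        gcongr
        exact (Finset.abs_sum_le_sum_abs _ _).trans (Finset.sum_le_sum hterm)
    _ = K * (2 + ∑ k ∈ Finset.range n, u k * u k + ∑ k ∈ Finset.range n, v k * v k)
        + K ^ 2 * r⁻¹ := by
        simp only [Finset.sum_add_distrib, ← Finset.mul_sum, Finset.sum_const, Finset.card_range,
          nsmul_eq_mul]
        rw [← hrr]
        field_simp
        ring
    _ ≤ K * (2 + ∑ k ∈ Finset.range n, u k * u k + ∑ k ∈ Finset.range n, v k * v k) + K ^ 2 := by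
        gcongr
        exact mul_le_of_le_one_right (sq_nonneg K) (inv_le_one_of_one_le₀ hr)

end Drift

/-! ### Moderate deviations of the realized covariance vector -/

section ModerateDeviations

variable {Ω : Type*} [MeasurableSpace Ω] {P : Measure Ω}

lemma MaxCondition.mul_cellIntegral_le {σ : ℝ → ℝ} {s : ℝ} (hs : 0 ≤ s) {n k : ℕ} (hk : k < n) :
    s * cellIntegral (fun t => σ t ^ 2) n k
      ≤ s * ⨆ k : Fin n, ∫ t in ((k : ℝ) / n)..(((k : ℝ) + 1) / n), σ t ^ 2 :=
  mul_le_mul_of_nonneg_left (le_ciSup (f := fun k : Fin n =>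
    ∫ t in ((k : ℝ) / n)..(((k : ℝ) + 1) / n), σ t ^ 2) (finite_range _).bddAbove ⟨k, hk⟩) hs

/-- The normalized error `(√n / b_n) (V_1^n - [V]_1)` of the realized covariance vector. -/
noncomputable def normalizedError (σ₁ σ₂ ρ : ℝ → ℝ) (b : ℕ → ℝ) (X₁ X₂ : ℝ → Ω → ℝ) (n : ℕ)
    (ω : Ω) : Fin 3 → ℝ :=
  (√(n : ℝ) / b n) • (realizedVector X₁ X₂ n 1 ω - integratedVector σ₁ σ₂ ρ 1)

variable {σ₁ σ₂ ρ : ℝ → ℝ} {b : ℕ → ℝ} {B₁ B₂ B₃ Z₁ Z₂ : ℝ → Ω → ℝ}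

omit [MeasurableSpace Ω] in
/-- The exponent of the Laplace transform of the normalized error is a centered quadratic form. -/
lemma sq_mul_dotProduct_normalizedError (h : VolatilityCoefficients σ₁ σ₂ ρ) {n : ℕ} (hn : n ≠ 0)
    (hb : b n ≠ 0) (l : Fin 3 → ℝ) (ω : Ω) :
    b n ^ 2 * (l ⬝ᵥ normalizedError σ₁ σ₂ ρ b Z₁ Z₂ n ω)
      = ∑ k : Fin n, (√(n : ℝ) * b n * l 0
            * (cellIncrement Z₁ n k ω * cellIncrement Z₁ n k ω)
          + √(n : ℝ) * b n * l 1 * (cellIncrement Z₂ n k ω * cellIncrement Z₂ n k ω)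
          + √(n : ℝ) * b n * l 2 * (cellIncrement Z₁ n k ω * cellIncrement Z₂ n k ω))
        - ∑ k : Fin n, traceTerm (√(n : ℝ) * b n * l 0) (√(n : ℝ) * b n * l 2)
            (√(n : ℝ) * b n * l 1) (cellIntegral (fun t => σ₁ t ^ 2) n k)
            (cellIntegral (fun t => σ₁ t * σ₂ t * ρ t) n k)
            (cellIntegral (fun t => σ₂ t ^ 2) n k) := by
  have e : ∀ f : ℝ → ℝ, MemLp f 2 (volume.restrict (Icc (0 : ℝ) 1)) →
      ∫ t in (0 : ℝ)..1, f t = ∑ k ∈ Finset.range n, cellIntegral f n k := fun f hf =>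
    (sum_cellIntegral hn fun k hk => intervalIntegrable_cell
      (VolatilityCoefficients.integrableOn_of_memLp hf) hk).symm
  simp only [traceTerm, Finset.sum_add_distrib, ← Finset.mul_sum]
  rw [Fin.sum_univ_eq_sum_range (fun k => cellIncrement Z₁ n k ω * cellIncrement Z₁ n k ω),
    Fin.sum_univ_eq_sum_range (fun k => cellIncrement Z₂ n k ω * cellIncrement Z₂ n k ω),
    Fin.sum_univ_eq_sum_range (fun k => cellIncrement Z₁ n k ω * cellIncrement Z₂ n k ω),
    Fin.sum_univ_eq_sum_range (fun k => cellIntegral (fun t => σ₁ t ^ 2) n k),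
    Fin.sum_univ_eq_sum_range (fun k => cellIntegral (fun t => σ₁ t * σ₂ t * ρ t) n k),
    Fin.sum_univ_eq_sum_range (fun k => cellIntegral (fun t => σ₂ t ^ 2) n k)]
  rw [← e _ h.memLp_sq₁, ← e _ h.memLp_sq₂, ← e _ h.memLp_mul_corr, ← realizedCov_one,
    ← realizedCov_one, ← realizedCov_one]
  simp only [normalizedError, dotProduct, Fin.sum_univ_three, realizedVector, integratedVector,
    Pi.smul_apply, Pi.sub_apply, smul_eq_mul, Matrix.cons_val]
  field_simp
  ring

lemma memL2_cellIncrement {S : Submodule ℝ (Lp ℝ 2 P)} {Z : ℝ → Ω → ℝ}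
    (hZ : ∀ t ∈ Icc (0 : ℝ) 1, MemL2 S (Z t)) {n k : ℕ} (hk : k < n) :
    MemL2 S (cellIncrement Z n k) :=
  (hZ _ (succ_div_mem_Icc hk)).sub (hZ _ (div_mem_Icc hk.le))

/-- The scaled log-Laplace transform equals the normalized sum of the `cellLogLaplace` terms as soon
as the determinants are positive, which holds for all large `n`. -/
theorem hasQuadraticLogLaplaceLimit_normalizedError [IsProbabilityMeasure P]
    (h : VolatilityCoefficients σ₁ σ₂ ρ) (hMDP : MDPCondition σ₁ σ₂ ρ b)
    (hB : AreCorrelatedBrownianMotions P ρ B₁ B₂ B₃)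
    (hZ₁ : ∀ t ∈ Icc (0 : ℝ) 1, IsStochIntegral P B₁ σ₁ t (Z₁ t))
    (hZ₂ : ∀ t ∈ Icc (0 : ℝ) 1, IsStochIntegral P B₂ σ₂ t (Z₂ t)) :
    HasQuadraticLogLaplaceLimit P (normalizedError σ₁ σ₂ ρ b Z₁ Z₂) (fun n => b n ^ 2)
      (covMatrix σ₁ σ₂ ρ) := by
  intro l
  have hs : ∀ n k : ℕ, k < n → 0 ≤ √(n : ℝ) * b n := fun n k hk =>
    mul_nonneg (Real.sqrt_nonneg _) (hMDP.pos n (by omega)).le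
  obtain ⟨hpos, hlim⟩ := tendsto_sum_cellLogLaplace
    (p := cellIntegral fun t => σ₁ t ^ 2) (r := cellIntegral fun t => σ₁ t * σ₂ t * ρ t)
    (q := cellIntegral fun t => σ₂ t ^ 2) (l 0) (l 1) (l 2) hMDP.pos
    (fun n k _ => VolatilityCoefficients.cellIntegral_sq_nonneg σ₁ n k)
    (fun n k _ => VolatilityCoefficients.cellIntegral_sq_nonneg σ₂ n k)
    (fun n k hk => h.abs_cellIntegral_mul_corr_le hk)
    (fun n k hk => h.sq_cellIntegral_mul_corr_le hk)
    (by simpa using hMDP.max₁.add hMDP.max₂)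
    (fun n k hk => by
      rw [mul_add]
      exact add_le_add (MaxCondition.mul_cellIntegral_le (hs n k hk) hk)
        (MaxCondition.mul_cellIntegral_le (hs n k hk) hk))
    (tendsto_mul_sum_cellIntegral_mul h.memLp_sq₁ h.memLp_sq₁)
    (tendsto_mul_sum_cellIntegral_mul h.memLp_sq₂ h.memLp_sq₂)
    (tendsto_mul_sum_cellIntegral_mul h.memLp_sq₁ h.memLp_sq₂)
    (tendsto_mul_sum_cellIntegral_mul h.memLp_mul_corr h.memLp_mul_corr)
    (tendsto_mul_sum_cellIntegral_mul h.memLp_sq₁ h.memLp_mul_corr)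
    (tendsto_mul_sum_cellIntegral_mul h.memLp_sq₂ h.memLp_mul_corr)
  rw [← half_quadratic_covMatrix (VolatilityCoefficients.intervalIntegrable_mul h.memLp_sq₁
    h.memLp_sq₂) (VolatilityCoefficients.intervalIntegrable_mul h.memLp_mul_corr
    h.memLp_mul_corr)] at hlim
  refine ⟨_, hlim, ?_⟩
  obtain ⟨S, hS, hSg, hS₁, hS₂⟩ := hB.exists_gaussianSpace
  have hm₁ : ∀ t ∈ Icc (0 : ℝ) 1, MemL2 S (Z₁ t) := fun t ht => (hZ₁ t ht).memL2 hS hS₁ ht.2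
  have hm₂ : ∀ t ∈ Icc (0 : ℝ) 1, MemL2 S (Z₂ t) := fun t ht => (hZ₂ t ht).memL2 hS hS₂ ht.2
  have hL₁ := fun s (hs : s ∈ Icc (0 : ℝ) 1) => hB.brownian₁.memLp hs
  have hL₂ := fun s (hs : s ∈ Icc (0 : ℝ) 1) => hB.brownian₂.memLp hs
  have c₁₁ := fun n j k => integral_cellIncrement_mul (n := n) (j := j) (k := k)
    (w := fun t => σ₁ t ^ 2) hL₁ hL₁ aestronglyMeasurable_const (by simp)
    hB.brownian₁.hasCovarianceDensity_self hZ₁ hZ₁ (fun u => by ring)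
    (VolatilityCoefficients.integrableOn_of_memLp h.memLp_sq₁)
  have c₂₂ := fun n j k => integral_cellIncrement_mul (n := n) (j := j) (k := k)
    (w := fun t => σ₂ t ^ 2) hL₂ hL₂ aestronglyMeasurable_const (by simp)
    hB.brownian₂.hasCovarianceDensity_self hZ₂ hZ₂ (fun u => by ring)
    (VolatilityCoefficients.integrableOn_of_memLp h.memLp_sq₂)
  have c₁₂ := fun n j k => integral_cellIncrement_mul (n := n) (j := j) (k := k)
    (w := fun t => σ₁ t * σ₂ t * ρ t) hL₁ hL₂
    (h.aemeasurable_corr.aestronglyMeasurable.mono_measure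
      (Measure.restrict_mono Ioc_subset_Icc_self le_rfl))
    (fun u hu => abs_le.2 ⟨(h.corr_mem u (Ioc_subset_Icc_self hu)).1.le,
      (h.corr_mem u (Ioc_subset_Icc_self hu)).2.le⟩)
    hB.hasCovarianceDensity₁₂ hZ₁ hZ₂ (fun u => by ring)
    (VolatilityCoefficients.integrableOn_of_memLp h.memLp_mul_corr)
  filter_upwards [hpos, eventually_ge_atTop 1] with n hn h1n
  have hbn := hMDP.pos n h1n
  have hne : ∀ {j k : Fin n}, j ≠ k → (j : ℕ) ≠ k := fun hjk => Fin.val_injective.ne hjk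
  have hmgf := MemL2.lintegral_exp_sum_quadratic hSg
    (U := fun k : Fin n => cellIncrement Z₁ n k) (V := fun k : Fin n => cellIncrement Z₂ n k)
    (fun k => memL2_cellIncrement hm₁ k.2) (fun k => memL2_cellIncrement hm₂ k.2)
    (fun k => (c₁₁ n k k k.2 k.2).trans (if_pos rfl))
    (fun k => (c₁₂ n k k k.2 k.2).trans (if_pos rfl))
    (fun k => (c₂₂ n k k k.2 k.2).trans (if_pos rfl))
    (fun j k hjk => (c₁₁ n j k j.2 k.2).trans (if_neg (hne hjk)))
    (fun j k hjk => (c₁₂ n j k j.2 k.2).trans (if_neg (hne hjk)))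
    (fun j k hjk => (c₂₂ n j k j.2 k.2).trans (if_neg (hne hjk)))
    (fun k => h.cellIntegral_sq₁_pos k.2)
    (fun k => (hn k k.2).1) (fun k => (hn k k.2).2)
  -- The trace terms are deterministic, so they factor out of the expectation and recombine with the
  -- log determinants.
  simp_rw [sq_mul_dotProduct_normalizedError h (by omega : n ≠ 0) hbn.ne', sub_eq_add_neg,
    Real.exp_add, ENNReal.ofReal_mul (Real.exp_nonneg _)]
  rw [lintegral_mul_const' _ _ ENNReal.ofReal_ne_top, hmgf, ← ENNReal.ofReal_mul
    (Real.exp_nonneg _), ← Real.exp_add, mul_inv_cancel_left₀ (pow_ne_zero 2 hbn.ne'),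
    ← Fin.sum_univ_eq_sum_range, ← sub_eq_add_neg, ← Finset.sum_sub_distrib]
  rfl

omit [MeasurableSpace Ω] in
-- Undoing the normalization bounds the realized variance by a constant plus a multiple of the error
-- itself. This makes the effect of the drift relative to the size of the error.
lemma realizedCov_self_le {Z : ℝ → Ω → ℝ} {n : ℕ} {ω : Ω} {β C N : ℝ} (hβ : n ≠ 0 → β ≠ 0)
    (hN : |√(n : ℝ) / β * (realizedCov Z Z n 1 ω - C)| ≤ N) :
    realizedCov Z Z n 1 ω ≤ |C| + |β / √(n : ℝ)| * N := by
  rcases eq_or_ne n 0 with rfl | hn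
  · simp [realizedCov]
  have hr : √(n : ℝ) ≠ 0 := (Real.sqrt_pos.2 (by exact_mod_cast Nat.pos_of_ne_zero hn)).ne'
  have h0 := hβ hn
  have e : realizedCov Z Z n 1 ω
      = C + β / √(n : ℝ) * (√(n : ℝ) / β * (realizedCov Z Z n 1 ω - C)) := by
    field_simp
    ring
  rw [e]
  refine add_le_add (le_abs_self _) ((le_abs_self _).trans ?_)
  rw [abs_mul]
  gcongr

omit [MeasurableSpace Ω] in
/-- Perturbing the processes by drifts of bounded density changes the normalized error by
`O(1 / b_n)`, relative to its size. -/
lemma norm_normalizedError_sub_le {X₁ X₂ A₁ A₂ : ℝ → Ω → ℝ} {n : ℕ} {ω : Ω} {K : ℝ} (hK : 0 ≤ K)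
    (hb : n ≠ 0 → b n ≠ 0)
    (hX₁ : ∀ k, cellIncrement X₁ n k ω = cellIncrement Z₁ n k ω + cellIncrement A₁ n k ω)
    (hX₂ : ∀ k, cellIncrement X₂ n k ω = cellIncrement Z₂ n k ω + cellIncrement A₂ n k ω)
    (hA₁ : ∀ k < n, |cellIncrement A₁ n k ω| ≤ K / n)
    (hA₂ : ∀ k < n, |cellIncrement A₂ n k ω| ≤ K / n) :
    ‖normalizedError σ₁ σ₂ ρ b X₁ X₂ n ω - normalizedError σ₁ σ₂ ρ b Z₁ Z₂ n ω‖
      ≤ |1 / b n| * (K * (2 + 2 * |∫ s in (0 : ℝ)..1, σ₁ s ^ 2| + 2 * |∫ s in (0 : ℝ)..1, σ₂ s ^ 2|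
          + 4 * |b n / √(n : ℝ)|) + K ^ 2) * (1 + ‖normalizedError σ₁ σ₂ ρ b Z₁ Z₂ n ω‖) := by
  set D := normalizedError σ₁ σ₂ ρ b Z₁ Z₂ n ω with hD
  set C₁ := ∫ s in (0 : ℝ)..1, σ₁ s ^ 2
  set C₂ := ∫ s in (0 : ℝ)..1, σ₂ s ^ 2
  set N := ‖D‖ with hN
  have hN0 : 0 ≤ N := norm_nonneg D
  have hQ₁ : realizedCov Z₁ Z₁ n 1 ω ≤ |C₁| + |b n / √(n : ℝ)| * N :=
    realizedCov_self_le hb (norm_le_pi_norm D 0)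
  have hQ₂ : realizedCov Z₂ Z₂ n 1 ω ≤ |C₂| + |b n / √(n : ℝ)| * N :=
    realizedCov_self_le hb (norm_le_pi_norm D 1)
  have h1 : 0 ≤ |C₁| + |b n / √(n : ℝ)| * N := by positivity
  have h2 : 0 ≤ |C₂| + |b n / √(n : ℝ)| * N := by positivity
  -- Both realized variances are compared with the sum of the two bounds, so that one estimate
  -- serves all three components.
  have key : ∀ {X X' Z Z' A A' : ℝ → Ω → ℝ},
      (∀ k, cellIncrement X n k ω = cellIncrement Z n k ω + cellIncrement A n k ω) →
      (∀ k, cellIncrement X' n k ω = cellIncrement Z' n k ω + cellIncrement A' n k ω) →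
      (∀ k < n, |cellIncrement A n k ω| ≤ K / n) → (∀ k < n, |cellIncrement A' n k ω| ≤ K / n) →
      realizedCov Z Z n 1 ω ≤ (|C₁| + |b n / √(n : ℝ)| * N) + (|C₂| + |b n / √(n : ℝ)| * N) →
      realizedCov Z' Z' n 1 ω ≤ (|C₁| + |b n / √(n : ℝ)| * N) + (|C₂| + |b n / √(n : ℝ)| * N) →
      ∀ c : ℝ, ‖√(n : ℝ) / b n * (realizedCov X X' n 1 ω - c)
        - √(n : ℝ) / b n * (realizedCov Z Z' n 1 ω - c)‖
        ≤ |1 / b n| * (K * (2 + 2 * |C₁| + 2 * |C₂| + 4 * |b n / √(n : ℝ)|) + K ^ 2)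
          * (1 + N) := by
    intro X X' Z Z' A A' hX hX' hA hA' hQ hQ' c
    have e : √(n : ℝ) / b n * (realizedCov X X' n 1 ω - c)
        - √(n : ℝ) / b n * (realizedCov Z Z' n 1 ω - c)
        = 1 / b n * (√(n : ℝ) * (realizedCov X X' n 1 ω - realizedCov Z Z' n 1 ω)) := by ring
    rw [e, norm_mul, norm_mul, Real.norm_of_nonneg (Real.sqrt_nonneg _), Real.norm_eq_abs,
      Real.norm_eq_abs, mul_assoc |1 / b n|]
    refine mul_le_mul_of_nonneg_left ?_ (abs_nonneg _)
    have h3 := sqrt_mul_abs_sum_mul_sub_le (n := n) (u := fun k => cellIncrement Z n k ω)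
      (v := fun k => cellIncrement Z' n k ω) hK hA hA'
    simp_rw [← hX, ← hX', ← realizedCov_one] at h3
    refine h3.trans ?_
    have h4 : 2 + realizedCov Z Z n 1 ω + realizedCov Z' Z' n 1 ω
        ≤ 2 + 2 * |C₁| + 2 * |C₂| + 4 * |b n / √(n : ℝ)| * N := by linarith
    have h5 := mul_le_mul_of_nonneg_left h4 hK
    -- The terms of the expanded product with `1 + N` that the estimate does not use.
    have h6 : 0 ≤ K * (4 * |b n / √(n : ℝ)|) + N * (K * (2 + 2 * |C₁| + 2 * |C₂|) + K ^ 2) := by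
      positivity
    linarith
  refine (pi_norm_le_iff_of_nonneg (by positivity)).2 fun i => ?_
  fin_cases i
  · exact key hX₁ hX₁ hA₁ hA₁ (by linarith) (by linarith) _
  · exact key hX₂ hX₂ hA₂ hA₂ (by linarith) (by linarith) _
  · exact key hX₁ hX₂ hA₁ hA₂ (by linarith) (by linarith) _

lemma aemeasurable_normalizedError {X₁ X₂ : ℝ → Ω → ℝ}
    (h₁ : ∀ n k : ℕ, k < n → AEMeasurable (cellIncrement X₁ n k) P)
    (h₂ : ∀ n k : ℕ, k < n → AEMeasurable (cellIncrement X₂ n k) P) (n : ℕ) :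
    AEMeasurable (normalizedError σ₁ σ₂ ρ b X₁ X₂ n) P := by
  have key : ∀ {X X' : ℝ → Ω → ℝ}, (∀ n k : ℕ, k < n → AEMeasurable (cellIncrement X n k) P) →
      (∀ n k : ℕ, k < n → AEMeasurable (cellIncrement X' n k) P) → ∀ c : ℝ,
      AEMeasurable (fun ω => √(n : ℝ) / b n * (realizedCov X X' n 1 ω - c)) P := by
    intro X X' h h' c
    simp_rw [realizedCov_one]
    exact ((Finset.aemeasurable_fun_sum _ fun k hk => (h n k (Finset.mem_range.1 hk)).mul
      (h' n k (Finset.mem_range.1 hk))).sub_const c).const_mul _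
  refine aemeasurable_pi_iff.2 fun i => ?_
  fin_cases i
  · exact key h₁ h₁ _
  · exact key h₂ h₂ _
  · exact key h₁ h₂ _

lemma aemeasurable_cellIncrement {Z : ℝ → Ω → ℝ} (h : ∀ t ∈ Icc (0 : ℝ) 1, AEMeasurable (Z t) P)
    (n k : ℕ) (hk : k < n) : AEMeasurable (cellIncrement Z n k) P :=
  (h _ (succ_div_mem_Icc hk)).sub (h _ (div_mem_Icc hk.le))

/-- The moderate deviation principle for the realized covariance vector. -/
theorem satisfiesLDP_normalizedError [IsProbabilityMeasure P] {b₁ b₂ X₁ X₂ : ℝ → Ω → ℝ}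
    (h : VolatilityCoefficients σ₁ σ₂ ρ) (hMDP : MDPCondition σ₁ σ₂ ρ b)
    (hB : AreCorrelatedBrownianMotions P ρ B₁ B₂ B₃)
    (hX₁ : IsItoProcess P B₁ σ₁ b₁ X₁) (hX₂ : IsItoProcess P B₂ σ₂ b₂ X₂)
    (hb₁ : BoundedDrift P b₁) (hb₂ : BoundedDrift P b₂) :
    SatisfiesLDP P (normalizedError σ₁ σ₂ ρ b X₁ X₂) (fun n => b n ^ 2)
      (fun x => (((1 / 2) * (x ⬝ᵥ ((covMatrix σ₁ σ₂ ρ)⁻¹ *ᵥ x)) : ℝ) : EReal)) := by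
  have hsum : ∀ (X : ℝ → Ω → ℝ) (d : ℝ → Ω → ℝ) (n k : ℕ) (ω : Ω),
      cellIncrement X n k ω
        = cellIncrement (fun t ω => X t ω - X 0 ω - ∫ s in (0 : ℝ)..t, d s ω) n k ω
          + cellIncrement (fun t ω => ∫ s in (0 : ℝ)..t, d s ω) n k ω := by
    intro X d n k ω
    simp only [cellIncrement]
    ring
  have hmeas : ∀ {B X d : ℝ → Ω → ℝ} {σ : ℝ → ℝ}, IsItoProcess P B σ d X → BoundedDrift P d →
      ∀ n k : ℕ, k < n → AEMeasurable (cellIncrement X n k) P := by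
    intro B X d σ hX hd n k hk
    rw [funext (hsum X d n k)]
    exact (aemeasurable_cellIncrement (fun t ht => (hX t ht).memLp.1.aemeasurable) n k hk).add
      (aemeasurable_cellIncrement (fun t ht => hd.aemeasurable_integral ht) n k hk)
  obtain ⟨K₁, hK₁, hA₁⟩ := hb₁.exists_cellIncrement_le
  obtain ⟨K₂, -, hA₂⟩ := hb₂.exists_cellIncrement_le
  have hinv : Tendsto (fun n => |1 / b n|) atTop (𝓝 0) := by
    simpa using hMDP.tendsto_atTop.inv_tendsto_atTop.abs
  have hε := hinv.mul ((((hMDP.tendsto_div_sqrt.abs.const_mul 4).const_add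
    (2 + 2 * |∫ s in (0 : ℝ)..1, σ₁ s ^ 2| + 2 * |∫ s in (0 : ℝ)..1, σ₂ s ^ 2|)).const_mul
    (max K₁ K₂)).add_const (max K₁ K₂ ^ 2))
  rw [zero_mul] at hε
  refine (hasQuadraticLogLaplaceLimit_normalizedError h hMDP hB hX₁ hX₂).satisfiesLDP
    ((tendsto_pow_atTop two_ne_zero).comp hMDP.tendsto_atTop)
    (aemeasurable_normalizedError
      (aemeasurable_cellIncrement fun t ht => (hX₁ t ht).memLp.1.aemeasurable)
      (aemeasurable_cellIncrement fun t ht => (hX₂ t ht).memLp.1.aemeasurable))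
    h.posDef_covMatrix (aemeasurable_normalizedError (hmeas hX₁ hb₁) (hmeas hX₂ hb₂)) hε
    fun n => ?_
  filter_upwards [hA₁, hA₂] with ω h₁ h₂
  refine norm_normalizedError_sub_le (hK₁.trans (le_max_left _ _))
    (fun hn => (hMDP.pos n (Nat.one_le_iff_ne_zero.2 hn)).ne') (fun k => hsum X₁ b₁ n k ω)
    (fun k => hsum X₂ b₂ n k ω) (fun k hk => (h₁ n k hk).trans ?_)
    (fun k hk => (h₂ n k hk).trans ?_)
  · gcongr
    exact le_max_left _ _
  · gcongr
    exact le_max_right _ _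

end ModerateDeviations

end RealizedVolatility

theorem mainTheorem4 {Ω : Type*} [MeasurableSpace Ω] (P : Measure Ω) [IsProbabilityMeasure P]
    (σ₁ σ₂ ρ : ℝ → ℝ) (b₁ b₂ : ℝ → Ω → ℝ) (B₁ B₂ B₃ X₁ X₂ : ℝ → Ω → ℝ) (b : ℕ → ℝ)
    (hσ₁ : AEMeasurable σ₁ (volume.restrict (Icc (0 : ℝ) 1)))
    (hσ₂ : AEMeasurable σ₂ (volume.restrict (Icc (0 : ℝ) 1)))
    (hρ : AEMeasurable ρ (volume.restrict (Icc (0 : ℝ) 1)))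
    (hσ₁_pos : ∀ t ∈ Icc (0 : ℝ) 1, 0 < σ₁ t)
    (hσ₂_pos : ∀ t ∈ Icc (0 : ℝ) 1, 0 < σ₂ t)
    (hρ_mem : ∀ t ∈ Icc (0 : ℝ) 1, ρ t ∈ Ioo (-1 : ℝ) 1)
    (hσ₁_fourth : IntegrableOn (fun t => σ₁ t ^ 4) (Icc (0 : ℝ) 1))
    (hσ₂_fourth : IntegrableOn (fun t => σ₂ t ^ 4) (Icc (0 : ℝ) 1))
    (hB : AreCorrelatedBrownianMotions P ρ B₁ B₂ B₃)
    (hX₁ : IsItoProcess P B₁ σ₁ b₁ X₁)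
    (hX₂ : IsItoProcess P B₂ σ₂ b₂ X₂)
    (hMDP : MDPCondition σ₁ σ₂ ρ b)
    (hb₁ : BoundedDrift P b₁) (hb₂ : BoundedDrift P b₂) :
    IsUnit (covMatrix σ₁ σ₂ ρ).det ∧
    (∀ x : Fin 3 → ℝ,
      IsLUB (range fun l : Fin 3 → ℝ => l ⬝ᵥ x - (1 / 2) * (l ⬝ᵥ (covMatrix σ₁ σ₂ ρ *ᵥ l)))
        ((1 / 2) * (x ⬝ᵥ ((covMatrix σ₁ σ₂ ρ)⁻¹ *ᵥ x)))) ∧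
    SatisfiesLDP P
      (fun n ω => (√(n : ℝ) / b n) • (realizedVector X₁ X₂ n 1 ω - integratedVector σ₁ σ₂ ρ 1))
      (fun n => b n ^ 2)
      (fun x => (((1 / 2) * (x ⬝ᵥ ((covMatrix σ₁ σ₂ ρ)⁻¹ *ᵥ x)) : ℝ) : EReal)) := by
  have h : VolatilityCoefficients σ₁ σ₂ ρ :=
    ⟨hσ₁, hσ₂, hρ, hσ₁_pos, hσ₂_pos, hρ_mem, hσ₁_fourth, hσ₂_fourth⟩
  exact ⟨h.posDef_covMatrix.det_pos.ne'.isUnit,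
    isLUB_dotProduct_sub_quadratic h.posDef_covMatrix,
    satisfiesLDP_normalizedError h hMDP hB hX₁ hX₂ hb₁ hb₂⟩
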